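/- Let $\mathbb K$ be a field of characteristic zero. An ordered forest is a finite rooted forest with a total order on its vertices, considered up to isomorphism; edges are oriented towards the roots. Let $\mathbf H_o$ be the graded $\mathbb K$-vector space with basis the ordered forests, graded by the number of vertices. The product of two ordered forests $\mathcal F$, $\mathcal G$ is their disjoint union in which every vertex of $\mathcal F$ precedes every vertex of $\mathcal G$ (shifted disjoint union), with the empty forest as unit. An admissible cut of $\mathcal F$ is a set $\vec v$ of vertices such that there is no oriented path between two distinct elements of $\vec v$. Let $\mathrm{Lea}_{\vec v}\mathcal F$ be the subforest induced on the vertices of $\vec v$ and those from which an oriented path leads to an element of $\vec v$, and $\mathrm{Roo}_{\vec v}\mathcal F$ the subforest induced on the other vertices, both with the induced orders. The coproduct is $$\Delta(\mathcal F)=\sum_{\vec v}\mathrm{Roo}_{\vec v}\mathcal F\otimes \mathrm{Lea}_{\vec v}\mathcal F ,$$ the sum being over all admissible cuts of $\mathcal F$, and the counit is $1$ on the empty forest and $0$ on all other forests. A parking function of length $n\ge 0$ is a word $a=a_1\cdots a_n$ of positive integers such that, for all $1\le i\le n$, at least $i$ of its letters are $\le i$. For a word $w$ of length $m$ in the positive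 integers, put $d(w)=\min\{i\ge 1 : \#\{j : w_j\le i\}<i\}$; then $w$ is a parking function if and only if $d(w)=m+1$. The parkization $\mathrm{Park}(w)$ is the parking function obtained from $w$ by decrementing all letters greater than $d(w)$, repeatedly, until the word is a parking function. Let $\mathbf{PQSym}$ be the graded $\mathbb K$-vector space with basis $(\mathbf F_a)$ indexed by all parking functions $a$, graded by the length, with $$\mathbf F_a\,\mathbf F_b=\sum_{c}\mathbf F_c ,\qquad \Delta\,\mathbf F_a=\sum_{uv=a}\mathbf F_{\mathrm{Park}(u)}\otimes\mathbf F_{\mathrm{Park}(v)} .$$ Here $c$ runs over the shuffles of the word $a$ with the word obtained from $b$ by adding the length of $a$ to all letters, and $uv=a$ runs over the factorizations of the word $a$ as a concatenation of two words. The unit is $\mathbf F_\emptyset$, and the counit is $1$ on $\mathbf F_\emptyset$ and $0$ on the other $\mathbf F_a$. Let $\mathbf{PQSym}^*=\bigoplus_n(\mathbf{PQSym}_n)^*$ be its graded dual, whose product and unit are the transposes of the coproduct and counit of $\mathbf{PQSym}$ and whose coproduct and counit are the transposes of the product and unit. **Theorem.** With these operations $\mathbf H_o$, $\mathbf{PQSym}$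 and $\mathbf{PQSym}^*$ are Hopf algebras, and there is an isomorphism of graded Hopf algebras $\mathbf H_o\cong\mathbf{PQSym}^*$, that is, a bijective linear map that preserves products, units, coproducts, counits and degrees. -/

import Mathlib

open scoped TensorProduct

/-! ## Ordered rooted forests -/

/-- An ordered rooted forest: a finite rooted forest with a total order on its vertices. The vertices
are numbered increasingly, so that the vertex set is `Fin size` with its usual order. Edges are
oriented towards the roots: a vertex that is not a root has exactly one outgoing edge, to its
parent, and `parent v = none` says that `v` is a root. There are no oriented cycles. -/
structure OrderedForest where
  size : ℕ
  parent : Fin size → Option (Fin size)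
  acyclic : ∀ v, ¬ Relation.TransGen (fun x y => parent x = some y) v v

namespace OrderedForest

/-- There is an edge from `v` to `w`. -/
def Edge (F : OrderedForest) (v w : Fin F.size) : Prop := F.parent v = some w

/-- There is an oriented path of positive length from `v` to `w`. -/
def Path (F : OrderedForest) : Fin F.size → Fin F.size → Prop := Relation.TransGen F.Edge

/-- `F` has an edge from its `a`-th to its `b`-th vertex. -/
def NatEdge (F : OrderedForest) (a b : ℕ) : Prop :=
  ∃ (ha : a < F.size) (hb : b < F.size), F.parent ⟨a, ha⟩ = some ⟨b, hb⟩

theorem ext_natEdge {F G : OrderedForest} (h : F.size = G.size)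
    (hp : ∀ a b, F.NatEdge a b ↔ G.NatEdge a b) : F = G := by
  obtain ⟨n, p, hF⟩ := F
  obtain ⟨m, q, hG⟩ := G
  obtain rfl : n = m := h
  congr
  funext v
  refine Option.ext fun w => ?_
  have := hp v w
  simp only [NatEdge, v.2, w.2, exists_true_left, Fin.eta] at this
  simpa using this

/-- The forest without vertices. -/
def empty : OrderedForest where
  size := 0
  parent _ := none
  acyclic v := v.elim0

/-- The parent map of the shifted disjoint union. -/
def unionParent (F G : OrderedForest) : Fin (F.size + G.size) → Option (Fin (F.size + G.size)) :=
  Fin.addCases (fun i => (F.parent i).map (Fin.castAdd G.size))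
    (fun j => (G.parent j).map (Fin.natAdd F.size))

theorem unionParent_acyclic (F G : OrderedForest) (v : Fin (F.size + G.size)) :
    ¬ Relation.TransGen (fun x y => unionParent F G x = some y) v v := by
  have hl : ∀ i w, Relation.TransGen (fun x y => unionParent F G x = some y)
      (Fin.castAdd G.size i) w → ∃ j, w = Fin.castAdd G.size j ∧ F.Path i j := by
    intro i w h
    induction h with
    | single h =>
      simp only [unionParent, Fin.addCases_left, Option.map_eq_some_iff] at h
      obtain ⟨j, hj, rfl⟩ := h
      exact ⟨j, rfl, .single hj⟩
    | tail _ h ih =>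
      obtain ⟨j, rfl, hj⟩ := ih
      simp only [unionParent, Fin.addCases_left, Option.map_eq_some_iff] at h
      obtain ⟨k, hk, rfl⟩ := h
      exact ⟨k, rfl, hj.tail hk⟩
  have hr : ∀ i w, Relation.TransGen (fun x y => unionParent F G x = some y)
      (Fin.natAdd F.size i) w → ∃ j, w = Fin.natAdd F.size j ∧ G.Path i j := by
    intro i w h
    induction h with
    | single h =>
      simp only [unionParent, Fin.addCases_right, Option.map_eq_some_iff] at h
      obtain ⟨j, hj, rfl⟩ := h
      exact ⟨j, rfl, .single hj⟩
    | tail _ h ih =>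
      obtain ⟨j, rfl, hj⟩ := ih
      simp only [unionParent, Fin.addCases_right, Option.map_eq_some_iff] at h
      obtain ⟨k, hk, rfl⟩ := h
      exact ⟨k, rfl, hj.tail hk⟩
  intro h
  refine Fin.addCases (motive := fun v => Relation.TransGen
    (fun x y => unionParent F G x = some y) v v → False) (fun i h => ?_) (fun i h => ?_) v h
  · obtain ⟨j, hj, hp⟩ := hl i _ h
    obtain rfl := Fin.castAdd_injective _ _ hj
    exact F.acyclic _ hp
  · obtain ⟨j, hj, hp⟩ := hr i _ h
    obtain rfl := Fin.natAdd_injective _ _ hj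
    exact G.acyclic _ hp

/-- The shifted disjoint union `FG`: the disjoint union of `F` and `G`, all vertices of `F` preceding
all vertices of `G`. -/
def union (F G : OrderedForest) : OrderedForest where
  size := F.size + G.size
  parent := unionParent F G
  acyclic := unionParent_acyclic F G

theorem natEdge_union (F G : OrderedForest) (a b : ℕ) :
    (union F G).NatEdge a b ↔
      F.NatEdge a b ∨ ∃ a' b', a = F.size + a' ∧ b = F.size + b' ∧ G.NatEdge a' b' := by
  constructor
  · rintro ⟨ha, hb, h⟩
    have ha' : a < F.size + G.size := ha
    have hb' : b < F.size + G.size := hb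
    replace h : unionParent F G ⟨a, ha'⟩ = some ⟨b, hb'⟩ := h
    by_cases hF : a < F.size
    · left
      have e : (⟨a, ha'⟩ : Fin (F.size + G.size)) = Fin.castAdd G.size ⟨a, hF⟩ := rfl
      rw [e, unionParent, Fin.addCases_left, Option.map_eq_some_iff] at h
      obtain ⟨w, hw, hwb⟩ := h
      obtain rfl : (w : ℕ) = b := congrArg Fin.val hwb
      exact ⟨hF, w.2, hw⟩
    · right
      have e : (⟨a, ha'⟩ : Fin (F.size + G.size)) =
          Fin.natAdd F.size ⟨a - F.size, by omega⟩ := Fin.ext (by simp; omega)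
      rw [e, unionParent, Fin.addCases_right, Option.map_eq_some_iff] at h
      obtain ⟨w, hw, hwb⟩ := h
      have hwb' : F.size + (w : ℕ) = b := congrArg Fin.val hwb
      exact ⟨a - F.size, w, by omega, hwb'.symm, ⟨by omega, w.2, hw⟩⟩
  · rintro (⟨ha, hb, h⟩ | ⟨a', b', rfl, rfl, ha, hb, h⟩)
    · refine ⟨Nat.lt_add_right _ ha, Nat.lt_add_right _ hb, ?_⟩
      have : unionParent F G (Fin.castAdd G.size ⟨a, ha⟩) = some (Fin.castAdd G.size ⟨b, hb⟩) := by
        rw [unionParent, Fin.addCases_left, h]; rfl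
      exact this
    · refine ⟨Nat.add_lt_add_left ha _, Nat.add_lt_add_left hb _, ?_⟩
      have : unionParent F G (Fin.natAdd F.size ⟨a', ha⟩) = some (Fin.natAdd F.size ⟨b', hb⟩) := by
        rw [unionParent, Fin.addCases_right, h]; rfl
      exact this

/-- The shifted disjoint union makes the ordered forests a monoid. -/
instance : Monoid OrderedForest where
  one := empty
  mul := union
  one_mul F := by
    refine ext_natEdge (Nat.zero_add _) fun a b => (natEdge_union empty F a b).trans ⟨?_, ?_⟩
    · rintro (⟨h, _⟩ | ⟨a', b', rfl, rfl, h⟩)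
      · exact absurd h (Nat.not_lt_zero _)
      · have e (n : ℕ) : empty.size + n = n := Nat.zero_add n
        rwa [e, e]
    · exact fun h => .inr ⟨a, b, (Nat.zero_add a).symm, (Nat.zero_add b).symm, h⟩
  mul_one F := by
    refine ext_natEdge (Nat.add_zero _) fun a b => (natEdge_union F empty a b).trans ⟨?_, .inl⟩
    rintro (h | ⟨a', b', rfl, rfl, h, _⟩)
    · exact h
    · exact absurd h (Nat.not_lt_zero _)
  mul_assoc F G H := by
    refine ext_natEdge (Nat.add_assoc _ _ _) fun a b => ?_
    refine (natEdge_union (union F G) H a b).trans (Iff.trans ?_ (natEdge_union F (union G H) a b).symm)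
    have e : (union F G).size = F.size + G.size := rfl
    simp only [natEdge_union, e]
    constructor
    · rintro ((h | ⟨a', b', ha, hb, h⟩) | ⟨a', b', ha, hb, h⟩)
      · exact .inl h
      · exact .inr ⟨a', b', ha, hb, .inl h⟩
      · exact .inr ⟨G.size + a', G.size + b', by omega, by omega, .inr ⟨a', b', rfl, rfl, h⟩⟩
    · rintro (h | ⟨a', b', ha, hb, h | ⟨a'', b'', ha', hb', h⟩⟩)
      · exact .inl (.inl h)
      · exact .inl (.inr ⟨a', b', ha, hb, h⟩)
      · exact .inr ⟨a'', b'', by omega, by omega, h⟩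

/-- The ordered forest induced by `F` on a set `S` of vertices: the edges are those of `F` between
elements of `S`, and the vertices are renumbered by the increasing bijection from `S` to
`Fin S.card`. -/
noncomputable def restrict (F : OrderedForest) (S : Finset (Fin F.size)) : OrderedForest where
  size := S.card
  parent i := (F.parent (S.orderIsoOfFin rfl i)).bind fun w =>
    if h : w ∈ S then some ((S.orderIsoOfFin rfl).symm ⟨w, h⟩) else none
  acyclic v h := by
    refine F.acyclic (S.orderIsoOfFin rfl v) (h.lift (fun i => (S.orderIsoOfFin rfl i : Fin F.size)) ?_)
    intro i j hij
    rw [Option.bind_eq_some_iff] at hij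
    obtain ⟨w, hw, hj⟩ := hij
    split_ifs at hj with hS
    obtain rfl := Option.some.inj hj
    simpa [Function.onFun] using hw

/-- An admissible cut: there is no path between two distinct elements of `c`. -/
def IsAdmissibleCut (F : OrderedForest) (c : Finset (Fin F.size)) : Prop :=
  ∀ v ∈ c, ∀ w ∈ c, v ≠ w → ¬ F.Path v w

open Classical in
/-- The vertices above `c`: those of `c` and those from which a path leads to an element of `c`. -/
noncomputable def leaVertices (F : OrderedForest) (c : Finset (Fin F.size)) : Finset (Fin F.size) :=
  {w | w ∈ c ∨ ∃ v ∈ c, F.Path w v}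

/-- The forest of the vertices above the cut. -/
noncomputable def lea (F : OrderedForest) (c : Finset (Fin F.size)) : OrderedForest :=
  F.restrict (F.leaVertices c)

/-- The forest of the other vertices. -/
noncomputable def roo (F : OrderedForest) (c : Finset (Fin F.size)) : OrderedForest :=
  F.restrict (F.leaVertices c)ᶜ

open Classical in
/-- The finite set of admissible cuts (the empty cut included). -/
noncomputable def admissibleCuts (F : OrderedForest) : Finset (Finset (Fin F.size)) :=
  {c | F.IsAdmissibleCut c}

end OrderedForest

/-! ## The Hopf algebra of ordered forests -/

/-- The free module on the ordered forests, with the bilinear extension of the shifted disjoint union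
as product. -/
def Ho (K : Type*) [CommRing K] : Type _ := MonoidAlgebra K OrderedForest

namespace Ho
variable (K : Type*) [CommRing K]
noncomputable instance : Ring (Ho K) := inferInstanceAs (Ring (MonoidAlgebra K OrderedForest))
noncomputable instance : Algebra K (Ho K) :=
  inferInstanceAs (Algebra K (MonoidAlgebra K OrderedForest))

/-- The basis element attached to an ordered forest. -/
noncomputable def S (F : OrderedForest) : Ho K :=
  (MonoidAlgebra.single F 1 : MonoidAlgebra K OrderedForest)

/-- The linear map with prescribed values on the basis. -/
noncomputable def extend {K : Type*} [CommRing K] {M : Type*} [AddCommGroup M] [Module K M]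
    (f : OrderedForest → M) : Ho K →ₗ[K] M :=
  (Finsupp.linearCombination K f) ∘ₗ
   (MonoidAlgebra.coeffLinearEquiv K : MonoidAlgebra K OrderedForest ≃ₗ[K] OrderedForest →₀ K).toLinearMap

@[simp] theorem extend_S {M : Type*} [AddCommGroup M] [Module K M]
   (f : OrderedForest → M) (F : OrderedForest) : extend f (S K F) = f F := by
  refine (Finsupp.linearCombination_single K (1 : K) F).trans (one_smul _ _)

theorem S_mul (F G : OrderedForest) : S K F * S K G = S K (F * G) :=
  (MonoidAlgebra.single_mul_single _ _ _ _).trans (by rw [one_mul]; rfl)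

theorem S_one : S K 1 = 1 := rfl

open Classical in
/-- The coproduct is given by admissible cuts; the counit takes the value `1` on the empty forest and
`0` on the other forests. -/
noncomputable instance : CoalgebraStruct K (Ho K) where
  comul := extend fun F => ∑ c ∈ F.admissibleCuts, S K (F.roo c) ⊗ₜ[K] S K (F.lea c)
  counit := extend fun F => if F = 1 then 1 else 0

/-- The homogeneous component of degree `n`, spanned by the forests with `n` vertices. -/
noncomputable def homogeneous (n : ℕ) : Submodule K (Ho K) :=
  Submodule.span K (S K '' {F | F.size = n})

end Ho

/-! ## Parking functions and parkization -/

/-- A word in the positive integers is a parking function if at least `i` of its letters are `≤ i`, for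
all `i` up to its length `n`; equivalently, its nondecreasing rearrangement `b₁ ≤ ⋯ ≤ bₙ`
satisfies `bᵢ ≤ i` for all `i`. -/
def IsParking (w : List ℕ) : Prop :=
  (∀ x ∈ w, 1 ≤ x) ∧ ∀ i ≤ w.length, i ≤ w.countP (· ≤ i)

theorem exists_gap (w : List ℕ) : ∃ i, w.countP (· ≤ i) < i :=
  ⟨w.length + 1, Nat.lt_succ_of_le List.countP_le_length⟩

/-- `d(w)`, the smallest `i` such that fewer than `i` letters of `w` are `≤ i`. -/
def firstGap (w : List ℕ) : ℕ := Nat.find (exists_gap w)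

/-- One step of the parkization algorithm: the letters greater than `d(w)` are decremented. It fixes
parking functions, and decreases the sum of the letters of all other words in the positive
integers. -/
def parkStep (w : List ℕ) : List ℕ := w.map fun x => if firstGap w < x then x - 1 else x

/-- The parkization of a word: the result of the parkization algorithm, which decrements the letters
greater than `d(w)` until the word is a parking function. A word that is not yet a parking
function loses at least one unit in each step, so `w.sum` steps suffice. -/
def park (w : List ℕ) : List ℕ := parkStep^[w.sum] w

/-- The value that the parkization of `w` gives to a letter, see `park_eq_map`. -/
def parkLetter (w : List ℕ) : ℕ → ℕ
  | 0 => 0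
  | v + 1 => min (parkLetter w v) (w.countP (· ≤ v)) + 1

theorem countP_le_succ (w : List ℕ) (v : ℕ) :
    w.countP (· ≤ v + 1) = w.countP (· ≤ v) + w.count (v + 1) := by
  induction w with
  | nil => rfl
  | cons a w ih =>
    simp only [List.countP_cons, List.count_cons, ih, beq_iff_eq, decide_eq_true_eq]
    split_ifs <;> omega

theorem countP_le_mono (w : List ℕ) {u v : ℕ} (h : u ≤ v) :
    w.countP (· ≤ u) ≤ w.countP (· ≤ v) :=
  List.countP_mono_left fun x _ hx => by
    simp only [decide_eq_true_eq] at hx ⊢; omega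

theorem parkLetter_le (w : List ℕ) (v : ℕ) : parkLetter w v ≤ w.countP (· ≤ v) + 1 := by
  cases v with
  | zero => simp [parkLetter]
  | succ v =>
    have := countP_le_succ w v
    simp only [parkLetter]; omega

/-- Invariance of `parkLetter` under relabellings that close gaps of `w`. -/
theorem parkLetter_map {w u : List ℕ} (hu : ∀ v, u.count v ≤ w.count v) {f : ℕ → ℕ}
    (f0 : f 0 = 0)
    (hf : ∀ v, f (v + 1) = f v + 1 ∨ (f (v + 1) = f v ∧ f v = w.countP (· ≤ v) + 1 ∧
      ∀ s < v, f (s + 1) ≤ w.countP (· ≤ s) + 1)) (v : ℕ) :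
    parkLetter (u.map f) (f v) = parkLetter u v := by
  have hmono : Monotone f := monotone_nat_of_le_succ fun n => by
    rcases hf n with h | h <;> omega
  induction v with
  | zero => rw [f0]; rfl
  | succ v ih =>
    rcases hf v with h | ⟨h, hv, hs⟩
    · have : (u.map f).countP (· ≤ f v) = u.countP (· ≤ v) := by
        rw [List.countP_map]
        refine List.countP_congr fun x _ => ?_
        simp only [Function.comp, decide_eq_true_eq]
        refine ⟨fun hx => ?_, fun hx => hmono hx⟩
        by_contra hlt
        have := hmono (show v + 1 ≤ x by omega)
        omega
      rw [h, parkLetter, this, ih, parkLetter]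
    · have key : ∀ s ≤ v, f s + u.countP (· ≤ s) ≤ parkLetter u s + w.countP (· ≤ s) := by
        intro s
        induction s with
        | zero =>
          intro _
          have e (l : List ℕ) : l.countP (· ≤ 0) = l.count 0 :=
            List.countP_congr fun x _ => by simp
          have := hu 0
          rw [f0, e, e]; omega
        | succ s ihs =>
          intro hsv
          have h1 := ihs (by omega)
          have h2 := hs s (by omega)
          have h3 := countP_le_succ u s
          have h4 := countP_le_succ w s
          have h5 := hu (s + 1)
          have h6 : f (s + 1) ≤ f s + 1 := by rcases hf s with h | h <;> omega
          simp only [parkLetter]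
          omega
      have k := key v le_rfl
      have := parkLetter_le u v
      rw [h, ih]
      simp only [parkLetter]
      omega


theorem parkLetter_eq_self {w : List ℕ} {d : ℕ} (h : ∀ i < d, i ≤ w.countP (· ≤ i)) {v : ℕ}
    (hv : v ≤ d) : parkLetter w v = v := by
  induction v with
  | zero => rfl
  | succ v ih =>
    have h1 := ih (by omega)
    have h2 := h v (by omega)
    simp only [parkLetter]; omega

theorem countP_firstGap (w : List ℕ) : w.countP (· ≤ firstGap w) < firstGap w :=
  Nat.find_spec (exists_gap w)

theorem le_countP_of_lt_firstGap {w : List ℕ} {i : ℕ} (h : i < firstGap w) :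
    i ≤ w.countP (· ≤ i) := by
  have := Nat.find_min (exists_gap w) h
  omega

theorem map_parkLetter_parkStep (w : List ℕ) :
    (parkStep w).map (parkLetter (parkStep w)) = w.map (parkLetter w) := by
  rw [parkStep, List.map_map]
  refine List.map_congr_left fun v _ => ?_
  have hd := countP_firstGap w
  refine parkLetter_map (f := fun x => if firstGap w < x then x - 1 else x)
    (fun _ => le_rfl) (by simp) (fun v => ?_) v
  rcases lt_trichotomy v (firstGap w) with h | h | h
  · left; split_ifs <;> omega
  · right
    have h1 : firstGap w - 1 ≤ w.countP (· ≤ firstGap w - 1) :=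
      le_countP_of_lt_firstGap (by omega)
    have h2 := countP_le_mono w (show firstGap w - 1 ≤ firstGap w by omega)
    refine ⟨by simp [h], by rw [h]; simp only [lt_irrefl, if_false]; omega, fun s hs => ?_⟩
    have := le_countP_of_lt_firstGap (w := w) (i := s) (by omega)
    rw [if_neg (by omega)]; omega
  · left; split_ifs <;> omega

theorem sum_parkStep (w : List ℕ) :
    (parkStep w).sum < w.sum ∨ (parkStep w = w ∧ ∀ x ∈ w, x ≤ firstGap w) := by
  by_cases h : ∀ x ∈ w, x ≤ firstGap w
  · right
    refine ⟨?_, h⟩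
    rw [parkStep]
    exact (List.map_congr_left fun x hx => if_neg (not_lt.2 (h x hx))).trans (List.map_id' _)
  · left
    push Not at h
    obtain ⟨x, hx, hlt⟩ := h
    have key : ((w.map fun x => if firstGap w < x then x - 1 else x).sum) < (w.map id).sum := by
      refine List.sum_lt_sum _ _ (fun y _ => ?_) ⟨x, hx, ?_⟩
      · simp only [id]; split_ifs <;> omega
      · simp only [id]; rw [if_pos hlt]; omega
    simpa [parkStep] using key

/-- The parkization decrements each letter by an amount given by a simple recursion. -/
theorem park_eq_map (w : List ℕ) : park w = w.map (parkLetter w) := by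
  suffices H : ∀ n (w : List ℕ), w.sum ≤ n → parkStep^[n] w = w.map (parkLetter w) from
    H _ w le_rfl
  intro n
  induction n with
  | zero =>
    intro w hw
    have : ∀ x ∈ w, x = 0 := List.sum_eq_zero_iff.1 (Nat.le_zero.1 hw)
    refine ((List.map_congr_left (g := id) fun x hx => ?_).trans (List.map_id _)).symm
    rw [this x hx]; rfl
  | succ n ih =>
    intro w hw
    rcases sum_parkStep w with h | ⟨h, hd⟩
    · rw [Function.iterate_succ_apply, ih _ (by omega), map_parkLetter_parkStep]
    · rw [Function.iterate_fixed h]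
      exact ((List.map_congr_left (g := id) fun x hx => parkLetter_eq_self
        (fun i => le_countP_of_lt_firstGap) (hd x hx)).trans (List.map_id _)).symm

theorem length_park (w : List ℕ) : (park w).length = w.length := by
  rw [park_eq_map, List.length_map]

theorem parkLetter_mono (w : List ℕ) : Monotone (parkLetter w) :=
  monotone_nat_of_le_succ fun v => by
    have := parkLetter_le w v
    simp only [parkLetter]; omega

theorem park_isParking {w : List ℕ} (h : ∀ x ∈ w, 1 ≤ x) : IsParking (park w) := by
  rw [IsParking, length_park, park_eq_map]
  refine ⟨fun y hy => ?_, fun i hi => ?_⟩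
  · obtain ⟨x, hx, rfl⟩ := List.mem_map.1 hy
    obtain ⟨v, rfl⟩ := Nat.exists_eq_add_of_le' (h x hx)
    simp [parkLetter]
  · rw [List.countP_map]
    by_cases hall : ∀ x ∈ w, parkLetter w x ≤ i
    · rw [List.countP_eq_length.2 fun x hx => by simpa using hall x hx]
      exact hi
    · push Not at hall
      have hex : ∃ v, i < parkLetter w v := by
        obtain ⟨x, _, hx⟩ := hall; exact ⟨x, hx⟩
      obtain ⟨v, hv, hmin⟩ : ∃ v, i < parkLetter w v ∧ ∀ u < v, ¬ i < parkLetter w u :=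
        ⟨Nat.find hex, Nat.find_spec hex, fun u => Nat.find_min hex⟩
      cases v with
      | zero => simp [parkLetter] at hv
      | succ v =>
        have h1 : i ≤ w.countP (· ≤ v) := by simp only [parkLetter] at hv; omega
        refine h1.trans (List.countP_mono_left fun x _ hx => ?_)
        have := hmin x (by simp only [decide_eq_true_eq] at hx; omega)
        simp only [Function.comp, decide_eq_true_eq]; omega

theorem IsParking.le_length {w : List ℕ} (h : IsParking w) : ∀ x ∈ w, x ≤ w.length := by
  have h1 := h.2 w.length le_rfl
  have := List.countP_eq_length.1 (le_antisymm List.countP_le_length h1)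
  simpa using this

theorem park_of_isParking {w : List ℕ} (h : IsParking w) : park w = w := by
  rw [park_eq_map]
  exact (List.map_congr_left (g := id) fun x hx => parkLetter_eq_self (d := w.length)
    (fun i hi => h.2 i hi.le) (h.le_length x hx)).trans (List.map_id _)

theorem park_map_parkLetter {u w : List ℕ} (h : u.Sublist w) :
    park (u.map (parkLetter w)) = park u := by
  rw [park_eq_map, List.map_map, park_eq_map]
  refine List.map_congr_left fun v _ => ?_
  refine parkLetter_map (fun v => h.count_le v) rfl (fun v => ?_) v
  have h1 := parkLetter_le w v
  by_cases h2 : parkLetter w v ≤ w.countP (· ≤ v)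
  · left; simp only [parkLetter]; omega
  · right
    refine ⟨by simp only [parkLetter]; omega, by omega, fun s _ => ?_⟩
    simp only [parkLetter]; omega

theorem park_take_park (w : List ℕ) (i : ℕ) : park ((park w).take i) = park (w.take i) := by
  rw [park_eq_map w, ← List.map_take, park_map_parkLetter (List.take_sublist i w)]

theorem park_drop_park (w : List ℕ) (i : ℕ) : park ((park w).drop i) = park (w.drop i) := by
  rw [park_eq_map w, ← List.map_drop, park_map_parkLetter (List.drop_sublist i w)]

/-- The type of parking functions, of all lengths. -/
abbrev ParkingFunction : Type := {w : List ℕ // IsParking w}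

namespace ParkingFunction

/-- The length of a parking function. -/
def size (a : ParkingFunction) : ℕ := a.1.length

/-- The empty parking function. -/
def empty : ParkingFunction := ⟨[], by simp [IsParking]⟩

/-- The parkization of a word in the positive integers, as a parking function. -/
def ofWord (w : List ℕ) (h : ∀ x ∈ w, 1 ≤ x) : ParkingFunction := ⟨park w, park_isParking h⟩

theorem le_size (a : ParkingFunction) : ∀ x ∈ a.1, x ≤ a.size := a.2.le_length

theorem finite_size (n : ℕ) : {a : ParkingFunction | a.size = n}.Finite := by
  refine Set.Finite.of_finite_image (f := Subtype.val) ?_ Subtype.val_injective.injOn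
  refine ((List.finite_length_eq (Fin (n + 1)) n).image (List.map Fin.val)).subset ?_
  rintro _ ⟨a, ha, rfl⟩
  have ha' : a.1.length = n := ha
  refine ⟨a.1.pmap (fun x (hx : x < n + 1) => ⟨x, hx⟩) fun x hx => ?_, ?_, ?_⟩
  · have := a.2.le_length x hx
    omega
  · simpa using ha'
  · rw [List.map_pmap]
    simp

/-- The finite set of parking functions of length `n`. -/
noncomputable def ofSize (n : ℕ) : Finset ParkingFunction := (finite_size n).toFinset

@[simp] theorem mem_ofSize {n : ℕ} {a : ParkingFunction} : a ∈ ofSize n ↔ a.size = n := by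
  simp [ofSize]

/-- The parkization of the prefix of length `i`. -/
def take (a : ParkingFunction) (i : ℕ) : ParkingFunction :=
  ofWord (a.1.take i) fun x hx => a.2.1 x (List.mem_of_mem_take hx)

/-- The parkization of the suffix left by removing `i` letters. -/
def drop (a : ParkingFunction) (i : ℕ) : ParkingFunction :=
  ofWord (a.1.drop i) fun x hx => a.2.1 x (List.mem_of_mem_drop hx)

/-- The words of the shifted shuffle of `a` and `b`, that is, of the shuffle of the words `a` and `b'`,
where `b'` is `b` with all letters shifted by the length `k` of `a`. As the letters of `a` are `≤ k`
and those of `b'` are `> k`, these words are exactly those in which the letters `≤ k` form the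
subword `a` and the letters `> k` form the subword `b'`; each of them is a parking function
(`isParking_of_filter`) and occurs once in the shuffle. -/
noncomputable def shiftedShuffle (a b : ParkingFunction) : Finset ParkingFunction :=
  {c ∈ ofSize (a.size + b.size) | c.1.filter (· ≤ a.size) = a.1 ∧
    c.1.filter (a.size < ·) = b.1.map (· + a.size)}

theorem size_take (a : ParkingFunction) (i : ℕ) : (a.take i).size = min i a.size := by
  simp [take, ofWord, size, length_park]

theorem size_drop (a : ParkingFunction) (i : ℕ) : (a.drop i).size = a.size - i := by
  simp [drop, ofWord, size, length_park]

theorem take_take (a : ParkingFunction) (i j : ℕ) : (a.take i).take j = a.take (min j i) :=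
  Subtype.ext <| by simp [take, ofWord, park_take_park, List.take_take]

theorem drop_take (a : ParkingFunction) (i j : ℕ) :
    (a.take (i + j)).drop i = (a.drop i).take j :=
  Subtype.ext <| by
    simp [take, drop, ofWord, park_take_park, park_drop_park, List.drop_take]

theorem drop_drop (a : ParkingFunction) (i j : ℕ) : (a.drop i).drop j = a.drop (i + j) :=
  Subtype.ext <| by simp [drop, ofWord, park_drop_park, List.drop_drop]

theorem take_size (a : ParkingFunction) {i : ℕ} (h : a.size ≤ i) : a.take i = a :=
  Subtype.ext <| by
    simp only [take, ofWord]; rw [List.take_of_length_le h, park_of_isParking a.2]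

theorem drop_zero (a : ParkingFunction) : a.drop 0 = a :=
  Subtype.ext <| by simp [drop, ofWord, park_of_isParking a.2]

theorem size_eq_zero {a : ParkingFunction} : a.size = 0 ↔ a = empty := by
  rw [Subtype.ext_iff]; exact List.length_eq_zero_iff

theorem size_of_mem_shiftedShuffle {a b c : ParkingFunction} (h : c ∈ shiftedShuffle a b) :
    c.size = a.size + b.size := by
  simpa using (Finset.mem_filter.1 h).1

theorem mem_shiftedShuffle {a b c : ParkingFunction} : c ∈ shiftedShuffle a b ↔
    c.1.filter (· ≤ a.size) = a.1 ∧ c.1.filter (a.size < ·) = b.1.map (· + a.size) := by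
  refine ⟨fun h => (Finset.mem_filter.1 h).2, fun h => Finset.mem_filter.2 ⟨?_, h⟩⟩
  have key (l : List ℕ) (k : ℕ) :
      l.length = (l.filter (· ≤ k)).length + (l.filter (k < ·)).length := by
    induction l with
    | nil => rfl
    | cons x l ih =>
      grind
  rw [mem_ofSize, size, key _ a.size, h.1, h.2, List.length_map]; rfl

theorem shiftedShuffle_empty_left (a : ParkingFunction) : shiftedShuffle empty a = {a} := by
  ext c
  rw [mem_shiftedShuffle, Finset.mem_singleton, Subtype.ext_iff]
  have h0 : empty.size = 0 := rfl
  have h1 : c.1.filter (· ≤ 0) = [] := List.filter_eq_nil_iff.2 fun x hx => by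
    have := c.2.1 x hx; simp; omega
  have h2 : c.1.filter (0 < ·) = c.1 := List.filter_eq_self.2 fun x hx => decide_eq_true (c.2.1 x hx)
  rw [h0, h1, h2]
  simp [empty]

theorem shiftedShuffle_empty_right (a : ParkingFunction) : shiftedShuffle a empty = {a} := by
  ext c
  rw [Finset.mem_singleton]
  constructor
  · intro h
    have hs := size_of_mem_shiftedShuffle h
    rw [mem_shiftedShuffle] at h
    have h0 : empty.size = 0 := rfl
    have hc : c.1.filter (· ≤ a.size) = c.1 := List.filter_eq_self.2 fun x hx => by
      have := c.2.le_length x hx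
      have h3 : c.1.length = a.size + empty.size := hs
      simp; omega
    exact Subtype.ext (hc.symm.trans h.1)
  · rintro rfl
    rw [mem_shiftedShuffle]
    refine ⟨List.filter_eq_self.2 fun x hx => decide_eq_true (c.le_size x hx), ?_⟩
    refine List.filter_eq_nil_iff.2 fun x hx => by simpa using c.le_size x hx

theorem isParking_of_filter {a b : ParkingFunction} {e : List ℕ}
    (ha : e.filter (· ≤ a.size) = a.1) (hb : e.filter (a.size < ·) = b.1.map (· + a.size)) :
    IsParking e := by
  have key (p : ℕ → Bool) : e.countP p = a.1.countP p + b.1.countP (p ∘ (· + a.size)) := by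
    rw [← List.countP_map, ← ha, ← hb]
    clear ha hb
    induction e with
    | nil => rfl
    | cons x l ih => grind
  have hlen : e.length = a.size + b.size := by
    have := key fun _ => true
    simpa [size] using this
  refine ⟨fun x hx => ?_, fun i hi => ?_⟩
  · by_cases h : x ≤ a.size
    · exact a.2.1 x (ha ▸ List.mem_filter.2 ⟨hx, by simpa using h⟩)
    · omega
  · rw [key]
    by_cases h : i ≤ a.size
    · exact (a.2.2 i h).trans (Nat.le_add_right _ _)
    · have h1 : a.1.countP (· ≤ i) = a.size := List.countP_eq_length.2 fun x hx => by
        have : x ≤ a.size := a.2.le_length x hx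
        simp; omega
      have h2 := b.2.2 (i - a.size) (by change _ ≤ b.size; omega)
      have h3 : b.1.countP ((fun x => decide (x ≤ i)) ∘ (· + a.size)) =
          b.1.countP (· ≤ i - a.size) := List.countP_congr fun x _ => by
        simp only [Function.comp, decide_eq_true_eq]; omega
      rw [h1, h3]; omega

theorem shiftedShuffle_assoc (a b c d : ParkingFunction) :
    (∃ e ∈ shiftedShuffle a b, d ∈ shiftedShuffle e c) ↔
      ∃ e ∈ shiftedShuffle b c, d ∈ shiftedShuffle a e := by
  constructor
  · rintro ⟨e, he, hd⟩
    have hs := size_of_mem_shiftedShuffle he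
    rw [mem_shiftedShuffle] at he hd
    rw [hs] at hd
    have g1 : ((d.1.filter (a.size < ·)).map (· - a.size)).filter (· ≤ b.size) = b.1 := by
      have : ((d.1.filter (a.size < ·)).filter fun x => x - a.size ≤ b.size) =
          b.1.map (· + a.size) := by
        rw [← he.2, ← hd.1, List.filter_filter, List.filter_filter]
        exact List.filter_congr fun x _ => by grind
      rw [List.filter_map]
      refine (congrArg _ this).trans ?_
      rw [List.map_map]
      refine (List.map_congr_left (g := id) fun x _ => ?_).trans (List.map_id _)
      simp
    have g2 : ((d.1.filter (a.size < ·)).map (· - a.size)).filter (b.size < ·) =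
        c.1.map (· + b.size) := by
      have : ((d.1.filter (a.size < ·)).filter fun x => b.size < x - a.size) =
          c.1.map (· + (a.size + b.size)) := by
        rw [← hd.2, List.filter_filter]
        exact List.filter_congr fun x _ => by grind
      rw [List.filter_map]
      refine (congrArg _ this).trans ?_
      rw [List.map_map]
      exact List.map_congr_left fun x _ => by simp only [Function.comp]; omega
    refine ⟨⟨_, isParking_of_filter g1 g2⟩, mem_shiftedShuffle.2 ⟨g1, g2⟩,
      mem_shiftedShuffle.2 ⟨?_, ?_⟩⟩
    · rw [← he.1, ← hd.1, List.filter_filter]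
      exact List.filter_congr fun x _ => by grind
    · rw [List.map_map]
      refine ((List.map_congr_left (g := id) fun x hx => ?_).trans (List.map_id _)).symm
      have := (List.mem_filter.1 hx).2
      simp only [decide_eq_true_eq] at this
      simp only [Function.comp, id]; omega
  · rintro ⟨e, he, hd⟩
    rw [mem_shiftedShuffle] at he hd
    have g1 : (d.1.filter (· ≤ a.size + b.size)).filter (· ≤ a.size) = a.1 := by
      rw [← hd.1, List.filter_filter]
      exact List.filter_congr fun x _ => by grind
    have g2 : (d.1.filter (· ≤ a.size + b.size)).filter (a.size < ·) =
        b.1.map (· + a.size) := by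
      rw [← he.1]
      have : (d.1.filter (a.size < ·)).filter (· ≤ a.size + b.size) =
          (e.1.filter (· ≤ b.size)).map (· + a.size) := by
        rw [hd.2, List.filter_map]
        exact congrArg _ (List.filter_congr fun x _ => by grind)
      rw [← this, List.filter_filter, List.filter_filter]
      exact List.filter_congr fun x _ => by grind
    have hm : (⟨_, isParking_of_filter g1 g2⟩ : ParkingFunction) ∈ shiftedShuffle a b :=
      mem_shiftedShuffle.2 ⟨g1, g2⟩
    refine ⟨_, hm, ?_⟩
    rw [mem_shiftedShuffle, size_of_mem_shiftedShuffle hm]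
    refine ⟨rfl, ?_⟩
    have : (d.1.filter (a.size < ·)).filter (a.size + b.size < ·) =
        (e.1.filter (b.size < ·)).map (· + a.size) := by
      rw [hd.2, List.filter_map]
      exact congrArg _ (List.filter_congr fun x _ => by grind)
    rw [he.2, List.map_map, List.filter_filter] at this
    refine Eq.trans ?_ (this.trans ?_)
    · exact List.filter_congr fun x _ => by grind
    · exact List.map_congr_left fun x _ => by simp only [Function.comp]; omega

theorem eq_of_mem_shiftedShuffle {e e' c d : ParkingFunction} (h : e.size = e'.size)
    (h1 : d ∈ shiftedShuffle e c) (h2 : d ∈ shiftedShuffle e' c) : e = e' := by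
  rw [mem_shiftedShuffle] at h1 h2
  exact Subtype.ext (by rw [← h1.1, ← h2.1, h])

theorem eq_of_mem_shiftedShuffle' {e e' a d : ParkingFunction}
    (h1 : d ∈ shiftedShuffle a e) (h2 : d ∈ shiftedShuffle a e') : e = e' := by
  rw [mem_shiftedShuffle] at h1 h2
  exact Subtype.ext (List.map_injective_iff.2 (add_left_injective a.size) (h1.2.symm.trans h2.2))

end ParkingFunction

/-! ## The Hopf algebra of parking functions -/

/-- The free module on the parking functions, with basis `F_a`. -/
def PQSym (K : Type*) [CommRing K] : Type _ := ParkingFunction →₀ K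

namespace PQSym
open ParkingFunction
variable {K : Type*} [CommRing K]

noncomputable instance : AddCommGroup (PQSym K) :=
  inferInstanceAs (AddCommGroup (ParkingFunction →₀ K))
noncomputable instance : Module K (PQSym K) := inferInstanceAs (Module K (ParkingFunction →₀ K))

variable (K) in
/-- The basis element `F_a`. -/
noncomputable def F (a : ParkingFunction) : PQSym K := Finsupp.single a (1 : K)

/-- The linear map with prescribed values on the basis `F_a`. -/
noncomputable def extend {M : Type*} [AddCommGroup M] [Module K M] (f : ParkingFunction → M) :
    PQSym K →ₗ[K] M := Finsupp.linearCombination K f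

@[simp] theorem extend_F {M : Type*} [AddCommGroup M] [Module K M] (f : ParkingFunction → M)
    (a : ParkingFunction) : extend f (F K a) = f a :=
  (Finsupp.linearCombination_single K (1 : K) a).trans (one_smul _ _)

theorem hom_ext {M : Type*} [AddCommGroup M] [Module K M] {f g : PQSym K →ₗ[K] M}
    (h : ∀ a, f (F K a) = g (F K a)) : f = g :=
  Finsupp.lhom_ext' fun a => LinearMap.ext_ring (h a)

/-- The product: `F_a F_b` is the sum of the `F_c`, for `c` in the shifted shuffle of `a` and `b`. -/
noncomputable def mulHom : PQSym K →ₗ[K] PQSym K →ₗ[K] PQSym K :=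
  extend fun a => extend fun b => ∑ c ∈ shiftedShuffle a b, F K c

theorem mulHom_F (a b : ParkingFunction) :
    mulHom (F K a) (F K b) = ∑ c ∈ shiftedShuffle a b, F K c := by
  rw [mulHom, extend_F, extend_F]

theorem mulHom_one_left (x : PQSym K) : mulHom (F K empty) x = x := by
  have : mulHom (F K empty) = LinearMap.id (R := K) (M := PQSym K) := hom_ext fun a => by
    rw [mulHom_F, shiftedShuffle_empty_left, Finset.sum_singleton]; rfl
  rw [this]; rfl

theorem mulHom_one_right (x : PQSym K) : mulHom x (F K empty) = x := by
  have : mulHom.flip (F K empty) = LinearMap.id (R := K) (M := PQSym K) := hom_ext fun a => by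
    rw [LinearMap.flip_apply, mulHom_F, shiftedShuffle_empty_right, Finset.sum_singleton]; rfl
  exact LinearMap.congr_fun this x

theorem mulHom_assoc (x y z : PQSym K) : mulHom (mulHom x y) z = mulHom x (mulHom y z) := by
  classical
  have : (mulHom (K := K)).compr₂ mulHom =
      LinearMap.lcomp K _ mulHom ∘ₗ LinearMap.llcomp K (PQSym K) (PQSym K) (PQSym K) ∘ₗ
        mulHom := by
    refine hom_ext fun a => hom_ext fun b => hom_ext fun c => ?_
    change mulHom (mulHom (F K a) (F K b)) (F K c) = mulHom (F K a) (mulHom (F K b) (F K c))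
    simp only [mulHom_F, map_sum, LinearMap.sum_apply]
    rw [← Finset.sum_biUnion, ← Finset.sum_biUnion]
    · congr 1
      ext d
      simpa only [Finset.mem_biUnion] using shiftedShuffle_assoc a b c d
    · intro e _ e' _ hne
      exact Finset.disjoint_left.2 fun d h1 h2 => hne (eq_of_mem_shiftedShuffle' h1 h2)
    · intro e he e' he' hne
      refine Finset.disjoint_left.2 fun d h1 h2 => hne (eq_of_mem_shiftedShuffle ?_ h1 h2)
      rw [size_of_mem_shiftedShuffle he, size_of_mem_shiftedShuffle he']
  exact LinearMap.congr_fun (LinearMap.congr_fun (LinearMap.congr_fun this x) y) z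

noncomputable instance : Ring (PQSym K) where
  __ := (inferInstance : AddCommGroup (PQSym K))
  one := F K empty
  mul x y := mulHom x y
  left_distrib x y z := map_add (mulHom x) y z
  right_distrib x y z := by
    change mulHom (x + y) z = mulHom x z + mulHom y z
    rw [map_add, LinearMap.add_apply]
  zero_mul x := by
    change mulHom 0 x = 0
    rw [map_zero, LinearMap.zero_apply]
  mul_zero x := map_zero (mulHom x)
  mul_assoc := mulHom_assoc
  one_mul := mulHom_one_left
  mul_one := mulHom_one_right

noncomputable instance : Algebra K (PQSym K) := Algebra.ofModule
  (fun r x y => by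
    change mulHom (r • x) y = r • mulHom x y
    rw [map_smul, LinearMap.smul_apply])
  (fun r x y => map_smul (mulHom x) r y)

theorem one_def : (1 : PQSym K) = F K empty := rfl

theorem F_mul (a b : ParkingFunction) : F K a * F K b = ∑ c ∈ shiftedShuffle a b, F K c :=
  mulHom_F a b

/-- The coproduct: `Δ F_a` is the sum of `F_{Park(u)} ⊗ F_{Park(v)}` over all factorizations of the
word `a` as a concatenation `uv`. -/
noncomputable def comulHom : PQSym K →ₗ[K] PQSym K ⊗[K] PQSym K :=
  extend fun a => ∑ i ∈ Finset.range (a.size + 1), F K (a.take i) ⊗ₜ[K] F K (a.drop i)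

open Classical in
/-- The counit, `1` on the empty parking function and `0` on the others. -/
noncomputable def counitHom : PQSym K →ₗ[K] K := extend fun a => if a = empty then 1 else 0

theorem comulHom_F (a : ParkingFunction) : comulHom (F K a) =
    ∑ i ∈ Finset.range (a.size + 1), F K (a.take i) ⊗ₜ[K] F K (a.drop i) := extend_F _ _

open Classical in
theorem counitHom_F (a : ParkingFunction) :
    counitHom (F K a) = if a = empty then 1 else 0 := extend_F _ _

noncomputable instance : Coalgebra K (PQSym K) where
  comul := comulHom
  counit := counitHom
  coassoc := hom_ext fun a => by
    simp only [LinearMap.comp_apply, comulHom_F, map_sum, LinearMap.rTensor_tmul,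
      LinearMap.lTensor_tmul, TensorProduct.sum_tmul, TensorProduct.tmul_sum,
      LinearEquiv.coe_coe, TensorProduct.assoc_tmul]
    rw [Finset.sum_sigma', Finset.sum_sigma']
    refine Finset.sum_bij' (fun p _ => ⟨p.2, p.1 - p.2⟩) (fun p _ => ⟨p.1 + p.2, p.1⟩) ?_ ?_ ?_ ?_ ?_
    · rintro ⟨i, j⟩ h
      simp only [Finset.mem_sigma, Finset.mem_range, size_take, size_drop] at h ⊢
      omega
    · rintro ⟨i, j⟩ h
      simp only [Finset.mem_sigma, Finset.mem_range, size_take, size_drop] at h ⊢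
      omega
    · rintro ⟨i, j⟩ h
      simp only [Finset.mem_sigma, Finset.mem_range, size_take] at h
      simp only [Sigma.mk.injEq, heq_eq_eq, and_true]
      omega
    · rintro ⟨i, j⟩ h
      simp only [Sigma.mk.injEq, heq_eq_eq, true_and]
      omega
    · rintro ⟨i, j⟩ h
      simp only [Finset.mem_sigma, Finset.mem_range, size_take] at h
      obtain ⟨k, rfl⟩ := Nat.exists_eq_add_of_le (show j ≤ i by omega)
      simp only [Nat.add_sub_cancel_left]
      rw [take_take, drop_take, drop_drop, Nat.min_eq_left (Nat.le_add_right _ _)]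
  rTensor_counit_comp_comul := hom_ext fun a => by
    classical
    simp only [LinearMap.comp_apply, comulHom_F, map_sum, LinearMap.rTensor_tmul, counitHom_F]
    rw [Finset.sum_eq_single 0]
    · rw [if_pos (size_eq_zero.1 (by simp [size_take])), drop_zero]; rfl
    · intro i hi h0
      have := Finset.mem_range.1 hi
      rw [if_neg, TensorProduct.zero_tmul]
      rw [← size_eq_zero, size_take]; omega
    · simp
  lTensor_counit_comp_comul := hom_ext fun a => by
    classical
    simp only [LinearMap.comp_apply, comulHom_F, map_sum, LinearMap.lTensor_tmul, counitHom_F]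
    rw [Finset.sum_eq_single a.size]
    · rw [if_pos (size_eq_zero.1 (by simp [size_drop])), take_size _ le_rfl]; rfl
    · intro i hi h0
      have := Finset.mem_range.1 hi
      rw [if_neg, TensorProduct.tmul_zero]
      rw [← size_eq_zero, size_drop]; omega
    · simp

theorem comul_F (a : ParkingFunction) : Coalgebra.comul (F K a) =
    ∑ i ∈ Finset.range (a.size + 1), F K (a.take i) ⊗ₜ[K] F K (a.drop i) := comulHom_F a

end PQSym

/-! ## The graded dual -/

/-- The graded dual of `PQSym K`, the direct sum of the duals of its homogeneous components. It has the
basis `G_a` dual to the basis `F_a`. The map `pair` identifies it with the space of the linear forms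
on `PQSym K` that vanish on all homogeneous components but finitely many (`pair_injective`,
`mem_range_pair`); its product is the transpose of the coproduct of `PQSym K` (`pair_mulHom`) and its
coproduct is the transpose of the product (`tensorPair_comul`). -/
def PQSymDual (K : Type*) [CommRing K] : Type _ := ParkingFunction →₀ K

namespace PQSymDual
open ParkingFunction
variable {K : Type*} [CommRing K]

noncomputable instance : AddCommGroup (PQSymDual K) :=
  inferInstanceAs (AddCommGroup (ParkingFunction →₀ K))
noncomputable instance : Module K (PQSymDual K) :=
  inferInstanceAs (Module K (ParkingFunction →₀ K))

variable (K) in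
/-- The basis element `G_a`. -/
noncomputable def G (a : ParkingFunction) : PQSymDual K := Finsupp.single a (1 : K)

/-- The linear map with prescribed values on the basis `G_a`. -/
noncomputable def extend {M : Type*} [AddCommGroup M] [Module K M] (f : ParkingFunction → M) :
    PQSymDual K →ₗ[K] M := Finsupp.linearCombination K f

@[simp] theorem extend_G {M : Type*} [AddCommGroup M] [Module K M] (f : ParkingFunction → M)
    (a : ParkingFunction) : extend f (G K a) = f a :=
  (Finsupp.linearCombination_single K (1 : K) a).trans (one_smul _ _)

theorem hom_ext {M : Type*} [AddCommGroup M] [Module K M] {f g : PQSymDual K →ₗ[K] M}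
    (h : ∀ a, f (G K a) = g (G K a)) : f = g :=
  Finsupp.lhom_ext' fun a => LinearMap.ext_ring (h a)

open Classical in
/-- The duality pairing, for which the bases `G_a` and `F_a` are dual to each other. -/
noncomputable def pair : PQSymDual K →ₗ[K] (PQSym K →ₗ[K] K) :=
  extend fun a => PQSym.extend fun b => if a = b then 1 else 0

open Classical in
theorem pair_G_F (a b : ParkingFunction) :
    pair (G K a) (PQSym.F K b) = if a = b then 1 else 0 := by
  rw [pair, extend_G, PQSym.extend_F]

theorem pair_F (x : PQSymDual K) (b : ParkingFunction) :
    pair x (PQSym.F K b) = (show ParkingFunction →₀ K from x) b := by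
  classical
  have : (pair (K := K)).flip (PQSym.F K b) = (Finsupp.lapply b : (ParkingFunction →₀ K) →ₗ[K] K) :=
    hom_ext fun a => by
      rw [LinearMap.flip_apply, pair_G_F]
      exact Finsupp.single_apply.symm
  exact LinearMap.congr_fun this x

theorem pair_injective : Function.Injective (pair (K := K)) := fun x y h =>
  Finsupp.ext (f := x) (g := y) fun b => by
    have := LinearMap.congr_fun h (PQSym.F K b)
    rwa [pair_F, pair_F] at this

/-- The induced pairing of tensor squares: `⟨x ⊗ y, u ⊗ v⟩ = ⟨x, u⟩ ⟨y, v⟩`. -/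
noncomputable def tensorPair :
    PQSymDual K ⊗[K] PQSymDual K →ₗ[K] (PQSym K ⊗[K] PQSym K →ₗ[K] K) :=
  TensorProduct.dualDistrib K (PQSym K) (PQSym K) ∘ₗ TensorProduct.map pair pair

theorem tensorPair_tmul (x y : PQSymDual K) (u v : PQSym K) :
    tensorPair (x ⊗ₜ y) (u ⊗ₜ v) = pair x u * pair y v := rfl

/-- The product, transposed from the coproduct of `PQSym K`: the coefficient of `G_c` in `G_a G_b` is
`⟨G_a ⊗ G_b, Δ F_c⟩`, which is zero unless the lengths add up. -/
noncomputable def mulHom : PQSymDual K →ₗ[K] PQSymDual K →ₗ[K] PQSymDual K :=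
  extend fun a => extend fun b => ∑ c ∈ ofSize (a.size + b.size),
    tensorPair (G K a ⊗ₜ[K] G K b) (Coalgebra.comul (PQSym.F K c)) • G K c

/-- The product is the transpose of the coproduct of `PQSym K`. -/
theorem pair_mulHom (x y : PQSymDual K) (u : PQSym K) :
    pair (mulHom x y) u = tensorPair (x ⊗ₜ y) (Coalgebra.comul u) := by
  classical
  have : (mulHom (K := K)).compr₂ pair = 
      (TensorProduct.mk K (PQSymDual K) (PQSymDual K)).compr₂
        (LinearMap.lcomp K K (Coalgebra.comul (R := K) (A := PQSym K)) ∘ₗ tensorPair) := by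
    refine hom_ext fun a => hom_ext fun b => PQSym.hom_ext fun c => ?_
    change pair (mulHom (G K a) (G K b)) (PQSym.F K c) =
      tensorPair (G K a ⊗ₜ G K b) (Coalgebra.comul (PQSym.F K c))
    rw [mulHom, extend_G, extend_G]
    simp only [map_sum, map_smul, LinearMap.sum_apply, LinearMap.smul_apply, pair_G_F,
      smul_eq_mul, mul_ite, mul_one, mul_zero, Finset.sum_ite_eq', mem_ofSize]
    split_ifs with h
    · rfl
    · symm
      rw [PQSym.comul_F, map_sum]
      refine Finset.sum_eq_zero fun i hi => ?_
      rw [tensorPair_tmul, pair_G_F, pair_G_F]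
      split_ifs with h1 h2
      · refine absurd ?_ h
        have := Finset.mem_range.1 hi
        rw [h1, h2, size_take, size_drop]; omega
      all_goals simp
  exact LinearMap.congr_fun (LinearMap.congr_fun (LinearMap.congr_fun this x) y) u

noncomputable instance : Mul (PQSymDual K) := ⟨fun x y => mulHom x y⟩
noncomputable instance : One (PQSymDual K) := ⟨G K empty⟩

theorem pair_mul (x y : PQSymDual K) :
    WithConv.toConv (pair (x * y)) = WithConv.toConv (pair x) * WithConv.toConv (pair y) := by
  rw [LinearMap.convMul_def]
  congr 1
  refine LinearMap.ext fun u => ?_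
  change pair (mulHom x y) u = _
  rw [pair_mulHom]
  have : tensorPair (x ⊗ₜ[K] y) = LinearMap.mul' K K ∘ₗ TensorProduct.map (pair x) (pair y) :=
    TensorProduct.ext' fun u v => rfl
  rw [this]; rfl

theorem pair_one : pair (1 : PQSymDual K) = Coalgebra.counit (R := K) (A := PQSym K) := by
  classical
  refine PQSym.hom_ext fun a => ?_
  refine (pair_G_F _ _).trans ((PQSym.counitHom_F a).trans ?_).symm
  simp only [eq_comm]

theorem toConv_pair_one : WithConv.toConv (pair (1 : PQSymDual K)) = 1 := by
  rw [pair_one, LinearMap.convOne_def]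
  rfl

noncomputable instance : Ring (PQSymDual K) where
  __ := (inferInstance : AddCommGroup (PQSymDual K))
  left_distrib x y z := map_add (mulHom x) y z
  right_distrib x y z := by
    change mulHom (x + y) z = mulHom x z + mulHom y z
    rw [map_add, LinearMap.add_apply]
  zero_mul x := by
    change mulHom 0 x = 0
    rw [map_zero, LinearMap.zero_apply]
  mul_zero x := map_zero (mulHom x)
  mul_assoc x y z := by
    refine pair_injective (WithConv.toConv_injective ?_)
    rw [pair_mul, pair_mul, pair_mul, pair_mul, mul_assoc]
  one_mul x := by
    refine pair_injective (WithConv.toConv_injective ?_)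
    rw [pair_mul, toConv_pair_one, one_mul]
  mul_one x := by
    refine pair_injective (WithConv.toConv_injective ?_)
    rw [pair_mul, toConv_pair_one, mul_one]

noncomputable instance : Algebra K (PQSymDual K) := Algebra.ofModule
  (fun r x y => by
    change mulHom (r • x) y = r • mulHom x y
    rw [map_smul, LinearMap.smul_apply])
  (fun r x y => map_smul (mulHom x) r y)

/-- The coproduct, transposed from the product of `PQSym K`: the coefficient of `G_a ⊗ G_b` in `Δ G_c`
is `⟨G_c, F_a F_b⟩`, which is zero unless the lengths add up. The counit is the evaluation at the
unit of `PQSym K`. -/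
noncomputable instance : CoalgebraStruct K (PQSymDual K) where
  comul := extend fun c => ∑ k ∈ Finset.range (c.size + 1),
    ∑ a ∈ ofSize k, ∑ b ∈ ofSize (c.size - k), pair (G K c) (PQSym.F K a * PQSym.F K b) • (G K a ⊗ₜ[K] G K b)
  counit := pair.flip 1

theorem pair_mul_eq_zero {a b c : ParkingFunction} (h : c.size ≠ a.size + b.size) :
    pair (G K c) (PQSym.F K a * PQSym.F K b) = 0 := by
  classical
  rw [PQSym.F_mul, map_sum]
  refine Finset.sum_eq_zero fun d hd => ?_
  rw [pair_G_F, if_neg]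
  rintro rfl
  exact h (size_of_mem_shiftedShuffle hd)

/-- The coproduct is the transpose of the product of `PQSym K`. -/
theorem tensorPair_comul (x : PQSymDual K) (w : PQSym K ⊗[K] PQSym K) :
    tensorPair (CoalgebraStruct.comul x) w = pair x (LinearMap.mul' K (PQSym K) w) := by
  classical
  have : tensorPair ∘ₗ CoalgebraStruct.comul (R := K) (A := PQSymDual K) =
      LinearMap.lcomp K K (LinearMap.mul' K (PQSym K)) ∘ₗ pair := by
    refine hom_ext fun c => TensorProduct.ext (PQSym.hom_ext fun a => PQSym.hom_ext fun b => ?_)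
    change tensorPair (extend _ (G K c)) (PQSym.F K a ⊗ₜ PQSym.F K b) =
      pair (G K c) (PQSym.F K a * PQSym.F K b)
    rw [extend_G]
    simp only [map_sum, map_smul, LinearMap.sum_apply, LinearMap.smul_apply, tensorPair_tmul,
      pair_G_F, smul_eq_mul, mul_ite, mul_one, mul_zero, Finset.sum_ite_eq', mem_ofSize]
    by_cases h : c.size = a.size + b.size
    · rw [Finset.sum_eq_single a.size]
      · rw [Finset.sum_eq_single a]
        · simp [h]
        · intro a' _ ha
          simp [ha]
        · simp
      · intro k _ hk
        refine Finset.sum_eq_zero fun a' ha' => ?_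
        have : a' ≠ a := by
          rintro rfl
          exact hk (mem_ofSize.1 ha').symm
        simp [this]
      · intro hk
        exact absurd (Finset.mem_range.2 (by omega)) hk
    · rw [pair_mul_eq_zero h]
      refine Finset.sum_eq_zero fun k _ => Finset.sum_eq_zero fun a' _ => ?_
      split_ifs with h1 h2
      · subst h2
        exact pair_mul_eq_zero h
      all_goals rfl
  exact LinearMap.congr_fun (LinearMap.congr_fun this x) w

/-- The pairing identifies `PQSymDual K` with the linear forms on `PQSym K` that vanish on all
homogeneous components but finitely many. -/
theorem mem_range_pair (f : PQSym K →ₗ[K] K) : f ∈ LinearMap.range (pair (K := K)) ↔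
    ∃ N, ∀ a : ParkingFunction, N ≤ a.size → f (PQSym.F K a) = 0 := by
  classical
  constructor
  · rintro ⟨x, rfl⟩
    let s : Finset ParkingFunction := (show ParkingFunction →₀ K from x).support
    refine ⟨s.sup size + 1, fun a ha => ?_⟩
    rw [pair_F]
    by_contra h
    have : a.size ≤ s.sup size := Finset.le_sup (f := size) (Finsupp.mem_support_iff.2 h)
    omega
  · rintro ⟨N, hN⟩
    refine ⟨∑ n ∈ Finset.range N, ∑ a ∈ ofSize n, f (PQSym.F K a) • G K a,
      PQSym.hom_ext fun b => ?_⟩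
    simp only [map_sum, map_smul, LinearMap.sum_apply, LinearMap.smul_apply, pair_G_F,
      smul_eq_mul, mul_ite, mul_one, mul_zero, Finset.sum_ite_eq', mem_ofSize]
    rw [Finset.sum_ite_eq]
    split_ifs with h
    · rfl
    · exact (hN b (by simpa using h)).symm

variable (K) in
/-- The homogeneous component of degree `n`, spanned by the `G_a` for `a` of length `n`. -/
noncomputable def homogeneous (n : ℕ) : Submodule K (PQSymDual K) :=
  Submodule.span K (G K '' {a | a.size = n})

end PQSymDual

/-! ## Hopf algebras -/

/-- The given product and unit and the given coproduct and counit make `A` a Hopf algebra: the axioms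
of Mathlib's `HopfAlgebra`, as a property of the operations. -/
structure IsHopfAlgebra (K A : Type*) [CommRing K] [Ring A] [Algebra K A] [CoalgebraStruct K A] :
    Prop where
  coassoc : TensorProduct.assoc K A A A ∘ₗ (CoalgebraStruct.comul (R := K) (A := A)).rTensor A ∘ₗ
    CoalgebraStruct.comul = (CoalgebraStruct.comul (R := K) (A := A)).lTensor A ∘ₗ
      CoalgebraStruct.comul
  rTensor_counit_comp_comul : (CoalgebraStruct.counit (R := K) (A := A)).rTensor A ∘ₗ
    CoalgebraStruct.comul = TensorProduct.mk K K A 1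
  lTensor_counit_comp_comul : (CoalgebraStruct.counit (R := K) (A := A)).lTensor A ∘ₗ
    CoalgebraStruct.comul = (TensorProduct.mk K A K).flip 1
  counit_one : CoalgebraStruct.counit (R := K) (1 : A) = 1
  counit_mul : ∀ x y : A, CoalgebraStruct.counit (R := K) (x * y) =
    CoalgebraStruct.counit (R := K) x * CoalgebraStruct.counit (R := K) y
  comul_one : CoalgebraStruct.comul (R := K) (1 : A) = 1
  comul_mul : ∀ x y : A, CoalgebraStruct.comul (R := K) (x * y) =
    CoalgebraStruct.comul (R := K) x * CoalgebraStruct.comul (R := K) y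
  exists_antipode : ∃ S : A →ₗ[K] A,
    LinearMap.mul' K A ∘ₗ S.rTensor A ∘ₗ CoalgebraStruct.comul =
      Algebra.linearMap K A ∘ₗ CoalgebraStruct.counit ∧
    LinearMap.mul' K A ∘ₗ S.lTensor A ∘ₗ CoalgebraStruct.comul =
      Algebra.linearMap K A ∘ₗ CoalgebraStruct.counit

/-- Mathlib's `HopfAlgebra` structure, with the given operations. -/
@[reducible]
noncomputable def IsHopfAlgebra.toHopfAlgebra {K A : Type*} [CommRing K] [Ring A] [Algebra K A]
    [c : CoalgebraStruct K A] (h : IsHopfAlgebra K A) : HopfAlgebra K A :=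
  letI : Coalgebra K A :=
    { c with
      coassoc := h.coassoc
      rTensor_counit_comp_comul := h.rTensor_counit_comp_comul
      lTensor_counit_comp_comul := h.lTensor_counit_comp_comul }
  letI : Bialgebra K A := Bialgebra.mk' K A h.counit_one (h.counit_mul _ _) h.comul_one
    (h.comul_mul _ _)
  { antipode := h.exists_antipode.choose
    mul_antipode_rTensor_comul := h.exists_antipode.choose_spec.1
    mul_antipode_lTensor_comul := h.exists_antipode.choose_spec.2 }

/-! Both algebras are rigid for the same reason. Their basis elements have a distinguished point:
the greatest vertex of an ordered forest, the last letter of a parking function. On the augmentation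
ideal the coproduct splits as `lam + rho`, according to whether this point falls into the right or
the left tensor factor. Besides the product there is an action `graft y x` on the augmentation
ideal: for forests, the roots of `y` become children of the greatest vertex of `x`; for the basis
`G_a`, it is the part of the product `G_a G_b` formed by the words in which all letters of the first
part exceed the last letter.

With left multiplication and the coaction `lam` the augmentation ideal is a Hopf module. By the
fundamental theorem of Hopf modules its elements decompose uniquely into products `x * q` with `lam
q = 1 ⊗ q`. Grafting and `rho` restrict to these `q` and make them a Hopf module for the opposite
coproduct, so the `q` decompose uniquely into elements `graft y v` with `v` in the space `V` of
coinvariants on both sides. Iterating `A ≅ K ⊕ A ⊗ A ⊗ V` yields a homogeneous basis of binary trees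
with nodes labelled by a basis of `V` (`IsGrafting.exists_treeBasis`). In this basis the product is
a grafting of trees, and the coproduct follows recursively from `Δ(graft y v) = 1 ⊗ graft y v + ∑
graft y' v ⊗ y''`. The whole structure therefore depends only on the numbers of labels in each
degree, which the dimensions determine (`labels_eq_of_card_treeWeight`), and two such bialgebras
with equal finite graded dimensions are isomorphic (`IsGrafting.exists_graded_bialgEquiv`).

What remains is combinatorial. `CutData.IsBasis` collects identities between cuts, products and
graftings that imply the axioms. They are verified for forests by describing admissible cuts as
upsets (`Ho.isBasis`), and for `PQSymDual` by splitting words at the values `k` such that exactly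
`k` letters are `≤ k` (`PQSymDual.isBasis`). The dimensions agree because rooted forests and parking
functions obey a common recursion (`nonempty_parentMap_equiv_parkingMap`). Antipodes come from the
connected grading, and `PQSym` inherits the compatibility of its product and coproduct from its dual
through the pairing. -/

/-! ## Connected graded bialgebras -/

section Grading
open Coalgebra
variable {K A X : Type*} [Field K] [AddCommGroup A] [Module K A]

/-- The span of the basis vectors of degree `n`. -/
def homog (b : Module.Basis X K A) (sz : X → ℕ) (n : ℕ) : Submodule K A :=
  Submodule.span K (b '' {x | sz x = n})

/-- The elements of total degree `n` of the tensor square. -/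
def tensorHomog (𝒜 : ℕ → Submodule K A) (n : ℕ) : Submodule K (A ⊗[K] A) :=
  Submodule.span K {t | ∃ i j x y, i + j = n ∧ x ∈ 𝒜 i ∧ y ∈ 𝒜 j ∧ t = x ⊗ₜ y}

theorem basis_mem_homog (b : Module.Basis X K A) (sz : X → ℕ) (x : X) :
    b x ∈ homog b sz (sz x) := Submodule.subset_span ⟨x, rfl, rfl⟩

theorem tmul_mem_tensorHomog {𝒜 : ℕ → Submodule K A} {i j n : ℕ} {x y : A} (hx : x ∈ 𝒜 i)
    (hy : y ∈ 𝒜 j) (h : i + j = n) : x ⊗ₜ y ∈ tensorHomog 𝒜 n :=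
  Submodule.subset_span ⟨i, j, x, y, h, hx, hy, rfl⟩


theorem map_mem_of_homog {b : Module.Basis X K A} {sz : X → ℕ} {n : ℕ} {M : Type*}
    [AddCommGroup M] [Module K M] {f : A →ₗ[K] M} {N : Submodule K M}
    (h : ∀ x, sz x = n → f (b x) ∈ N) {a : A} (ha : a ∈ homog b sz n) : f a ∈ N := by
  have : homog b sz n ≤ N.comap f := Submodule.span_le.2 (by rintro _ ⟨x, hx, rfl⟩; exact h x hx)
  exact this ha

theorem eq_of_homog {b : Module.Basis X K A} {sz : X → ℕ} {n : ℕ} {M : Type*}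
    [AddCommGroup M] [Module K M] {f g : A →ₗ[K] M}
    (h : ∀ x, sz x = n → f (b x) = g (b x)) {a : A} (ha : a ∈ homog b sz n) : f a = g a := by
  have : homog b sz n ≤ LinearMap.eqLocus f g :=
    Submodule.span_le.2 (by rintro _ ⟨x, hx, rfl⟩; exact h x hx)
  exact this ha

theorem eq_of_tensorHomog {𝒜 : ℕ → Submodule K A} {n : ℕ} {M : Type*}
    [AddCommGroup M] [Module K M] {f g : A ⊗[K] A →ₗ[K] M}
    (h : ∀ i j x y, i + j = n → x ∈ 𝒜 i → y ∈ 𝒜 j → f (x ⊗ₜ y) = g (x ⊗ₜ y))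
    {t : A ⊗[K] A} (ht : t ∈ tensorHomog 𝒜 n) : f t = g t := by
  have : tensorHomog 𝒜 n ≤ LinearMap.eqLocus f g :=
    Submodule.span_le.2 (by rintro _ ⟨i, j, x, y, hij, hx, hy, rfl⟩; exact h i j x y hij hx hy)
  exact this ht

theorem map_mem_of_tensorHomog {𝒜 : ℕ → Submodule K A} {n : ℕ} {M : Type*}
    [AddCommGroup M] [Module K M] {f : A ⊗[K] A →ₗ[K] M} {N : Submodule K M}
    (h : ∀ i j x y, i + j = n → x ∈ 𝒜 i → y ∈ 𝒜 j → f (x ⊗ₜ y) ∈ N)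
    {t : A ⊗[K] A} (ht : t ∈ tensorHomog 𝒜 n) : f t ∈ N := by
  have : tensorHomog 𝒜 n ≤ N.comap f :=
    Submodule.span_le.2 (by rintro _ ⟨i, j, x, y, hij, hx, hy, rfl⟩; exact h i j x y hij hx hy)
  exact this ht

end Grading

section Antipode
open Coalgebra WithConv
variable {K A X : Type*} [Field K] [Ring A]

section
variable [Algebra K A] [Coalgebra K A]

/-- A basis of homogeneous elements of an algebra and coalgebra that is connected graded. -/
structure IsConnectedGraded (b : Module.Basis X K A) (sz : X → ℕ) : Prop where
  exists_unit : ∃ x₀, sz x₀ = 0 ∧ b x₀ = 1 ∧ ∀ x, sz x = 0 → x = x₀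
  mul_mem : ∀ x y, b x * b y ∈ homog b sz (sz x + sz y)
  comul_mem : ∀ x, comul (R := K) (b x) ∈ tensorHomog (homog b sz) (sz x)
  counit_one : counit (R := K) (1 : A) = 1
  counit_eq_zero : ∀ x, sz x ≠ 0 → counit (R := K) (b x) = 0

namespace IsConnectedGraded
variable {b : Module.Basis X K A} {sz : X → ℕ} (h : IsConnectedGraded b sz)
include h

theorem homog_zero {a : A} (ha : a ∈ homog b sz 0) : a = algebraMap K A (counit (R := K) a) := by
  obtain ⟨x₀, h0, h1, hx⟩ := h.exists_unit
  refine eq_of_homog (f := LinearMap.id) (g := Algebra.linearMap K A ∘ₗ counit) (fun x hx' => ?_) ha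
  rw [hx x hx', h1]
  simp [h.counit_one]

theorem one_mem : (1 : A) ∈ homog b sz 0 := by
  obtain ⟨x₀, h0, h1, -⟩ := h.exists_unit
  rw [← h1, ← h0]
  exact basis_mem_homog b sz x₀

theorem counit_homog {n : ℕ} (hn : n ≠ 0) {a : A} (ha : a ∈ homog b sz n) :
    counit (R := K) a = 0 :=
  eq_of_homog (f := counit) (g := 0) (fun x hx => h.counit_eq_zero x ((show sz x = n from hx).symm ▸ hn)) ha

theorem mul_mem_homog {i j n : ℕ} (hn : i + j = n) {x y : A} (hx : x ∈ homog b sz i)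
    (hy : y ∈ homog b sz j) : x * y ∈ homog b sz n := by
  subst hn
  refine map_mem_of_homog (f := LinearMap.mulRight K y) (fun x hx => ?_) hx
  refine map_mem_of_homog (f := LinearMap.mulLeft K (b x)) (fun y hy => ?_) hy
  subst hx hy
  exact h.mul_mem x y

theorem comul_homog {n : ℕ} {a : A} (ha : a ∈ homog b sz n) :
    comul (R := K) a ∈ tensorHomog (homog b sz) n :=
  map_mem_of_homog (f := comul) (fun x hx => hx ▸ h.comul_mem x) ha

theorem algebraMap_counit_mem {n : ℕ} {a : A} (ha : a ∈ homog b sz n) :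
    algebraMap K A (counit (R := K) a) ∈ homog b sz n := by
  rcases eq_or_ne n 0 with rfl | hn
  · rwa [← h.homog_zero ha]
  · rw [h.counit_homog hn ha, map_zero]
    exact zero_mem _

theorem pow_mem_homog {f : WithConv (A →ₗ[K] A)} (hf : ∀ n, ∀ a ∈ homog b sz n, f a ∈ homog b sz n)
    (k n : ℕ) {a : A} (ha : a ∈ homog b sz n) : (f ^ k) a ∈ homog b sz n := by
  induction k generalizing n a with
  | zero => exact h.algebraMap_counit_mem ha
  | succ k ih =>
    rw [pow_succ', LinearMap.convMul_apply]
    refine map_mem_of_tensorHomog (f := LinearMap.mul' K A ∘ₗ TensorProduct.map f.ofConv (f ^ k).ofConv)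
      (fun i j x y hij hx hy => ?_) (h.comul_homog ha)
    exact h.mul_mem_homog hij (hf i x hx) (ih j hy)

/-- A `k`-th convolution power distributes the degree `n` over `k` factors; if `n < k`, one of them
has degree zero and is killed by `f`. -/
theorem pow_eq_zero {f : WithConv (A →ₗ[K] A)} (hf : ∀ a ∈ homog b sz 0, f a = 0)
    {k n : ℕ} (hk : n < k) {a : A} (ha : a ∈ homog b sz n) : (f ^ k) a = 0 := by
  induction k generalizing n a with
  | zero => omega
  | succ k ih =>
    rw [pow_succ', LinearMap.convMul_apply]
    refine eq_of_tensorHomog (f := LinearMap.mul' K A ∘ₗ TensorProduct.map f.ofConv (f ^ k).ofConv)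
      (g := 0) (fun i j x y hij hx hy => ?_) (h.comul_homog ha)
    change f x * (f ^ k) y = 0
    rcases Nat.eq_zero_or_pos i with rfl | hi
    · rw [hf x hx, zero_mul]
    · rw [ih (by omega) hy, mul_zero]

/-- A connected graded bialgebra has a homogeneous antipode. -/
theorem exists_antipode : ∃ S : A →ₗ[K] A, toConv S * toConv LinearMap.id = 1 ∧
    toConv LinearMap.id * toConv S = 1 ∧ ∀ n, ∀ a ∈ homog b sz n, S a ∈ homog b sz n := by
  -- The convolution inverse of the identity `1 - f` is the geometric series in `f`, which is finite
  -- in each degree because `f` vanishes on scalars.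
  let f : WithConv (A →ₗ[K] A) := 1 - toConv LinearMap.id
  have hid : toConv LinearMap.id = 1 - f := (sub_sub_cancel _ _).symm
  have hf (a : A) : f a = algebraMap K A (counit (R := K) a) - a := rfl
  have hf0 : ∀ a ∈ homog b sz 0, f a = 0 := fun a ha => by
    rw [hf, ← h.homog_zero ha, sub_self]
  have hfn : ∀ n, ∀ a ∈ homog b sz n, f a ∈ homog b sz n := fun n a ha => by
    rw [hf]
    exact sub_mem (h.algebraMap_counit_mem ha) ha
  let T (n : ℕ) : WithConv (A →ₗ[K] A) := ∑ k ∈ Finset.range (n + 1), f ^ k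
  have hTa (n : ℕ) (a : A) : T n a = ∑ k ∈ Finset.range (n + 1), (f ^ k) a := by
    induction n with
    | zero => simp [T]
    | succ n ih =>
      rw [Finset.sum_range_succ, ← ih]
      simp only [T]
      rw [Finset.sum_range_succ]; rfl
  have hT {m n : ℕ} (hmn : m ≤ n) {a : A} (ha : a ∈ homog b sz m) : T n a = T m a := by
    rw [hTa, hTa]
    refine (Finset.sum_subset (Finset.range_mono (by omega)) fun k _ hk => ?_).symm
    exact h.pow_eq_zero hf0 (by simpa using hk) ha
  -- The truncation of the series depends on the degree, so `S` is prescribed on the homogeneous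
  -- basis.
  let S : A →ₗ[K] A := b.constr K fun x => T (sz x) (b x)
  have hS {m n : ℕ} (hmn : m ≤ n) {a : A} (ha : a ∈ homog b sz m) : S a = T n a := by
    refine eq_of_homog (f := S) (g := (T n).ofConv) (fun x hx => ?_) ha
    rw [Module.Basis.constr_basis]
    exact (hT (hx ▸ hmn) (basis_mem_homog b sz x)).symm
  refine ⟨S, ?_, ?_, fun n a ha => ?_⟩
  · refine ofConv_injective (b.ext fun x => ?_)
    have hc := h.comul_mem x
    -- All left factors of the coproduct of `b x` have degree at most `sz x`, so a single truncation
    -- replaces `S` and the geometric sum telescopes.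
    have h1 : (toConv S * toConv LinearMap.id : WithConv (A →ₗ[K] A)) (b x) = (T (sz x) * (1 - f)) (b x) := by
      rw [← hid]
      refine eq_of_tensorHomog
        (f := LinearMap.mul' K A ∘ₗ TensorProduct.map S LinearMap.id)
        (g := LinearMap.mul' K A ∘ₗ TensorProduct.map (T (sz x)).ofConv LinearMap.id)
        (fun i j u v hij hu hv => ?_) hc
      exact congrArg (· * v) (hS (by omega) hu)
    refine h1.trans ?_
    rw [geom_sum_mul_neg]
    change (1 : WithConv (A →ₗ[K] A)) (b x) - (f ^ (sz x + 1)) (b x) = _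
    rw [h.pow_eq_zero hf0 (Nat.lt_succ_self _) (basis_mem_homog b sz x), sub_zero]
  · refine ofConv_injective (b.ext fun x => ?_)
    have hc := h.comul_mem x
    have h1 : (toConv LinearMap.id * toConv S : WithConv (A →ₗ[K] A)) (b x) = ((1 - f) * T (sz x)) (b x) := by
      rw [← hid]
      refine eq_of_tensorHomog
        (f := LinearMap.mul' K A ∘ₗ TensorProduct.map LinearMap.id S)
        (g := LinearMap.mul' K A ∘ₗ TensorProduct.map LinearMap.id (T (sz x)).ofConv)
        (fun i j u v hij hu hv => ?_) hc
      exact congrArg (u * ·) (hS (by omega) hv)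
    refine h1.trans ?_
    rw [mul_neg_geom_sum]
    change (1 : WithConv (A →ₗ[K] A)) (b x) - (f ^ (sz x + 1)) (b x) = _
    rw [h.pow_eq_zero hf0 (Nat.lt_succ_self _) (basis_mem_homog b sz x), sub_zero]
  · rw [hS le_rfl ha, hTa]
    exact sum_mem fun k _ => h.pow_mem_homog hfn k n ha

end IsConnectedGraded
end

theorem IsConnectedGraded.isHopfAlgebra [Bialgebra K A] {b : Module.Basis X K A} {sz : X → ℕ}
    (h : IsConnectedGraded b sz) : IsHopfAlgebra K A := by
  obtain ⟨S, h1, h2, -⟩ := h.exists_antipode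
  exact ⟨coassoc, rTensor_counit_comp_comul, lTensor_counit_comp_comul, Bialgebra.counit_one,
    Bialgebra.counit_mul, Bialgebra.comul_one, Bialgebra.comul_mul,
    S, congrArg WithConv.ofConv h1, congrArg WithConv.ofConv h2⟩

end Antipode

/-! ## Hopf modules -/

section HopfModule
open Coalgebra WithConv
variable {K A M : Type*} [Field K] [Ring A] [Algebra K A] [Coalgebra K A] [AddCommGroup M] [Module K M]

/-- A left Hopf module, not necessarily unital or counital: an action of `A` and a coaction of `A`
such that the coaction is compatible with the actions. -/
structure IsHopfModule (act : A →ₗ[K] M →ₗ[K] M) (coact : M →ₗ[K] A ⊗[K] M) : Prop where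
  act_mul : ∀ x y m, act (x * y) m = act x (act y m)
  coassoc : ∀ m, TensorProduct.assoc K A A M ((comul (R := K)).rTensor M (coact m)) =
    coact.lTensor A (coact m)
  counit : ∀ m, TensorProduct.lift (act ∘ₗ Algebra.linearMap K A ∘ₗ counit) (coact m) = act 1 m
  compat : ∀ x m, coact (act x m) =
    TensorProduct.map₂ (LinearMap.mul K A) act (comul (R := K) x) (coact m)

/-- Convolution with the antipode, the projection onto the coinvariants of a Hopf module. -/
noncomputable def coinvProj (act : A →ₗ[K] M →ₗ[K] M) (coact : M →ₗ[K] A ⊗[K] M) (S : A →ₗ[K] A) :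
    M →ₗ[K] M := TensorProduct.lift (act ∘ₗ S) ∘ₗ coact

/-- In the convolution algebra of linear maps `A → A ⊗ A` the coproduct is the product `i₁ * i₂` of
the two inclusions, `Δ ∘ S` is inverse to it, and `i₂ ∘ S` is inverse to `i₂`; hence `(Δ ∘ S) * i₁ =
i₂ ∘ S`. Multiplicativity of the coproduct enters only through the algebra morphism `δ`, so that the
lemma also serves the opposite coproduct, which is provided as a coalgebra structure only. -/
theorem comul_antipode_mul_includeLeft {S : A →ₗ[K] A} {δ : A →ₐ[K] A ⊗[K] A}
    (hδ : δ.toLinearMap = comul)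
    (h1 : toConv S * toConv LinearMap.id = 1) (h2 : toConv LinearMap.id * toConv S = 1) (x : A) :
    TensorProduct.lift ((LinearMap.mul K (A ⊗[K] A)).compl₁₂ (δ.toLinearMap ∘ₗ S)
      (Algebra.TensorProduct.includeLeft : A →ₐ[K] A ⊗[K] A).toLinearMap) (comul (R := K) x) =
        1 ⊗ₜ S x := by
  let i₁ : A →ₐ[K] A ⊗[K] A := Algebra.TensorProduct.includeLeft
  let i₂ : A →ₐ[K] A ⊗[K] A := Algebra.TensorProduct.includeRight
  have e : toConv i₁.toLinearMap * toConv i₂.toLinearMap = toConv δ.toLinearMap := by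
    refine ofConv_injective ?_
    have : LinearMap.mul' K (A ⊗[K] A) ∘ₗ TensorProduct.map i₁.toLinearMap i₂.toLinearMap =
        LinearMap.id := TensorProduct.ext' fun x y => by simp [i₁, i₂]
    change (LinearMap.mul' K (A ⊗[K] A) ∘ₗ TensorProduct.map i₁.toLinearMap i₂.toLinearMap) ∘ₗ
      comul = _
    rw [this, ← hδ]
    rfl
  have e1 : toConv (δ.toLinearMap ∘ₗ S) * toConv δ.toLinearMap = 1 := by
    refine ofConv_injective ?_
    have := LinearMap.algHom_comp_convMul_distrib δ (toConv S) (toConv LinearMap.id)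
    rw [h1] at this
    refine Eq.trans this.symm ?_
    ext x
    simp [LinearMap.convOne_def]
  have e2 : toConv i₂.toLinearMap * toConv (i₂.toLinearMap ∘ₗ S) = 1 := by
    refine ofConv_injective ?_
    have := LinearMap.algHom_comp_convMul_distrib i₂ (toConv LinearMap.id) (toConv S)
    rw [h2] at this
    refine Eq.trans this.symm ?_
    ext x
    simp [LinearMap.convOne_def]
  have e3 : toConv (δ.toLinearMap ∘ₗ S) * toConv i₁.toLinearMap =
      toConv (i₂.toLinearMap ∘ₗ S) := by
    rw [← e, ← mul_assoc] at e1
    exact left_inv_eq_right_inv e1 e2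
  have := LinearMap.congr_fun (congrArg ofConv e3) x
  refine Eq.trans ?_ this
  rw [LinearMap.convMul_def]
  have : TensorProduct.lift ((LinearMap.mul K (A ⊗[K] A)).compl₁₂ (δ.toLinearMap ∘ₗ S)
      i₁.toLinearMap) =
        LinearMap.mul' K (A ⊗[K] A) ∘ₗ TensorProduct.map (δ.toLinearMap ∘ₗ S) i₁.toLinearMap :=
    TensorProduct.ext' fun x y => rfl
  exact LinearMap.congr_fun this _

namespace IsHopfModule
variable {act : A →ₗ[K] M →ₗ[K] M} {coact : M →ₗ[K] A ⊗[K] M} (h : IsHopfModule act coact)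
  {S : A →ₗ[K] A} (h1 : toConv S * toConv LinearMap.id = 1)
  (h2 : toConv LinearMap.id * toConv S = 1)
include h

/-- Trades a second coaction on the module factor for a coproduct on the algebra factor, after which
only identities in `A` are needed. -/
theorem coact_coact (m : M) (f : A →ₗ[K] M →ₗ[K] M) :
    (TensorProduct.lift f ∘ₗ coact).lTensor A (coact m) =
      (TensorProduct.lift f).lTensor A
        (TensorProduct.assoc K A A M ((comul (R := K)).rTensor M (coact m))) := by
  rw [h.coassoc, LinearMap.lTensor_comp]; rfl

include h2 in
-- In Sweedler notation `m₋₂ S(m₋₁) m₀ = ε(m₋₁) m₀`. This is the existence half of the fundamental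
-- theorem of Hopf modules; the result is `act 1 m` instead of `m` because the action need not be
-- unital.
theorem lift_act_coinvProj (m : M) :
    TensorProduct.lift act ((coinvProj act coact S).lTensor A (coact m)) = act 1 m := by
  rw [coinvProj, h.coact_coact, ← h.counit]
  suffices H : TensorProduct.lift act ∘ₗ (TensorProduct.lift (act ∘ₗ S)).lTensor A ∘ₗ
      (TensorProduct.assoc K A A M).toLinearMap ∘ₗ (comul (R := K)).rTensor M =
        TensorProduct.lift (act ∘ₗ Algebra.linearMap K A ∘ₗ Coalgebra.counit) from
    LinearMap.congr_fun H _
  refine TensorProduct.ext' fun x m => ?_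
  have hx := LinearMap.congr_fun (congrArg ofConv h2) x
  have key : TensorProduct.lift act ∘ₗ (TensorProduct.lift (act ∘ₗ S)).lTensor A ∘ₗ
      (TensorProduct.assoc K A A M).toLinearMap ∘ₗ (TensorProduct.mk K (A ⊗[K] A) M).flip m =
        act.flip m ∘ₗ LinearMap.mul' K A ∘ₗ TensorProduct.map LinearMap.id S :=
    TensorProduct.ext' fun y z => (h.act_mul _ _ _).symm
  refine (LinearMap.congr_fun key (comul x)).trans ?_
  exact congrArg (fun z => act z m) hx

include h1 h2 in
-- By compatibility and coassociativity the coaction of `S(m₋₁) m₀` involves the algebra only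
-- through `Δ(S x') (x'' ⊗ 1)`, which `comul_antipode_mul_includeLeft` evaluates.
theorem coact_coinvProj {δ : A →ₐ[K] A ⊗[K] A} (hδ : δ.toLinearMap = comul) (m : M) : coact (coinvProj act coact S m) = 1 ⊗ₜ coinvProj act coact S m := by
  let Θ : A →ₗ[K] A ⊗[K] M →ₗ[K] A ⊗[K] M :=
    TensorProduct.map₂ (LinearMap.mul K A) act ∘ₗ comul ∘ₗ S
  have e1 : coact ∘ₗ TensorProduct.lift (act ∘ₗ S) = TensorProduct.lift Θ ∘ₗ coact.lTensor A :=
    TensorProduct.ext' fun x m => h.compat (S x) m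
  have e2 : coact (coinvProj act coact S m) = TensorProduct.lift Θ (coact.lTensor A (coact m)) :=
    LinearMap.congr_fun e1 (coact m)
  rw [e2, ← h.coassoc]
  suffices H : TensorProduct.lift Θ ∘ₗ (TensorProduct.assoc K A A M).toLinearMap ∘ₗ
      (comul (R := K)).rTensor M = TensorProduct.mk K A M 1 ∘ₗ TensorProduct.lift (act ∘ₗ S) from
    LinearMap.congr_fun H _
  refine TensorProduct.ext' fun x m => ?_
  have key : TensorProduct.lift Θ ∘ₗ (TensorProduct.assoc K A A M).toLinearMap ∘ₗ
      (TensorProduct.mk K (A ⊗[K] A) M).flip m = (act.flip m).lTensor A ∘ₗ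
        TensorProduct.lift ((LinearMap.mul K (A ⊗[K] A)).compl₁₂ (δ.toLinearMap ∘ₗ S)
          (Algebra.TensorProduct.includeLeft : A →ₐ[K] A ⊗[K] A).toLinearMap) := by
    refine TensorProduct.ext' fun y z => ?_
    rw [hδ]
    change TensorProduct.map₂ (LinearMap.mul K A) act (comul (S y)) (z ⊗ₜ m) =
      (act.flip m).lTensor A (comul (S y) * z ⊗ₜ 1)
    have : (TensorProduct.map₂ (LinearMap.mul K A) act).flip (z ⊗ₜ m) =
        (act.flip m).lTensor A ∘ₗ LinearMap.mulRight K (z ⊗ₜ[K] (1 : A)) :=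
      TensorProduct.ext' fun a b => by simp
    exact LinearMap.congr_fun this _
  refine (LinearMap.congr_fun key (comul x)).trans ?_
  rw [LinearMap.comp_apply, comul_antipode_mul_includeLeft hδ h1 h2]
  rfl

theorem coact_act {q : M} (hq : coact q = 1 ⊗ₜ q) (x : A) :
    coact (act x q) = (act.flip q).lTensor A (comul x) := by
  rw [h.compat, hq]
  have : (TensorProduct.map₂ (LinearMap.mul K A) act).flip (1 ⊗ₜ q) = (act.flip q).lTensor A :=
    TensorProduct.ext' fun a b => by simp
  exact LinearMap.congr_fun this _

include h1 in
theorem coinvProj_act {q : M} (hq : coact q = 1 ⊗ₜ q) (x : A) :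
    coinvProj act coact S (act x q) = Coalgebra.counit (R := K) x • act 1 q := by
  have hx := LinearMap.congr_fun (congrArg ofConv h1) x
  have key : TensorProduct.lift (act ∘ₗ S) ∘ₗ (act.flip q).lTensor A =
      act.flip q ∘ₗ LinearMap.mul' K A ∘ₗ TensorProduct.map S LinearMap.id :=
    TensorProduct.ext' fun y z => (h.act_mul _ _ _).symm
  rw [coinvProj, LinearMap.comp_apply, h.coact_act hq]
  refine (LinearMap.congr_fun key (comul x)).trans ?_
  refine (congrArg (fun z => act z q) hx).trans ?_
  simp [LinearMap.convOne_def, Algebra.algebraMap_eq_smul_one]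

include h1 in
-- The uniqueness half of the fundamental theorem: the coefficient `x` of a coinvariant `q` can be
-- read off, since `x' ⊗ x'' q` is sent to `x' ⊗ ε(x'') q`.
theorem lTensor_coinvProj_coact_act {q : M} (hq : coact q = 1 ⊗ₜ q) (hq' : act 1 q = q) (x : A) :
    (coinvProj act coact S).lTensor A (coact (act x q)) = x ⊗ₜ q := by
  have e : coinvProj act coact S ∘ₗ act.flip q =
      LinearMap.toSpanSingleton K M q ∘ₗ Coalgebra.counit := by
    ext x
    simp [h.coinvProj_act h1 hq, hq']
  rw [h.coact_act hq, ← LinearMap.comp_apply, ← LinearMap.lTensor_comp, e, LinearMap.lTensor_comp,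
    LinearMap.comp_apply, Coalgebra.lTensor_counit_comul]
  simp

end IsHopfModule

end HopfModule

/-! ### The opposite coalgebra. -/

section Cop
open Coalgebra
variable {K A : Type*} [Field K] [AddCommGroup A] [Module K A]

variable (K A) in
/-- The reversal of triple tensors. -/
noncomputable def tensorReverse : (A ⊗[K] A) ⊗[K] A →ₗ[K] A ⊗[K] (A ⊗[K] A) :=
  (TensorProduct.comm K A A).toLinearMap.lTensor A ∘ₗ
    (TensorProduct.comm K (A ⊗[K] A) A).toLinearMap

/-- Together with `assoc_rTensor_comm_comp`: flipping a coproduct or a coaction reverses triple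
tensors and exchanges the two sides of coassociativity. -/
theorem lTensor_comm_comp (f : A →ₗ[K] A ⊗[K] A) (t : A ⊗[K] A) :
    ((TensorProduct.comm K A A).toLinearMap ∘ₗ f).lTensor A (TensorProduct.comm K A A t) =
      tensorReverse K A (f.rTensor A t) := by
  have : ((TensorProduct.comm K A A).toLinearMap ∘ₗ f).lTensor A ∘ₗ
      (TensorProduct.comm K A A).toLinearMap = tensorReverse K A ∘ₗ f.rTensor A :=
    TensorProduct.ext' fun x y => rfl
  exact LinearMap.congr_fun this t

theorem assoc_rTensor_comm_comp (f : A →ₗ[K] A ⊗[K] A) (t : A ⊗[K] A) :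
    TensorProduct.assoc K A A A
      (((TensorProduct.comm K A A).toLinearMap ∘ₗ f).rTensor A (TensorProduct.comm K A A t)) =
      tensorReverse K A ((TensorProduct.assoc K A A A).symm (f.lTensor A t)) := by
  have : (TensorProduct.assoc K A A A).toLinearMap ∘ₗ
      ((TensorProduct.comm K A A).toLinearMap ∘ₗ f).rTensor A ∘ₗ
      (TensorProduct.comm K A A).toLinearMap =
        tensorReverse K A ∘ₗ (TensorProduct.assoc K A A A).symm.toLinearMap ∘ₗ f.lTensor A := by
    refine TensorProduct.ext' fun x y => ?_
    have : (TensorProduct.assoc K A A A).toLinearMap ∘ₗ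
        (TensorProduct.mk K (A ⊗[K] A) A).flip x ∘ₗ (TensorProduct.comm K A A).toLinearMap =
          tensorReverse K A ∘ₗ (TensorProduct.assoc K A A A).symm.toLinearMap ∘ₗ
            TensorProduct.mk K A (A ⊗[K] A) x :=
      TensorProduct.ext' fun a b => rfl
    exact LinearMap.congr_fun this (f y)
  exact LinearMap.congr_fun this t

theorem comm_map₂ (f g : A →ₗ[K] A →ₗ[K] A) (s t : A ⊗[K] A) :
    TensorProduct.comm K A A (TensorProduct.map₂ f g s t) =
      TensorProduct.map₂ g f (TensorProduct.comm K A A s) (TensorProduct.comm K A A t) := by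
  have : (TensorProduct.map₂ f g).compr₂ (TensorProduct.comm K A A).toLinearMap =
      (TensorProduct.map₂ g f).compl₁₂ (TensorProduct.comm K A A).toLinearMap
        (TensorProduct.comm K A A).toLinearMap :=
    TensorProduct.ext' fun a b => TensorProduct.ext' fun c d => rfl
  exact LinearMap.congr_fun (LinearMap.congr_fun this s) t

variable (K A) in
/-- The coalgebra with the opposite coproduct. -/
@[reducible]
noncomputable def copCoalgebra [Coalgebra K A] : Coalgebra K A where
  comul := (TensorProduct.comm K A A).toLinearMap ∘ₗ comul
  counit := counit
  coassoc := by
    ext a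
    refine (assoc_rTensor_comm_comp _ _).trans (Eq.trans ?_ (lTensor_comm_comp _ _).symm)
    rw [Coalgebra.coassoc_symm_apply]
  rTensor_counit_comp_comul := by
    have : (counit (R := K) (A := A)).rTensor A ∘ₗ (TensorProduct.comm K A A).toLinearMap =
        (TensorProduct.comm K A K).toLinearMap ∘ₗ (counit (R := K) (A := A)).lTensor A :=
      TensorProduct.ext' fun x y => rfl
    rw [← LinearMap.comp_assoc, this, LinearMap.comp_assoc, lTensor_counit_comp_comul]
    rfl
  lTensor_counit_comp_comul := by
    have : (counit (R := K) (A := A)).lTensor A ∘ₗ (TensorProduct.comm K A A).toLinearMap =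
        (TensorProduct.comm K K A).toLinearMap ∘ₗ (counit (R := K) (A := A)).rTensor A :=
      TensorProduct.ext' fun x y => rfl
    rw [← LinearMap.comp_assoc, this, LinearMap.comp_assoc, rTensor_counit_comp_comul]
    rfl

end Cop

/-! ## Bialgebras with a split coproduct and a grafting operation -/

section Grafting
open Coalgebra WithConv
variable {K A X : Type*} [Field K] [Ring A] [Bialgebra K A]

/-- A connected graded bialgebra whose coproduct splits as `lam + rho` on the augmentation ideal, and
an action `graft` of the algebra on the augmentation ideal, which is compatible with the splitting. -/
structure IsGrafting (b : Module.Basis X K A) (sz : X → ℕ) (lam rho : A →ₗ[K] A ⊗[K] A)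
    (graft : A →ₗ[K] A →ₗ[K] A) : Prop where
  graded : IsConnectedGraded b sz
  comul_eq : ∀ a, comul (R := K) a = lam a + rho a + counit (R := K) a • (1 ⊗ₜ 1)
  lam_coassoc : ∀ a, TensorProduct.assoc K A A A (comul.rTensor A (lam a)) = lam.lTensor A (lam a)
  lam_rho : ∀ a, TensorProduct.assoc K A A A (lam.rTensor A (rho a)) = rho.lTensor A (lam a)
  rho_coassoc : ∀ a, TensorProduct.assoc K A A A (rho.rTensor A (rho a)) = comul.lTensor A (rho a)
  counit_lam : ∀ a, counit.rTensor A (lam a) = 1 ⊗ₜ (a - counit (R := K) a • 1)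
  lam_counit : ∀ a, (counit (R := K)).lTensor A (lam a) = 0
  rho_counit : ∀ a, counit.lTensor A (rho a) = (a - counit (R := K) a • 1) ⊗ₜ 1
  lam_mul : ∀ x y, lam (x * y) = comul x * lam y + counit (R := K) y • lam x
  graft_mul : ∀ x y m, graft (x * y) m = graft x (graft y m)
  graft_one : ∀ m, graft 1 m = m - counit (R := K) m • 1
  lam_graft : ∀ x m, lam (graft x m) = (graft x).lTensor A (lam m)
  rho_graft : ∀ x m, rho (graft x m) =
    TensorProduct.map₂ graft (LinearMap.mul K A) (comul x) (rho m)
  lam_mem : ∀ x, lam (b x) ∈ tensorHomog (homog b sz) (sz x)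
  rho_mem : ∀ x, rho (b x) ∈ tensorHomog (homog b sz) (sz x)
  graft_mem : ∀ x y, graft (b x) (b y) ∈ homog b sz (sz x + sz y)

theorem IsConnectedGraded.cop {b : Module.Basis X K A} {sz : X → ℕ} (h : IsConnectedGraded b sz) :
    letI := copCoalgebra K A
    IsConnectedGraded b sz := by
  obtain ⟨h1, h2, h3, h4, h5⟩ := h
  let := copCoalgebra K A
  refine ⟨h1, h2, fun x => ?_, h4, h5⟩
  refine map_mem_of_tensorHomog (f := (TensorProduct.comm K A A).toLinearMap)
    (fun i j x y hij hx hy => ?_) (h3 x)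
  exact tmul_mem_tensorHomog hy hx ((add_comm j i).trans hij)

namespace IsGrafting
variable {b : Module.Basis X K A} {sz : X → ℕ} {lam rho : A →ₗ[K] A ⊗[K] A}
    {graft : A →ₗ[K] A →ₗ[K] A} (h : IsGrafting b sz lam rho graft)

variable (K A) in
/-- Left multiplication, preceded by the projection onto the augmentation ideal. -/
noncomputable def mulAug : A →ₗ[K] A →ₗ[K] A :=
  (LinearMap.mul K A).compl₂ (LinearMap.id - Algebra.linearMap K A ∘ₗ counit)

theorem mulAug_apply (x y : A) :
    mulAug K A x y = x * (y - algebraMap K A (counit (R := K) y)) := rfl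

theorem mulAug_of_counit {y : A} (hy : counit (R := K) y = 0) (x : A) : mulAug K A x y = x * y := by
  rw [mulAug_apply, hy, map_zero, sub_zero]

include h

/-- The rule `lam_mul` for `1 * 1` produces `lam 1` twice. -/
theorem lam_one : lam 1 = 0 := by
  have := h.lam_mul 1 1
  simpa using this

/-- Plain multiplication would be incompatible with `lam` on scalars because of the counit term in
`lam_mul`. `mulAug` discards the scalar part, and by `lam_counit` the module factor of `lam` has
none. -/
theorem isHopfModule_lam : IsHopfModule (mulAug K A) lam where
  act_mul x y m := by
    rw [mulAug_of_counit (x := x), mulAug_apply, mulAug_apply, mul_assoc]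
    simp [mulAug_apply]
  coassoc := h.lam_coassoc
  counit m := by
    have : TensorProduct.lift (mulAug K A ∘ₗ Algebra.linearMap K A ∘ₗ counit (A := A)) =
        mulAug K A 1 ∘ₗ (TensorProduct.lid K A).toLinearMap ∘ₗ counit.rTensor A :=
      TensorProduct.ext' fun x y => by
        simp only [TensorProduct.lift.tmul, LinearMap.comp_apply, Algebra.linearMap_apply,
          Algebra.algebraMap_eq_smul_one, map_smul, LinearMap.smul_apply, LinearMap.rTensor_tmul,
          LinearEquiv.coe_coe, TensorProduct.lid_tmul]
    rw [this, LinearMap.comp_apply, LinearMap.comp_apply, h.counit_lam]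
    simp [mulAug_apply, Algebra.algebraMap_eq_smul_one]
  compat x m := by
    have e (t : A ⊗[K] A) : TensorProduct.map₂ (LinearMap.mul K A) (mulAug K A) t =
        LinearMap.mulLeft K t ∘ₗ
          (LinearMap.id - Algebra.linearMap K A ∘ₗ Coalgebra.counit).lTensor A := by
      induction t with
      | zero => ext; simp
      | tmul x y => exact TensorProduct.ext' fun a b => by simp [mulAug, ← TensorProduct.tmul_sub]
      | add s t hs ht => rw [map_add, hs, ht]; ext; simp [add_mul]
    rw [e, LinearMap.comp_apply, LinearMap.lTensor_sub, LinearMap.sub_apply, LinearMap.lTensor_comp,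
      LinearMap.comp_apply, h.lam_counit, mulAug_apply, mul_sub, map_sub, h.lam_mul,
      Algebra.algebraMap_eq_smul_one, mul_smul_comm, mul_one, map_smul]
    simp

/-- `rho` coacts from the right while `graft` acts from the left. Flipping `rho` gives a left
coaction at the price of the opposite coproduct. -/
theorem isHopfModule_rho :
    letI := copCoalgebra K A
    IsHopfModule graft ((TensorProduct.comm K A A).toLinearMap ∘ₗ rho) :=
  letI := copCoalgebra K A
  { act_mul := h.graft_mul
    coassoc := fun m => by
      refine (assoc_rTensor_comm_comp _ _).trans (Eq.trans ?_ (lTensor_comm_comp _ _).symm)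
      rw [← h.rho_coassoc, LinearEquiv.symm_apply_apply]
    counit := fun m => by
      have : TensorProduct.lift (graft ∘ₗ Algebra.linearMap K A ∘ₗ Coalgebra.counit (A := A)) ∘ₗ
          (TensorProduct.comm K A A).toLinearMap =
            graft 1 ∘ₗ (TensorProduct.rid K A).toLinearMap ∘ₗ Coalgebra.counit.lTensor A :=
        TensorProduct.ext' fun x y => by
          simp [Algebra.algebraMap_eq_smul_one]
      refine (LinearMap.congr_fun this (rho m)).trans ?_
      refine (congrArg (fun t => graft 1 (TensorProduct.rid K A t)) (h.rho_counit m)).trans ?_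
      simp [h.graft_one]
    compat := fun x m => (congrArg _ (h.rho_graft x m)).trans (comm_map₂ _ _ _ _) }

theorem counit_eq_zero_of_lam {q : A} (hq : lam q = 1 ⊗ₜ q) : counit (R := K) q = 0 := by
  have := h.lam_counit q
  rw [hq, LinearMap.lTensor_tmul] at this
  have := congrArg (fun t => counit (R := K) (TensorProduct.rid K A t)) this
  simpa using this

theorem graft_one_of_lam {q : A} (hq : lam q = 1 ⊗ₜ q) : graft 1 q = q := by
  rw [h.graft_one, h.counit_eq_zero_of_lam hq, zero_smul, sub_zero]

/-- By `lam_rho` the left factors of `rho q` are again coinvariant for `lam`. So these coinvariants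
form a subcomodule for `rho`, and the Hopf module theorem can be applied a second time, inside them.
-/
theorem lTensor_lam_comm_rho {q : A} (hq : lam q = 1 ⊗ₜ q) :
    lam.lTensor A (TensorProduct.comm K A A (rho q)) =
      (TensorProduct.mk K A A 1).lTensor A (TensorProduct.comm K A A (rho q)) := by
  have e1 : lam.lTensor A ∘ₗ (TensorProduct.comm K A A).toLinearMap =
      (TensorProduct.comm K (A ⊗[K] A) A).toLinearMap ∘ₗ lam.rTensor A :=
    TensorProduct.ext' fun x y => rfl
  have e2 : (TensorProduct.mk K A A 1).lTensor A ∘ₗ (TensorProduct.comm K A A).toLinearMap =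
      (TensorProduct.comm K (A ⊗[K] A) A).toLinearMap ∘ₗ
        (TensorProduct.assoc K A A A).symm.toLinearMap ∘ₗ TensorProduct.mk K A (A ⊗[K] A) 1 :=
    TensorProduct.ext' fun x y => rfl
  refine (LinearMap.congr_fun e1 _).trans ((LinearMap.congr_fun e2 _).trans ?_).symm
  have := h.lam_rho q
  rw [hq, LinearMap.lTensor_tmul, ← LinearEquiv.eq_symm_apply] at this
  simp [this]

/-- The homogeneous projection onto the elements with trivial left coaction. -/
theorem exists_proj_lam : ∃ P : A →ₗ[K] A, (∀ n, ∀ a ∈ homog b sz n, P a ∈ homog b sz n) ∧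
    (∀ a, a = algebraMap K A (counit (R := K) a) + LinearMap.mul' K A (P.lTensor A (lam a))) ∧
    (∀ a, lam (P a) = 1 ⊗ₜ P a) ∧ P 1 = 0 ∧
    (∀ q, lam q = 1 ⊗ₜ q → ∀ x, P.lTensor A (lam (x * q)) = x ⊗ₜ q) ∧
    ∀ q, lam q = 1 ⊗ₜ q → P.lTensor A (TensorProduct.comm K A A (rho q)) =
      TensorProduct.comm K A A (rho q) := by
  obtain ⟨S, h1, h2, hS⟩ := h.graded.exists_antipode
  have hM := h.isHopfModule_lam
  have hP1 (a : A) : lam (coinvProj (mulAug K A) lam S a) = 1 ⊗ₜ coinvProj (mulAug K A) lam S a :=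
    hM.coact_coinvProj h1 h2 (δ := Bialgebra.comulAlgHom K A) rfl a
  have hS1 : S 1 = 1 := by
    have := LinearMap.congr_fun (congrArg ofConv h1) 1
    simpa [LinearMap.convMul_def, LinearMap.convOne_def, Algebra.TensorProduct.one_def] using this
  refine ⟨coinvProj (mulAug K A) lam S, fun n a ha => ?_, fun a => ?_, hP1, ?_, fun q hq x => ?_,
    fun q hq => ?_⟩
  · refine map_mem_of_tensorHomog (f := TensorProduct.lift (mulAug K A ∘ₗ S))
      (fun i j x y hij hx hy => ?_) (map_mem_of_homog (fun x hx => hx ▸ h.lam_mem x) ha)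
    exact h.graded.mul_mem_homog hij (hS i x hx)
      (sub_mem hy (h.graded.algebraMap_counit_mem hy))
  · have := hM.lift_act_coinvProj h2 a
    rw [mulAug_apply, one_mul] at this
    rw [eq_comm, ← eq_sub_iff_add_eq', ← this]
    have : LinearMap.mul' K A ∘ₗ (coinvProj (mulAug K A) lam S).lTensor A =
        TensorProduct.lift (mulAug K A) ∘ₗ (coinvProj (mulAug K A) lam S).lTensor A :=
      TensorProduct.ext' fun x y =>
        (mulAug_of_counit (h.counit_eq_zero_of_lam (hP1 y)) x).symm
    exact LinearMap.congr_fun this _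
  · simp [coinvProj, h.lam_one]
  · have hq0 := h.counit_eq_zero_of_lam hq
    have := hM.lTensor_coinvProj_coact_act h1 hq (by rw [mulAug_of_counit hq0, one_mul]) x
    rwa [mulAug_of_counit hq0] at this
  · rw [coinvProj, LinearMap.lTensor_comp, LinearMap.comp_apply, h.lTensor_lam_comm_rho hq,
      ← LinearMap.comp_apply, ← LinearMap.lTensor_comp]
    -- On a coinvariant `u` the projection is `S(1) (u - ε(u))`, so it remains to see that the
    -- counit vanishes on the left factors of `rho q`.
    have e : TensorProduct.lift (mulAug K A ∘ₗ S) ∘ₗ TensorProduct.mk K A A 1 =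
        LinearMap.id - Algebra.linearMap K A ∘ₗ counit := by
      ext x
      simp [hS1, mulAug_apply]
    have e0 : (counit (R := K)).lTensor A (TensorProduct.comm K A A (rho q)) = 0 := by
      -- Applying `ε ⊗ ε` to `lam u = 1 ⊗ u` for the left factors `u` of `rho q` gives `0 = ε(u)`.
      have e1 := congrArg (((TensorProduct.lid K K).toLinearMap ∘ₗ
        TensorProduct.map counit counit).lTensor A) (h.lTensor_lam_comm_rho hq)
      rw [← LinearMap.comp_apply, ← LinearMap.comp_apply, ← LinearMap.lTensor_comp,
        ← LinearMap.lTensor_comp] at e1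
      have e2 : ((TensorProduct.lid K K).toLinearMap ∘ₗ TensorProduct.map counit counit) ∘ₗ lam =
          0 := by
        ext a
        have e3 : TensorProduct.map (counit (R := K) (A := A)) (counit (R := K) (A := A)) =
            counit.rTensor K ∘ₗ counit.lTensor A := TensorProduct.ext' fun x y => rfl
        change TensorProduct.lid K K (TensorProduct.map counit counit (lam a)) = 0
        rw [e3, LinearMap.comp_apply, h.lam_counit, map_zero, map_zero]
      have e4 : ((TensorProduct.lid K K).toLinearMap ∘ₗ TensorProduct.map counit counit) ∘ₗ
          TensorProduct.mk K A A 1 = counit := by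
        ext a
        simp
      rw [e2, e4, LinearMap.lTensor_zero] at e1
      exact e1.symm
    rw [e, LinearMap.lTensor_sub, LinearMap.sub_apply, LinearMap.lTensor_comp,
      LinearMap.comp_apply, e0]
    simp

/-- The homogeneous projection onto the elements with trivial right coaction. -/
theorem exists_proj_rho : ∃ W : A →ₗ[K] A, (∀ n, ∀ a ∈ homog b sz n, W a ∈ homog b sz n) ∧
    (∀ q, lam q = 1 ⊗ₜ q → q = TensorProduct.lift graft
      (W.lTensor A (TensorProduct.comm K A A (rho q)))) ∧
    (∀ a, rho (W a) = W a ⊗ₜ 1) ∧ (∀ q, lam q = 1 ⊗ₜ q → lam (W q) = 1 ⊗ₜ W q) ∧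
    ∀ q, lam q = 1 ⊗ₜ q → rho q = q ⊗ₜ 1 → ∀ x,
      W.lTensor A (TensorProduct.comm K A A (rho (graft x q))) = x ⊗ₜ q := by
  have hg := h.graded.cop
  have hM := h.isHopfModule_rho
  -- The antipode for the opposite coproduct is again obtained from the grading, so the antipode of
  -- `A` need not be inverted.
  obtain ⟨S, h1, h2, hS⟩ :=
    @IsConnectedGraded.exists_antipode _ _ _ _ _ _ (copCoalgebra K A) _ _ hg
  have hW := @IsHopfModule.coact_coinvProj _ _ _ _ _ _ (copCoalgebra K A) _ _ _ _ hM _ h1 h2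
    ((Algebra.TensorProduct.comm K A A).toAlgHom.comp (Bialgebra.comulAlgHom K A)) rfl
  have hL := @IsHopfModule.lift_act_coinvProj _ _ _ _ _ _ (copCoalgebra K A) _ _ _ _ hM _ h2
  have hR := @IsHopfModule.lTensor_coinvProj_coact_act _ _ _ _ _ _ (copCoalgebra K A) _ _ _ _ hM _ h1
  refine ⟨coinvProj graft ((TensorProduct.comm K A A).toLinearMap ∘ₗ rho) S, fun n a ha => ?_,
    fun q hq => ?_, fun a => ?_, fun q hq => ?_, fun q hq hq' x => ?_⟩
  · have hr := map_mem_of_homog (f := rho) (fun x hx => hx ▸ h.rho_mem x) ha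
    refine map_mem_of_tensorHomog (f := TensorProduct.lift (graft ∘ₗ S) ∘ₗ
      (TensorProduct.comm K A A).toLinearMap) (fun i j x y hij hx hy => ?_) hr
    subst hij
    refine map_mem_of_homog (f := graft.flip x ∘ₗ LinearMap.id) (fun y hy => ?_) (hS j y hy)
    refine map_mem_of_homog (f := graft (b y)) (fun x hx => ?_) hx
    subst hx hy
    rw [add_comm]
    exact h.graft_mem y x
  · exact ((hL q).trans (h.graft_one_of_lam hq)).symm
  · have := congrArg (TensorProduct.comm K A A).symm (hW a)
    simpa using this
  -- `W q` is a sum of graftings on left factors of `rho q`. These are coinvariant for `lam`, and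
  -- grafting commutes with `lam`.
  · let Θ : A →ₗ[K] A ⊗[K] A →ₗ[K] A ⊗[K] A := LinearMap.lTensorHom A ∘ₗ graft ∘ₗ S
    have e1 : lam ∘ₗ TensorProduct.lift (graft ∘ₗ S) = TensorProduct.lift Θ ∘ₗ lam.lTensor A :=
      TensorProduct.ext' fun x m => h.lam_graft (S x) m
    have e2 : TensorProduct.lift Θ ∘ₗ (TensorProduct.mk K A A 1).lTensor A =
        TensorProduct.mk K A A 1 ∘ₗ TensorProduct.lift (graft ∘ₗ S) :=
      TensorProduct.ext' fun x m => rfl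
    refine (LinearMap.congr_fun e1 (TensorProduct.comm K A A (rho q))).trans ?_
    rw [LinearMap.comp_apply, h.lTensor_lam_comm_rho hq]
    exact LinearMap.congr_fun e2 _
  · exact hR (by simp [hq']) (h.graft_one_of_lam hq) x

end IsGrafting
end Grafting

/-! ## The basis indexed by binary trees -/

section TreeBasis
open Coalgebra

theorem LinearIndependent.exists_dual {ι K M : Type*} [Field K] [AddCommGroup M] [Module K M]
    {v : ι → M} (hv : LinearIndependent K v) (i : ι) :
    ∃ φ : M →ₗ[K] K, φ (v i) = 1 ∧ ∀ j ≠ i, φ (v j) = 0 := by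
  obtain ⟨φ, hφ⟩ := LinearMap.exists_extend (Finsupp.lapply i ∘ₗ hv.repr)
  have key (j : ι) : φ (v j) = Finsupp.single j (1 : K) i := by
    have := LinearMap.congr_fun hφ ⟨v j, Submodule.subset_span ⟨j, rfl⟩⟩
    refine this.trans ?_
    rw [← hv.repr_eq_single j ⟨v j, Submodule.subset_span ⟨j, rfl⟩⟩ rfl]; rfl
  exact ⟨φ, by simp [key], fun j hj => by rw [key, Finsupp.single_eq_of_ne hj.symm]⟩

theorem linearIndependent_of_exists_dual {ι K M : Type*} [Field K] [AddCommGroup M] [Module K M]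
    {v : ι → M} (hv : ∀ i, ∃ φ : M →ₗ[K] K, φ (v i) = 1 ∧ ∀ j ≠ i, φ (v j) = 0) :
    LinearIndependent K v := by
  rw [linearIndependent_iff']
  intro s g hg i hi
  obtain ⟨φ, h1, h2⟩ := hv i
  have := congrArg φ hg
  rw [map_sum, Finset.sum_eq_single i (fun j _ hj => by rw [map_smul, h2 j hj, smul_zero])
    (fun h => absurd hi h), map_smul, h1, map_zero] at this
  simpa using this

theorem LinearIndependent.finrank_span_image {ι K M : Type*} [Field K] [AddCommGroup M]
    [Module K M] {v : ι → M} (hv : LinearIndependent K v) (s : Set ι) :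
    Module.finrank K (Submodule.span K (v '' s)) = Nat.card s := by
  have := Module.finrank_eq_nat_card_basis
    (Module.Basis.span (hv.comp ((↑) : s → ι) Subtype.val_injective))
  rwa [Set.range_comp, Subtype.range_coe] at this

variable {K A X : Type*} [Field K] [Ring A] [Bialgebra K A]

/-- The sum of the degrees of the labels of a tree. -/
def treeWeight {d : ℕ → ℕ} : BinaryTree (Σ n, Fin (d n)) → ℕ
  | .nil => 0
  | .node i l r => i.1 + treeWeight l + treeWeight r

/-- The element of `A` attached to a tree labelled by elements of `A`. -/
def treeElement {ι : Type*} (graft : A →ₗ[K] A →ₗ[K] A) (v : ι → A) : BinaryTree ι → A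
  | .nil => 1
  | .node i l r => treeElement graft v l * graft (treeElement graft v r) (v i)

/-- The elements with trivial coactions on both sides. -/
def totalPrimitives (lam rho : A →ₗ[K] A ⊗[K] A) : Submodule K A :=
  LinearMap.eqLocus lam (TensorProduct.mk K A A 1) ⊓
    LinearMap.eqLocus rho ((TensorProduct.mk K A A).flip 1)

theorem mem_totalPrimitives {lam rho : A →ₗ[K] A ⊗[K] A} {v : A} :
    v ∈ totalPrimitives lam rho ↔ lam v = 1 ⊗ₜ v ∧ rho v = v ⊗ₜ 1 := Iff.rfl

theorem mul_graft_mem_span {graft : A →ₗ[K] A →ₗ[K] A} {d : ℕ → ℕ} {v : (Σ n, Fin (d n)) → A} {i j k n : ℕ}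
    (hn : i + (j + k) = n) {x y w : A}
    (hx : x ∈ Submodule.span K (treeElement graft v '' {t | treeWeight t = i}))
    (hy : y ∈ Submodule.span K (treeElement graft v '' {t | treeWeight t = j}))
    (hw : w ∈ Submodule.span K (Set.range fun m : Fin (d k) => v ⟨k, m⟩)) :
    x * graft y w ∈ Submodule.span K (treeElement graft v '' {t | treeWeight t = n}) := by
  set N := Submodule.span K (treeElement graft v '' {t | treeWeight t = n})
  refine (Submodule.span_le (p := N.comap (LinearMap.mulRight K (graft y w)))).2 ?_ hx
  rintro _ ⟨s, hs, rfl⟩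
  refine (Submodule.span_le (p := N.comap
    (LinearMap.mulLeft K (treeElement graft v s) ∘ₗ graft.flip w))).2 ?_ hy
  rintro _ ⟨t, ht, rfl⟩
  refine (Submodule.span_le (p := N.comap
    (LinearMap.mulLeft K (treeElement graft v s) ∘ₗ graft (treeElement graft v t)))).2 ?_ hw
  rintro _ ⟨m, rfl⟩
  refine Submodule.subset_span ⟨.node ⟨k, m⟩ s t, ?_, rfl⟩
  simp only [Set.mem_ofPred_eq, treeWeight] at hs ht ⊢
  omega

namespace IsGrafting
variable {b : Module.Basis X K A} {sz : X → ℕ} {lam rho : A →ₗ[K] A ⊗[K] A}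
    {graft : A →ₗ[K] A →ₗ[K] A} (h : IsGrafting b sz lam rho graft)
include h

theorem graft_mem_homog {i j n : ℕ} (hn : i + j = n) {x y : A} (hx : x ∈ homog b sz i)
    (hy : y ∈ homog b sz j) : graft x y ∈ homog b sz n := by
  subst hn
  refine map_mem_of_homog (f := graft.flip y) (fun x hx => ?_) hx
  refine map_mem_of_homog (f := graft (b x)) (fun y hy => ?_) hy
  subst hx hy
  exact h.graft_mem x y

theorem lam_graft_of_lam {q : A} (hq : lam q = 1 ⊗ₜ q) (x : A) :
    lam (graft x q) = 1 ⊗ₜ graft x q := by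
  rw [h.lam_graft, hq, LinearMap.lTensor_tmul]

/-- The decomposition `x * graft y v ↦ x ⊗ (y ⊗ v)` is induced by a linear map `J` on `A`, composed
of the two coactions and the two projections. Functionals dual to the two subtrees and to the label
therefore combine with `J` to a functional dual to the whole tree; for the empty tree the counit
does it. -/
theorem linearIndependent_treeElement {ι : Type*} {v : ι → A} (hv : LinearIndependent K v)
    (hV : ∀ i, v i ∈ totalPrimitives lam rho) : LinearIndependent K (treeElement graft v) := by
  refine linearIndependent_of_exists_dual fun t => ?_
  obtain ⟨P, -, -, -, -, hP, -⟩ := h.exists_proj_lam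
  obtain ⟨W, -, -, -, -, hW⟩ := h.exists_proj_rho
  have hq (i : ι) (y : A) := h.lam_graft_of_lam (hV i).1 y
  induction t with
  | nil =>
    refine ⟨counit, Bialgebra.counit_one, fun t ht => ?_⟩
    cases t with
    | nil => exact absurd rfl ht
    | node i l r =>
      rw [treeElement, Bialgebra.counit_mul, h.counit_eq_zero_of_lam (hq i _), mul_zero]
  | node i l r hl hr =>
    obtain ⟨φ, h1, h2⟩ := hl
    obtain ⟨χ, h3, h4⟩ := hr
    obtain ⟨ψ, h5, h6⟩ := hv.exists_dual i
    let J : A →ₗ[K] A ⊗[K] (A ⊗[K] A) := (W.lTensor A ∘ₗ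
      (TensorProduct.comm K A A).toLinearMap ∘ₗ rho).lTensor A ∘ₗ P.lTensor A ∘ₗ lam
    have hJ (x y : A) (j : ι) : J (x * graft y (v j)) = x ⊗ₜ (y ⊗ₜ v j) := by
      change (W.lTensor A ∘ₗ (TensorProduct.comm K A A).toLinearMap ∘ₗ rho).lTensor A
        (P.lTensor A (lam (x * graft y (v j)))) = _
      rw [hP _ (hq j y)]
      exact congrArg (x ⊗ₜ[K] ·) (hW _ (hV j).1 (hV j).2 y)
    refine ⟨LinearMap.mul' K K ∘ₗ TensorProduct.map φ
      (LinearMap.mul' K K ∘ₗ TensorProduct.map χ ψ) ∘ₗ J, ?_, fun t ht => ?_⟩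
    · rw [LinearMap.comp_apply, LinearMap.comp_apply, treeElement, hJ]
      simp [h1, h3, h5]
    · cases t with
      | nil => simp [treeElement, J, h.lam_one]
      | node j l' r' =>
        rw [LinearMap.comp_apply, LinearMap.comp_apply, treeElement, hJ]
        simp only [TensorProduct.map_tmul, LinearMap.comp_apply, LinearMap.mul'_apply]
        by_cases e1 : l' = l
        · by_cases e2 : r' = r
          · rw [h6 j (by rintro rfl; exact ht (by rw [e1, e2])), mul_zero, mul_zero]
          · rw [h4 _ e2, zero_mul, mul_zero]
        · rw [h2 _ e1, zero_mul]

theorem treeElement_mem {d : ℕ → ℕ} {v : (Σ n, Fin (d n)) → A} (hv : ∀ i, v i ∈ homog b sz i.1)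
    (t : BinaryTree (Σ n, Fin (d n))) : treeElement graft v t ∈ homog b sz (treeWeight t) := by
  induction t with
  | nil => exact h.graded.one_mem
  | node i l r hl hr =>
    refine h.graded.mul_mem_homog ?_ hl (h.graft_mem_homog rfl hr (hv i))
    simp only [treeWeight]; omega

/-- Induction on the degree. An element is its counit plus a sum of `x * P m`, and `P m` is a sum of
`graft y (W u)`; as `P` vanishes in degree zero, `m` and `u` have positive degree and `x` and `y`
have degree below `n`. -/
theorem homog_le_span_treeElement {d : ℕ → ℕ} {v : (Σ n, Fin (d n)) → A}
    (hv : ∀ n, totalPrimitives lam rho ⊓ homog b sz n ≤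
      Submodule.span K (Set.range fun m : Fin (d n) => v ⟨n, m⟩)) (n : ℕ) :
    homog b sz n ≤ Submodule.span K (treeElement graft v '' {t | treeWeight t = n}) := by
  obtain ⟨P, hPn, hP, hP', hP1, -, hPr⟩ := h.exists_proj_lam
  obtain ⟨W, hWn, hW, hWr, hWl, -⟩ := h.exists_proj_rho
  have hP0 {a : A} (ha : a ∈ homog b sz 0) : P a = 0 := by
    rw [h.graded.homog_zero ha, Algebra.algebraMap_eq_smul_one, map_smul, hP1, smul_zero]
  induction n using Nat.strong_induction_on with
  | _ n ih =>
    intro a ha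
    rw [hP a]
    refine add_mem ?_ ?_
    · rcases Nat.eq_zero_or_pos n with rfl | hn
      · rw [Algebra.algebraMap_eq_smul_one]
        exact Submodule.smul_mem _ _ (Submodule.subset_span ⟨.nil, rfl, rfl⟩)
      · rw [h.graded.counit_homog hn.ne' ha, map_zero]
        exact zero_mem _
    · refine map_mem_of_tensorHomog (f := LinearMap.mul' K A ∘ₗ P.lTensor A)
        (fun i j x m hij hx hm => ?_) (map_mem_of_homog (fun x hx => hx ▸ h.lam_mem x) ha)
      change x * P m ∈ _
      rcases Nat.eq_zero_or_pos j with rfl | hj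
      · rw [hP0 hm, mul_zero]
        exact zero_mem _
      have hx' := ih i (by omega) hx
      have hq := hPn j m hm
      have hql := hP' m
      generalize P m = q at hq hql
      -- Inserting `P` in front of `W` changes nothing on the left factors of `rho q`, but makes
      -- visible, after expanding `rho q` into arbitrary tensors, that `W` is applied to
      -- coinvariants of `lam` and so gives totally primitive elements.
      rw [hW q hql, ← hPr q hql]
      refine map_mem_of_tensorHomog (f := LinearMap.mulLeft K x ∘ₗ TensorProduct.lift graft ∘ₗ
        W.lTensor A ∘ₗ P.lTensor A ∘ₗ (TensorProduct.comm K A A).toLinearMap)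
        (fun k l u y hkl hu hy => ?_) (map_mem_of_homog (fun x hx => hx ▸ h.rho_mem x) hq)
      change x * graft y (W (P u)) ∈ _
      rcases Nat.eq_zero_or_pos k with rfl | hk
      · rw [hP0 hu, map_zero, map_zero, mul_zero]
        exact zero_mem _
      refine mul_graft_mem_span (by omega) hx' (ih l (by omega) hy)
        (hv k ⟨⟨hWl _ (hP' u), hWr _⟩, hWn k _ (hPn k u hu)⟩)

/-- The labels of degree `n` are a basis of the totally primitive elements of degree `n`. None has
degree zero, where elements are scalars and coinvariants have counit zero. The tree basis being
homogeneous, trees of weight `n` are counted by the dimension in degree `n`. -/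
theorem exists_treeBasis (hfin : ∀ n, {x | sz x = n}.Finite) :
    ∃ (d : ℕ → ℕ) (v : (Σ n, Fin (d n)) → A) (E : Module.Basis (BinaryTree (Σ n, Fin (d n))) K A),
      d 0 = 0 ∧ (∀ t, E t = treeElement graft v t) ∧ (∀ i, v i ∈ totalPrimitives lam rho) ∧
      (∀ n, homog b sz n = homog E treeWeight n) ∧ 
      (∀ n, {t : BinaryTree (Σ n, Fin (d n)) | treeWeight t = n}.Finite) ∧
      ∀ n, Nat.card {t : BinaryTree (Σ n, Fin (d n)) | treeWeight t = n} =
        Nat.card {x | sz x = n} := by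
  have hfd (n : ℕ) : FiniteDimensional K (homog b sz n) :=
    FiniteDimensional.span_of_finite K ((hfin n).image b)
  let V (n : ℕ) : Submodule K A := totalPrimitives lam rho ⊓ homog b sz n
  have hVd (n : ℕ) : FiniteDimensional K (V n) := Submodule.finiteDimensional_inf_right _ _
  let d (n : ℕ) : ℕ := Module.finrank K (V n)
  let v (i : Σ n, Fin (d n)) : A := Module.finBasis K (V i.1) i.2
  have hvV (i) : v i ∈ V i.1 := SetLike.coe_mem _
  have hvs (n : ℕ) : V n ≤ Submodule.span K (Set.range fun m : Fin (d n) => v ⟨n, m⟩) := by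
    intro a ha
    have := Submodule.mem_map_of_mem (f := (V n).subtype)
      ((Module.finBasis K (V n)).mem_span ⟨a, ha⟩)
    rwa [Submodule.map_span, ← Set.range_comp] at this
  have hvi : LinearIndependent K v := by
    refine linearIndependent_iUnion_finite (f := fun n (m : Fin (d n)) => v ⟨n, m⟩)
      (fun n => ?_) (fun n t _ hn => ?_)
    · exact (Module.finBasis K (V n)).linearIndependent.map' _ (V n).ker_subtype
    · have hle (k : ℕ) : Submodule.span K (Set.range fun m : Fin (d k) => v ⟨k, m⟩) ≤
          homog b sz k := Submodule.span_le.2 (by rintro _ ⟨m, rfl⟩; exact (hvV ⟨k, m⟩).2)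
      -- The spaces `V n` for different `n` are independent because they lie in the spans of
      -- disjoint parts of the basis `b`.
      have hdis := b.linearIndependent.disjoint_span_image
        (s := {x | sz x = n}) (t := {x | sz x ∈ t})
        (Set.disjoint_left.2 fun x (h1 : sz x = n) (h2 : sz x ∈ t) => hn (h1 ▸ h2))
      refine hdis.mono (hle n) (iSup₂_le fun k hk => (hle k).trans ?_)
      exact Submodule.span_mono (Set.image_mono fun x (hx : sz x = k) =>
        show sz x ∈ t from hx ▸ hk)
  have hsp := h.homog_le_span_treeElement hvs
  have hli := h.linearIndependent_treeElement hvi fun i => (hvV i).1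
  have htop : ⊤ ≤ Submodule.span K (Set.range (treeElement graft v)) := by
    rw [← b.span_eq, Submodule.span_le]
    rintro _ ⟨x, rfl⟩
    exact Submodule.span_mono (Set.image_subset_range _ _) (hsp _ (basis_mem_homog b sz x))
  let E := Module.Basis.mk hli htop
  have hE : ⇑E = treeElement graft v := Module.Basis.coe_mk hli htop
  have hEh (n : ℕ) : homog b sz n = homog E treeWeight n := by
    refine le_antisymm ?_ (Submodule.span_le.2 ?_)
    · rw [homog, homog, hE]; exact hsp n
    · rintro _ ⟨t, rfl, rfl⟩
      rw [hE]
      exact h.treeElement_mem (fun i => (hvV i).2) t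
  refine ⟨d, v, E, ?_, fun t => congrFun hE t, fun i => (hvV i).1, hEh, fun n => ?_, fun n => ?_⟩
  · refine Submodule.finrank_eq_zero.2 ((Submodule.eq_bot_iff _).2 fun a ha => ?_)
    rw [h.graded.homog_zero ha.2, h.counit_eq_zero_of_lam ha.1.1, map_zero]
  · have := hfd n
    rw [hEh, homog] at this
    have hb := Module.Basis.span (E.linearIndependent.comp
      ((↑) : {t : BinaryTree (Σ n, Fin (d n)) | treeWeight t = n} → _) Subtype.val_injective)
    rw [Set.range_comp, Subtype.range_coe] at hb
    exact Set.finite_coe_iff.1 (Module.Finite.finite_basis hb)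
  · rw [← E.linearIndependent.finrank_span_image, ← b.linearIndependent.finrank_span_image]
    exact congrArg (fun N : Submodule K A => Module.finrank K N) (hEh n).symm

end IsGrafting
end TreeBasis

/-! ## Uniqueness of graded bialgebras with grafting -/

section Counting

/-- A tree of positive weight has a root; `p` divides the weight between the label of the root and
the two subtrees, and `q` divides the second share between the subtrees. -/
theorem card_treeWeight {d : ℕ → ℕ} (T : ℕ → Finset (BinaryTree (Σ n, Fin (d n))))
    (hT : ∀ n t, t ∈ T n ↔ treeWeight t = n) {n : ℕ} (hn : 0 < n) :
    (T n).card = ∑ p ∈ Finset.HasAntidiagonal.antidiagonal n,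
      d p.1 * ∑ q ∈ Finset.HasAntidiagonal.antidiagonal p.2, (T q.1).card * (T q.2).card := by
  classical
  let S := (Finset.HasAntidiagonal.antidiagonal n).sigma fun p => (Finset.univ : Finset (Fin (d p.1))) ×ˢ
    (Finset.HasAntidiagonal.antidiagonal p.2).sigma fun q => T q.1 ×ˢ T q.2
  have hS : S.card = ∑ p ∈ Finset.HasAntidiagonal.antidiagonal n,
      d p.1 * ∑ q ∈ Finset.HasAntidiagonal.antidiagonal p.2, (T q.1).card * (T q.2).card := by
    simp [S, Finset.card_sigma, Finset.card_product]
  rw [← hS, eq_comm]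
  refine Finset.card_bij (fun x _ => .node ⟨x.1.1, x.2.1⟩ x.2.2.2.1 x.2.2.2.2) ?_ ?_ ?_
  · rintro ⟨p, m, q, l, r⟩ hx
    simp only [S, Finset.mem_sigma, Finset.mem_product, Finset.HasAntidiagonal.mem_antidiagonal, hT] at hx
    rw [hT]
    simp only [treeWeight]
    omega
  · rintro ⟨⟨p1, p2⟩, m, ⟨q1, q2⟩, l, r⟩ hx ⟨⟨p1', p2'⟩, m', ⟨q1', q2'⟩, l', r'⟩ hx' h
    simp only [S, Finset.mem_sigma, Finset.mem_product, Finset.HasAntidiagonal.mem_antidiagonal, hT] at hx hx'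
    simp only [BinaryTree.node.injEq, Sigma.mk.injEq] at h
    obtain ⟨⟨rfl, h⟩, rfl, rfl⟩ := h
    obtain rfl := eq_of_heq h
    obtain ⟨h1, -, h2, h3, h4⟩ := hx
    obtain ⟨h1', -, h2', h3', h4'⟩ := hx'
    subst h3 h4 h3' h4'
    obtain rfl : p2 = p2' := by omega
    rfl
  · intro t ht
    rw [hT] at ht
    cases t with
    | nil => simp only [treeWeight] at ht; omega
    | node i l r =>
      refine ⟨⟨(i.1, treeWeight l + treeWeight r), i.2, (treeWeight l, treeWeight r), l, r⟩, ?_, rfl⟩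
      simp only [treeWeight] at ht
      simp only [S, Finset.mem_sigma, Finset.mem_product, Finset.HasAntidiagonal.mem_antidiagonal, hT,
        Finset.mem_univ, and_true]
      omega

/-- In the recursion of `card_treeWeight`, `d n` occurs only in the term where both subtrees have
weight zero. Its coefficient is the square of the number of trees of weight zero, which is positive
because of the empty tree; all other terms involve `d` at smaller arguments only. -/
theorem labels_eq_of_card_treeWeight {d d' : ℕ → ℕ} (h0 : d 0 = 0) (h0' : d' 0 = 0)
    (hf : ∀ n, {t : BinaryTree (Σ n, Fin (d n)) | treeWeight t = n}.Finite)
    (hf' : ∀ n, {t : BinaryTree (Σ n, Fin (d' n)) | treeWeight t = n}.Finite)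
    (h : ∀ n, Nat.card {t : BinaryTree (Σ n, Fin (d n)) | treeWeight t = n} =
      Nat.card {t : BinaryTree (Σ n, Fin (d' n)) | treeWeight t = n}) : d = d' := by
  have e {n : ℕ} (hn : 0 < n) := card_treeWeight (fun n => (hf n).toFinset) (fun n t => by simp) hn
  have e' {n : ℕ} (hn : 0 < n) := card_treeWeight (fun n => (hf' n).toFinset) (fun n t => by simp) hn
  have hc (n : ℕ) : (hf n).toFinset.card = (hf' n).toFinset.card := by
    rw [← Set.ncard_eq_toFinset_card _ (hf n), ← Set.ncard_eq_toFinset_card _ (hf' n)]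
    exact h n
  funext n
  induction n using Nat.strong_induction_on with
  | _ n ih =>
    rcases Nat.eq_zero_or_pos n with rfl | hn
    · rw [h0, h0']
    have e1 := (e hn).symm.trans ((hc n).trans (e' hn))
    simp only [hc] at e1
    have hmem : (n, 0) ∈ Finset.HasAntidiagonal.antidiagonal n := by simp
    rw [← Finset.add_sum_erase _ _ hmem, ← Finset.add_sum_erase _ _ hmem] at e1
    have e2 := Finset.sum_congr (rfl : (Finset.HasAntidiagonal.antidiagonal n).erase (n, 0) = _)
      (f := fun p => d p.1 * ∑ q ∈ Finset.HasAntidiagonal.antidiagonal p.2,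
        (hf' q.1).toFinset.card * (hf' q.2).toFinset.card)
      (g := fun p => d' p.1 * ∑ q ∈ Finset.HasAntidiagonal.antidiagonal p.2,
        (hf' q.1).toFinset.card * (hf' q.2).toFinset.card) fun p hp => by
          obtain ⟨hp1, hp2⟩ := Finset.mem_erase.1 hp
          rw [Finset.HasAntidiagonal.mem_antidiagonal] at hp2
          have : p.1 ≠ n := fun h => hp1 (Prod.ext h (by simp; omega))
          simp only [ih p.1 (by omega)]
    rw [e2] at e1
    have e3 := Nat.add_right_cancel e1
    have : 0 < (hf' 0).toFinset.card := Finset.card_pos.2 ⟨.nil, by simp [treeWeight]⟩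
    refine Nat.eq_of_mul_eq_mul_right ?_ e3
    simpa only [Finset.HasAntidiagonal.antidiagonal_zero, Finset.sum_singleton] using Nat.mul_pos this this

end Counting

section Uniqueness
open Coalgebra
variable {K A A' X X' ι : Type*} [Field K] [Ring A] [Bialgebra K A] [Ring A'] [Bialgebra K A']

/-- The tree obtained by grafting the first tree at the leftmost leaf of the second. -/
def treeAppend {ι : Type*} (s : BinaryTree ι) : BinaryTree ι → BinaryTree ι
  | .nil => s
  | .node i l r => .node i (treeAppend s l) r

/-- The leftmost branch of a tree lists the factors of a product. Hence the multiplication table of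
the tree basis is independent of the algebra. -/
theorem treeElement_append {graft : A →ₗ[K] A →ₗ[K] A} {v : ι → A} (s t : BinaryTree ι) :
    treeElement graft v (treeAppend s t) = treeElement graft v s * treeElement graft v t := by
  induction t with
  | nil => simp [treeAppend, treeElement]
  | node i l r hl _ => rw [treeAppend, treeElement, treeElement, hl, mul_assoc]

/-- For totally primitive `v` the map `y ↦ graft y v` is a one-cocycle, a mirrored version of the
operator `B₊` on rooted forests: `lam` contributes the first term and `rho` the second. This
determines the coproduct on trees recursively. -/
theorem IsGrafting.comul_graft {b : Module.Basis X K A} {sz : X → ℕ} {lam rho : A →ₗ[K] A ⊗[K] A}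
    {graft : A →ₗ[K] A →ₗ[K] A} (h : IsGrafting b sz lam rho graft) {v : A}
    (hv : v ∈ totalPrimitives lam rho) (y : A) :
    comul (R := K) (graft y v) = 1 ⊗ₜ graft y v + (graft.flip v).rTensor A (comul y) := by
  have hl := h.lam_graft_of_lam hv.1 y
  rw [h.comul_eq, h.counit_eq_zero_of_lam hl, zero_smul, add_zero, hl, h.rho_graft,
    (mem_totalPrimitives.1 hv).2]
  congr 1
  have : (TensorProduct.map₂ graft (LinearMap.mul K A)).flip (v ⊗ₜ 1) = (graft.flip v).rTensor A :=
    TensorProduct.ext' fun a b => by simp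
  exact LinearMap.congr_fun this _

/-- The product of trees, their grafting on labels, the counit and the recursion for the coproduct
do not mention the algebra, so identifying the two tree bases respects all operations. -/
theorem IsGrafting.exists_bialgEquiv {b : Module.Basis X K A} {sz : X → ℕ}
    {lam rho : A →ₗ[K] A ⊗[K] A} {graft : A →ₗ[K] A →ₗ[K] A} (h : IsGrafting b sz lam rho graft)
    {b' : Module.Basis X' K A'} {sz' : X' → ℕ} {lam' rho' : A' →ₗ[K] A' ⊗[K] A'}
    {graft' : A' →ₗ[K] A' →ₗ[K] A'} (h' : IsGrafting b' sz' lam' rho' graft')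
    {v : ι → A} {v' : ι → A'} (hv : ∀ i, v i ∈ totalPrimitives lam rho)
    (hv' : ∀ i, v' i ∈ totalPrimitives lam' rho')
    (E : Module.Basis (BinaryTree ι) K A) (E' : Module.Basis (BinaryTree ι) K A')
    (hE : ∀ t, E t = treeElement graft v t) (hE' : ∀ t, E' t = treeElement graft' v' t) :
    ∃ e : A ≃ₐc[K] A', ∀ t, e (E t) = E' t := by
  let e₀ : A ≃ₗ[K] A' := E.equiv E' (Equiv.refl _)
  have he₀ (t) : e₀ (E t) = E' t := by simp [e₀]
  have hmul (x y : A) : e₀ (x * y) = e₀ x * e₀ y := by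
    have : (LinearMap.mul K A).compr₂ e₀.toLinearMap =
        (LinearMap.mul K A').compl₁₂ e₀.toLinearMap e₀.toLinearMap := by
      refine E.ext fun s => E.ext fun t => ?_
      change e₀ (E s * E t) = e₀ (E s) * e₀ (E t)
      rw [he₀, he₀, hE, hE, ← treeElement_append, ← hE, he₀, hE', hE', hE', ← treeElement_append]
    exact LinearMap.congr_fun (LinearMap.congr_fun this x) y
  have hone : e₀ 1 = 1 := by
    have := he₀ .nil
    rwa [hE, hE'] at this
  let e₁ : A ≃ₐ[K] A' := AlgEquiv.ofLinearEquiv e₀ hone hmul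
  have he₁ (t) : e₁ (E t) = E' t := he₀ t
  have hgraft (y : A) (i : ι) : e₀ (graft y (v i)) = graft' (e₀ y) (v' i) := by
    have : e₀.toLinearMap ∘ₗ graft.flip (v i) = graft'.flip (v' i) ∘ₗ e₀.toLinearMap := by
      refine E.ext fun t => ?_
      change e₀ (graft (E t) (v i)) = graft' (e₀ (E t)) (v' i)
      -- With an empty left subtree the element of a node is the grafting alone.
      have := he₀ (.node i .nil t)
      rw [hE, hE', treeElement, treeElement, treeElement, treeElement, one_mul, one_mul, ← hE,
        ← hE'] at this
      rw [this, he₀]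
    exact LinearMap.congr_fun this y
  have hcounit : counit ∘ₗ e₀.toLinearMap = counit (R := K) (A := A) := by
    refine E.ext fun t => ?_
    change counit (e₀ (E t)) = counit (E t)
    rw [he₀, hE, hE']
    cases t with
    | nil => simp [treeElement]
    | node i l r =>
      rw [treeElement, treeElement, Bialgebra.counit_mul, Bialgebra.counit_mul,
        h.counit_eq_zero_of_lam (h.lam_graft_of_lam (hv i).1 _),
        h'.counit_eq_zero_of_lam (h'.lam_graft_of_lam (hv' i).1 _), mul_zero, mul_zero]
  let e₂ : A ⊗[K] A →ₐ[K] A' ⊗[K] A' := Algebra.TensorProduct.map e₁.toAlgHom e₁.toAlgHom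
  have hcomul : e₂.toLinearMap ∘ₗ comul = comul ∘ₗ e₀.toLinearMap := by
    refine E.ext fun t => ?_
    change e₂ (comul (E t)) = comul (e₀ (E t))
    rw [he₀]
    induction t with
    | nil =>
      rw [hE, hE']
      simp [treeElement]
    | node i l r hl hr =>
      rw [hE, hE', treeElement, treeElement, Bialgebra.comul_mul, Bialgebra.comul_mul, map_mul,
        ← hE, ← hE, ← hE', ← hE', hl, h.comul_graft (hv i), h'.comul_graft (hv' i), ← hr, map_add]
      congr 2
      · change (e₀ 1) ⊗ₜ[K] (e₀ (graft (E r) (v i))) = _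
        rw [hone, hgraft, he₀]
      · have : e₂.toLinearMap ∘ₗ (graft.flip (v i)).rTensor A =
            (graft'.flip (v' i)).rTensor A' ∘ₗ e₂.toLinearMap :=
          TensorProduct.ext' fun x y => congrArg (· ⊗ₜ[K] e₀ y) (hgraft x i)
        exact LinearMap.congr_fun this _
  refine ⟨BialgEquiv.ofAlgEquiv e₁ ?_ ?_, he₁⟩
  · exact AlgHom.toLinearMap_injective hcounit
  · exact AlgHom.toLinearMap_injective hcomul

/-- Two bialgebras with grafting are isomorphic if they have the same finite dimensions. -/
theorem IsGrafting.exists_graded_bialgEquiv {b : Module.Basis X K A} {sz : X → ℕ}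
    {lam rho : A →ₗ[K] A ⊗[K] A} {graft : A →ₗ[K] A →ₗ[K] A} (h : IsGrafting b sz lam rho graft)
    {b' : Module.Basis X' K A'} {sz' : X' → ℕ} {lam' rho' : A' →ₗ[K] A' ⊗[K] A'}
    {graft' : A' →ₗ[K] A' →ₗ[K] A'} (h' : IsGrafting b' sz' lam' rho' graft')
    (hfin : ∀ n, {x | sz x = n}.Finite) (hfin' : ∀ n, {x | sz' x = n}.Finite)
    (hcard : ∀ n, Nat.card {x | sz x = n} = Nat.card {x | sz' x = n}) :
    ∃ e : A ≃ₐc[K] A', ∀ (n : ℕ) (x : A), x ∈ homog b sz n ↔ e x ∈ homog b' sz' n := by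
  obtain ⟨d, v, E, h0, hE, hv, hEh, hf, hc⟩ := h.exists_treeBasis hfin
  obtain ⟨d', v', E', h0', hE', hv', hEh', hf', hc'⟩ := h'.exists_treeBasis hfin'
  obtain rfl : d = d' := labels_eq_of_card_treeWeight h0 h0' hf hf' fun n => by
    rw [hc, hc', hcard]
  obtain ⟨e, he⟩ := h.exists_bialgEquiv h' hv hv' E E' hE hE'
  refine ⟨e, fun n x => ?_⟩
  have : homog E' treeWeight n =
      (homog E treeWeight n).map (e : A ≃ₗ[K] A').toLinearMap := by
    rw [homog, homog, Submodule.map_span, ← Set.image_comp]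
    congr 2
    funext t
    exact (he t).symm
  rw [hEh, hEh', this]
  refine ⟨fun hx => ⟨x, hx, rfl⟩, ?_⟩
  rintro ⟨y, hy, hyx⟩
  obtain rfl : y = x := e.injective hyx
  exact hy

end Uniqueness

/-! ## Bialgebras given by cuts -/

universe u v

/-- Combinatorial data for a coproduct by cuts, a product and a grafting operation. A cut `k` of `x`
separates `x` into `roo x k` and `lea x k`; `side x k` says that the distinguished point of `x` lies
in `lea x k`. The products of `x` and `y` are the elements of `prod x y`, and those of `gr y x` are
the results of grafting `y` on the distinguished point of `x`. -/
structure CutData (X κ : Type*) where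
  one : X
  size : X → ℕ
  cuts : X → Finset κ
  roo : X → κ → X
  lea : X → κ → X
  side : X → κ → Prop
  prod : X → X → Finset X
  gr : X → X → Finset X

open Classical in
/-- `A` has a basis indexed by `X` on which the operations are given by the data `C`, which satisfy
the laws of a bialgebra with grafting. -/
structure CutData.IsBasis {X κ : Type*} (C : CutData X κ) {K : Type*} {A : Type u} [Field K] [Ring A]
    [Algebra K A] [CoalgebraStruct K A] (b : Module.Basis X K A) : Prop where
  basis_one : b C.one = 1
  counit_basis : ∀ x, CoalgebraStruct.counit (R := K) (b x) = if x = C.one then 1 else 0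
  comul_basis : ∀ x, CoalgebraStruct.comul (R := K) (b x) =
    ∑ k ∈ C.cuts x, b (C.roo x k) ⊗ₜ[K] b (C.lea x k)
  mul_basis : ∀ x y, b x * b y = ∑ z ∈ C.prod x y, b z
  size_eq_zero : ∀ x, C.size x = 0 ↔ x = C.one
  size_cut : ∀ x, ∀ k ∈ C.cuts x, C.size (C.roo x k) + C.size (C.lea x k) = C.size x
  exists_top : ∀ x, ∃ k ∈ C.cuts x, C.roo x k = C.one ∧ C.lea x k = x ∧
    ∀ l ∈ C.cuts x, C.roo x l = C.one → l = k
  exists_bot : ∀ x, ∃ k ∈ C.cuts x, C.lea x k = C.one ∧ C.roo x k = x ∧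
    ∀ l ∈ C.cuts x, C.lea x l = C.one → l = k
  lea_ne_one : ∀ x, ∀ k ∈ C.cuts x, C.side x k → C.lea x k ≠ C.one
  roo_ne_one : ∀ x ≠ C.one, ∀ k ∈ C.cuts x, ¬ C.side x k → C.roo x k ≠ C.one
  -- Equality for every summand `Φ` expresses that two families agree as multisets without naming a
  -- bijection. The first proposition says that the distinguished point lies in the third of the
  -- three pieces, the second that it does not lie in the first; `side` of a piece is consulted only
  -- together with `side x k`, since a piece without the point of `x` has a point of its own.
  cuts_cuts : ∀ (x : X) {M : Type u} [AddCommMonoid M] (Φ : X → X → X → Prop → Prop → M),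
    ∑ k ∈ C.cuts x, ∑ l ∈ C.cuts (C.roo x k), Φ (C.roo (C.roo x k) l) (C.lea (C.roo x k) l)
      (C.lea x k) (C.side x k) (C.side x k ∨ C.side (C.roo x k) l) =
    ∑ k ∈ C.cuts x, ∑ l ∈ C.cuts (C.lea x k), Φ (C.roo x k) (C.roo (C.lea x k) l)
      (C.lea (C.lea x k) l) (C.side x k ∧ C.side (C.lea x k) l) (C.side x k)
  size_prod : ∀ x y, ∀ z ∈ C.prod x y, C.size z = C.size x + C.size y
  -- The distinguished point of a product is that of its right factor, which must therefore not be
  -- the unit.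
  cuts_prod : ∀ x, ∀ y ≠ C.one, ∀ {M : Type u} [AddCommMonoid M] (Φ : X → X → Prop → M),
    ∑ z ∈ C.prod x y, ∑ k ∈ C.cuts z, Φ (C.roo z k) (C.lea z k) (C.side z k) =
    ∑ k ∈ C.cuts x, ∑ l ∈ C.cuts y, ∑ u ∈ C.prod (C.roo x k) (C.roo y l),
      ∑ w ∈ C.prod (C.lea x k) (C.lea y l), Φ u w (C.side y l)
  size_gr : ∀ y, ∀ x ≠ C.one, ∀ z ∈ C.gr y x, C.size z = C.size y + C.size x
  gr_one : ∀ x ≠ C.one, C.gr C.one x = {x}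
  gr_prod : ∀ y y', ∀ x ≠ C.one, ∀ {M : Type u} [AddCommMonoid M] (Φ : X → M),
    ∑ w ∈ C.prod y y', ∑ z ∈ C.gr w x, Φ z = ∑ w ∈ C.gr y' x, ∑ z ∈ C.gr y w, Φ z
  -- What is grafted sits above the distinguished point. If this point is cut off, all of `y` goes
  -- with it; if not, `y` is cut independently and the part cut off from it is no longer attached to
  -- anything.
  cuts_gr : ∀ y, ∀ x ≠ C.one, ∀ {M : Type u} [AddCommMonoid M] (Φ : X → X → Prop → M),
    ∑ z ∈ C.gr y x, ∑ k ∈ C.cuts z, Φ (C.roo z k) (C.lea z k) (C.side z k) =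
    ∑ k ∈ C.cuts x, if C.side x k then ∑ w ∈ C.gr y (C.lea x k), Φ (C.roo x k) w True else
      ∑ l ∈ C.cuts y, ∑ u ∈ C.gr (C.roo y l) (C.roo x k), ∑ w ∈ C.prod (C.lea y l) (C.lea x k),
        Φ u w False

namespace CutData.IsBasis
variable {X κ : Type*} {C : CutData X κ} {K : Type*} {A : Type u} [Field K] [Ring A] [Algebra K A]

section
variable [CoalgebraStruct K A] {b : Module.Basis X K A} (h : C.IsBasis b)
include h

theorem eq_one_of_cut {k : κ} (hk : k ∈ C.cuts C.one) :
    C.roo C.one k = C.one ∧ C.lea C.one k = C.one := by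
  have h1 := h.size_cut _ k hk
  rw [(h.size_eq_zero _).2 rfl] at h1
  exact ⟨(h.size_eq_zero _).1 (by omega), (h.size_eq_zero _).1 (by omega)⟩

theorem not_side_one {k : κ} (hk : k ∈ C.cuts C.one) : ¬ C.side C.one k := fun hs =>
  h.lea_ne_one _ k hk hs (h.eq_one_of_cut hk).2

theorem sum_cuts_one {M : Type*} [AddCommMonoid M] (f : X → X → M) :
    ∑ k ∈ C.cuts C.one, f (C.roo C.one k) (C.lea C.one k) = f C.one C.one := by
  obtain ⟨k, hk, h1, h2, hu⟩ := h.exists_top C.one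
  rw [Finset.sum_eq_single_of_mem k hk, h1, h2]
  intro l hl hne
  exact absurd (hu l hl (h.eq_one_of_cut hl).1) hne

/-- Only the cut with trivial `roo` contributes. There the distinguished point lies in `lea`, unless
`x` is the unit and has no such point. -/
theorem sum_cuts_roo {M : Type*} [AddCommMonoid M] (x : X) (f : X → X → Prop → M)
    (hf : ∀ u v s, u ≠ C.one → f u v s = 0) :
    ∑ k ∈ C.cuts x, f (C.roo x k) (C.lea x k) (C.side x k) = f C.one x (x ≠ C.one) := by
  obtain ⟨k, hk, h1, h2, hu⟩ := h.exists_top x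
  have hs : C.side x k = (x ≠ C.one) := propext ⟨fun hs => h2 ▸ h.lea_ne_one x k hk hs, fun hx =>
    by_contra fun hs => h.roo_ne_one x hx k hk hs h1⟩
  rw [Finset.sum_eq_single_of_mem k hk, h1, h2, hs]
  exact fun l hl hne => hf _ _ _ fun hr => hne (hu l hl hr)

theorem sum_cuts_lea {M : Type*} [AddCommMonoid M] (x : X) (f : X → X → Prop → M)
    (hf : ∀ u v s, v ≠ C.one → f u v s = 0) :
    ∑ k ∈ C.cuts x, f (C.roo x k) (C.lea x k) (C.side x k) = f x C.one False := by
  obtain ⟨k, hk, h1, h2, hu⟩ := h.exists_bot x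
  have hs : C.side x k = False := propext ⟨fun hs => h.lea_ne_one x k hk hs h1, False.elim⟩
  rw [Finset.sum_eq_single_of_mem k hk, h1, h2, hs]
  exact fun l hl hne => hf _ _ _ fun hr => hne (hu l hl hr)

theorem counit_one : CoalgebraStruct.counit (R := K) (1 : A) = 1 := by
  rw [← h.basis_one, h.counit_basis, if_pos rfl]

theorem comul_one : CoalgebraStruct.comul (R := K) (1 : A) = 1 ⊗ₜ 1 := by
  rw [← h.basis_one, h.comul_basis, h.sum_cuts_one fun u v => b u ⊗ₜ[K] b v]

/-- The coalgebra given by cuts. -/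
@[reducible]
noncomputable def coalgebra : Coalgebra K A where
  coassoc := b.ext fun x => by
    simp only [LinearMap.comp_apply, h.comul_basis, map_sum, LinearMap.rTensor_tmul,
      LinearMap.lTensor_tmul, TensorProduct.sum_tmul, TensorProduct.tmul_sum,
      LinearEquiv.coe_coe, TensorProduct.assoc_tmul]
    exact h.cuts_cuts x fun u v w _ _ => b u ⊗ₜ[K] (b v ⊗ₜ[K] b w)
  rTensor_counit_comp_comul := b.ext fun x => by
    classical
    simp only [LinearMap.comp_apply, h.comul_basis, map_sum, LinearMap.rTensor_tmul, h.counit_basis]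
    rw [h.sum_cuts_roo x fun u v _ => (if u = C.one then (1 : K) else 0) ⊗ₜ[K] b v]
    · rw [if_pos rfl]; rfl
    · intro u v _ hu
      rw [if_neg hu, TensorProduct.zero_tmul]
  lTensor_counit_comp_comul := b.ext fun x => by
    classical
    simp only [LinearMap.comp_apply, h.comul_basis, map_sum, LinearMap.lTensor_tmul, h.counit_basis]
    rw [h.sum_cuts_lea x fun u v _ => b u ⊗ₜ[K] (if v = C.one then (1 : K) else 0)]
    · rw [if_pos rfl]; rfl
    · intro u v _ hu
      rw [if_neg hu, TensorProduct.tmul_zero]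

/-- `cuts_prod` leaves out the unit as right factor. This case is recovered by comparing
coefficients in `b x * 1 = b x`. -/
theorem prod_one {M : Type*} [AddCommMonoid M] (x : X) (f : X → M) :
    ∑ z ∈ C.prod x C.one, f z = f x := by
  classical
  have h1 : ∑ z ∈ C.prod x C.one, b z = b x := by rw [← h.mul_basis, h.basis_one, mul_one]
  have : C.prod x C.one = {x} := by
    ext z
    have := congrArg (fun a => b.repr a z) h1
    simp only [map_sum, Module.Basis.repr_self, Finsupp.coe_finsetSum, Finset.sum_apply,
      Finsupp.single_apply, Finset.sum_ite_eq'] at this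
    rw [Finset.mem_singleton]
    split_ifs at this with h2 h3 h3
    · exact ⟨fun _ => h3.symm, fun _ => h2⟩
    · exact absurd this one_ne_zero
    · exact absurd this zero_ne_one
    · exact ⟨fun h => absurd h h2, fun h => absurd h.symm h3⟩
  rw [this, Finset.sum_singleton]

/-- The bialgebra given by cuts. -/
@[reducible]
noncomputable def bialgebra : Bialgebra K A :=
  letI := h.coalgebra
  Bialgebra.mk' K A h.counit_one
    (by
      have : (LinearMap.mul K A).compr₂ (CoalgebraStruct.counit (R := K)) =
          (LinearMap.mul K K).compl₁₂ (CoalgebraStruct.counit (R := K)) (CoalgebraStruct.counit (R := K)) := by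
        refine b.ext fun x => b.ext fun y => ?_
        simp only [LinearMap.compr₂_apply, LinearMap.compl₁₂_apply, LinearMap.mul_apply',
          h.mul_basis, map_sum, h.counit_basis]
        by_cases hy : y = C.one
        · classical
          rw [hy, h.prod_one x fun z => if z = C.one then (1 : K) else 0]
          simp
        · rw [if_neg hy, mul_zero]
          refine Finset.sum_eq_zero fun z hz => if_neg fun hz1 => hy ?_
          have := h.size_prod x y z hz
          rw [(h.size_eq_zero z).2 hz1] at this
          exact (h.size_eq_zero y).1 (by omega)
      exact fun {x y} => LinearMap.congr_fun (LinearMap.congr_fun this x) y)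
    h.comul_one
    (by
      have : (LinearMap.mul K A).compr₂ (CoalgebraStruct.comul (R := K)) =
          (LinearMap.mul K (A ⊗[K] A)).compl₁₂ (CoalgebraStruct.comul (R := K))
            (CoalgebraStruct.comul (R := K)) := by
        refine b.ext fun x => b.ext fun y => ?_
        simp only [LinearMap.compr₂_apply, LinearMap.compl₁₂_apply, LinearMap.mul_apply']
        by_cases hy : y = C.one
        · rw [hy, h.basis_one, mul_one, h.comul_one, ← Algebra.TensorProduct.one_def, mul_one]
        · simp only [h.mul_basis, map_sum, h.comul_basis, Finset.sum_mul_sum,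
            Algebra.TensorProduct.tmul_mul_tmul, TensorProduct.sum_tmul, TensorProduct.tmul_sum]
          rw [h.cuts_prod x y hy fun u v _ => b u ⊗ₜ[K] b v]
          exact Finset.sum_congr rfl fun k _ => Finset.sum_congr rfl fun l _ => Finset.sum_comm
      exact fun {x y} => LinearMap.congr_fun (LinearMap.congr_fun this x) y)

end

/-! ### The split coproduct and the grafting defined by cuts. -/

section Grafting
open Classical Coalgebra

/-- The part of the coproduct in which the distinguished point is on the right. -/
noncomputable def lam (C : CutData X κ) (b : Module.Basis X K A) : A →ₗ[K] A ⊗[K] A :=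
  b.constr K fun x => ∑ k ∈ C.cuts x, if C.side x k then b (C.roo x k) ⊗ₜ[K] b (C.lea x k) else 0

/-- The part of the coproduct in which the distinguished point is on the left. -/
noncomputable def rho (C : CutData X κ) (b : Module.Basis X K A) : A →ₗ[K] A ⊗[K] A :=
  b.constr K fun x => if x = C.one then 0 else
    ∑ k ∈ C.cuts x, if C.side x k then 0 else b (C.roo x k) ⊗ₜ[K] b (C.lea x k)

/-- The bilinear extension of grafting. -/
noncomputable def graft (C : CutData X κ) (b : Module.Basis X K A) : A →ₗ[K] A →ₗ[K] A :=
  b.constr K fun y => b.constr K fun x => if x = C.one then 0 else ∑ z ∈ C.gr y x, b z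

theorem lam_basis (C : CutData X κ) (b : Module.Basis X K A) (x : X) : lam C b (b x) =
    ∑ k ∈ C.cuts x, if C.side x k then b (C.roo x k) ⊗ₜ[K] b (C.lea x k) else 0 :=
  Module.Basis.constr_basis ..

theorem rho_basis (b : Module.Basis X K A) {x : X} (hx : x ≠ C.one) : rho C b (b x) =
    ∑ k ∈ C.cuts x, if C.side x k then 0 else b (C.roo x k) ⊗ₜ[K] b (C.lea x k) :=
  (Module.Basis.constr_basis ..).trans (if_neg hx)

theorem rho_basis_one (C : CutData X κ) (b : Module.Basis X K A) : rho C b (b C.one) = 0 :=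
  (Module.Basis.constr_basis ..).trans (if_pos rfl)

theorem graft_basis (b : Module.Basis X K A) (y : X) {x : X} (hx : x ≠ C.one) :
    graft C b (b y) (b x) = ∑ z ∈ C.gr y x, b z := by
  rw [graft, Module.Basis.constr_basis, Module.Basis.constr_basis, if_neg hx]

theorem graft_basis_one (C : CutData X κ) (b : Module.Basis X K A) (y : X) :
    graft C b (b y) (b C.one) = 0 := by
  rw [graft, Module.Basis.constr_basis, Module.Basis.constr_basis, if_pos rfl]

theorem map_lam_basis {M : Type*} [AddCommGroup M] [Module K M] (b : Module.Basis X K A)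
    (f : A ⊗[K] A →ₗ[K] M) (x : X) :
    f (lam C b (b x)) =
      ∑ k ∈ C.cuts x, if C.side x k then f (b (C.roo x k) ⊗ₜ[K] b (C.lea x k)) else 0 := by
  rw [lam_basis, map_sum]
  exact Finset.sum_congr rfl fun k _ => by split_ifs <;> simp

theorem map_rho_basis {M : Type*} [AddCommGroup M] [Module K M] (b : Module.Basis X K A)
    (f : A ⊗[K] A →ₗ[K] M) {x : X}
    (hx : x ≠ C.one) : f (rho C b (b x)) =
      ∑ k ∈ C.cuts x, if C.side x k then 0 else f (b (C.roo x k) ⊗ₜ[K] b (C.lea x k)) := by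
  rw [rho_basis b hx, map_sum]
  exact Finset.sum_congr rfl fun k _ => by split_ifs <;> simp

theorem eq_of_basis {M : Type*} [AddCommGroup M] [Module K M] (b : Module.Basis X K A)
    (f g : A →ₗ[K] M) (hfg : ∀ x, f (b x) = g (b x)) (a : A) : f a = g a :=
  LinearMap.congr_fun (b.ext hfg) a

theorem eq_of_basis₂ {M : Type*} [AddCommGroup M] [Module K M] (b : Module.Basis X K A)
    (f g : A →ₗ[K] A →ₗ[K] M) (hfg : ∀ x y, f (b x) (b y) = g (b x) (b y)) (a a' : A) :
    f a a' = g a a' :=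
  LinearMap.congr_fun (LinearMap.congr_fun (b.ext fun x => b.ext (hfg x)) a) a'

variable [CoalgebraStruct K A] {b : Module.Basis X K A} (h : C.IsBasis b)
include h

theorem lam_basis_one : lam C b (b C.one) = 0 := by
  rw [lam_basis]
  exact Finset.sum_eq_zero fun k hk => if_neg (h.not_side_one hk)

theorem gr_ne_one {y x z : X} (hx : x ≠ C.one) (hz : z ∈ C.gr y x) : z ≠ C.one := fun hz1 => by
  have := h.size_gr y x hx z hz
  rw [(h.size_eq_zero z).2 hz1] at this
  exact hx ((h.size_eq_zero x).1 (by omega))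

/-- The bialgebra given by cuts is a bialgebra with grafting. -/
theorem isGrafting : letI := h.bialgebra
    IsGrafting b C.size (lam C b) (rho C b) (graft C b) := by
  let _ := h.bialgebra
  have hcu (x : X) : counit (R := K) (b x) = if x = C.one then 1 else 0 := h.counit_basis x
  have hcm (x : X) : comul (R := K) (b x) = ∑ k ∈ C.cuts x, b (C.roo x k) ⊗ₜ[K] b (C.lea x k) :=
    h.comul_basis x
  have hcm1 : comul (R := K) (b C.one) = b C.one ⊗ₜ b C.one := by
    rw [h.basis_one]; exact h.comul_one
  have hcut (x : X) (k : κ) (hk : k ∈ C.cuts x) :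
      b (C.roo x k) ⊗ₜ[K] b (C.lea x k) ∈ tensorHomog (homog b C.size) (C.size x) :=
    tmul_mem_tensorHomog (basis_mem_homog b C.size _) (basis_mem_homog b C.size _)
      (h.size_cut x k hk)
  refine
    { graded :=
        { exists_unit := ⟨C.one, (h.size_eq_zero _).2 rfl, h.basis_one, fun x => (h.size_eq_zero x).1⟩
          mul_mem := fun x y => ?_
          comul_mem := fun x => ?_
          counit_one := h.counit_one
          counit_eq_zero := fun x hx => ?_ }
      comul_eq := fun a => ?_
      lam_coassoc := fun a => ?_
      lam_rho := fun a => ?_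
      rho_coassoc := fun a => ?_
      counit_lam := fun a => ?_
      lam_counit := fun a => ?_
      rho_counit := fun a => ?_
      lam_mul := fun a a' => ?_
      graft_mul := fun a a' m => ?_
      graft_one := fun m => ?_
      lam_graft := fun a m => ?_
      rho_graft := fun a m => ?_
      lam_mem := fun x => ?_
      rho_mem := fun x => ?_
      graft_mem := fun y x => ?_ }
  · rw [h.mul_basis]
    exact sum_mem fun z hz => h.size_prod x y z hz ▸ basis_mem_homog b C.size z
  · rw [hcm]
    exact sum_mem fun k hk => hcut x k hk
  · rw [hcu, if_neg fun h1 => hx ((h.size_eq_zero x).2 h1)]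
  -- `comul_eq`
  · refine eq_of_basis b comul (lam C b + rho C b + (counit (R := K) (A := A)).smulRight (1 ⊗ₜ 1))
      (fun x => ?_) a
    simp only [LinearMap.add_apply, LinearMap.smulRight_apply, hcu]
    by_cases hx : x = C.one
    · rw [hx, hcm1, h.lam_basis_one, rho_basis_one, if_pos rfl, h.basis_one]
      simp
    · rw [if_neg hx, zero_smul, add_zero, hcm, lam_basis, rho_basis b hx, ← Finset.sum_add_distrib]
      exact Finset.sum_congr rfl fun k _ => by split_ifs <;> simp
  -- `lam_coassoc`
  · refine eq_of_basis b ((TensorProduct.assoc K A A A).toLinearMap ∘ₗ comul.rTensor A ∘ₗ lam C b)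
      ((lam C b).lTensor A ∘ₗ lam C b) (fun x => ?_) a
    simp only [LinearMap.comp_apply, LinearMap.rTensor_tmul, LinearMap.lTensor_tmul,
      hcm, lam_basis, TensorProduct.sum_tmul, TensorProduct.tmul_sum, apply_ite, map_sum,
      LinearEquiv.coe_coe, TensorProduct.assoc_tmul, map_zero, TensorProduct.tmul_zero]
    -- Both sides collect the triples with the distinguished point in the third piece.
    have := h.cuts_cuts x fun u v w s _ => if s then b u ⊗ₜ[K] (b v ⊗ₜ[K] b w) else 0
    refine (Finset.sum_congr rfl fun k _ => ?_).trans
      (this.trans (Finset.sum_congr rfl fun k _ => ?_))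
    · split_ifs <;> simp
    · by_cases hk : C.side x k <;> simp [hk]
  -- `lam_rho`
  · refine eq_of_basis b ((TensorProduct.assoc K A A A).toLinearMap ∘ₗ (lam C b).rTensor A ∘ₗ rho C b)
      ((rho C b).lTensor A ∘ₗ lam C b) (fun x => ?_) a
    by_cases hx : x = C.one
    · simp only [LinearMap.comp_apply, hx, rho_basis_one, h.lam_basis_one, map_zero]
    simp only [LinearMap.comp_apply, map_rho_basis b _ hx, LinearMap.rTensor_tmul,
      LinearMap.lTensor_tmul, lam_basis, TensorProduct.sum_tmul, apply_ite, map_sum,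
      LinearEquiv.coe_coe, map_zero]
    -- Here the distinguished point lies in the middle piece: not in the third, and not in the
    -- first.
    have := h.cuts_cuts x fun u v w s t => if ¬ s ∧ t then b u ⊗ₜ[K] (b v ⊗ₜ[K] b w) else 0
    refine (Finset.sum_congr rfl fun k _ => ?_).trans
      (this.trans (Finset.sum_congr rfl fun k hk => ?_))
    · by_cases hk : C.side x k
      · simp [hk]
      · simp only [hk, if_false, false_or, not_false_eq_true, true_and]
        refine Finset.sum_congr rfl fun l _ => ?_
        split_ifs <;> simp
    · by_cases hs : C.side x k
      · simp only [hs, if_true, true_and, and_true, rho_basis b (h.lea_ne_one x k hk hs),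
          TensorProduct.tmul_sum]
        refine Finset.sum_congr rfl fun l _ => ?_
        split_ifs <;> simp_all
      · simp [hs]
  -- `rho_coassoc`
  · refine eq_of_basis b ((TensorProduct.assoc K A A A).toLinearMap ∘ₗ (rho C b).rTensor A ∘ₗ rho C b)
      (comul.lTensor A ∘ₗ rho C b) (fun x => ?_) a
    by_cases hx : x = C.one
    · simp only [LinearMap.comp_apply, hx, rho_basis_one, map_zero]
    simp only [LinearMap.comp_apply, map_rho_basis b _ hx, LinearMap.rTensor_tmul,
      LinearMap.lTensor_tmul, hcm, TensorProduct.tmul_sum, apply_ite, map_sum,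
      LinearEquiv.coe_coe, map_zero]
    -- Here the distinguished point lies in the first piece.
    have := h.cuts_cuts x fun u v w s t => if ¬ s ∧ ¬ t then b u ⊗ₜ[K] (b v ⊗ₜ[K] b w) else 0
    refine (Finset.sum_congr rfl fun k hk => ?_).trans
      (this.trans (Finset.sum_congr rfl fun k _ => ?_))
    · by_cases hs : C.side x k
      · simp [hs]
      · simp only [hs, if_false, false_or, not_false_eq_true, true_and,
          rho_basis b (h.roo_ne_one x hx k hk hs), TensorProduct.sum_tmul, map_sum]
        refine Finset.sum_congr rfl fun l _ => ?_
        split_ifs <;> simp_all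
    · by_cases hs : C.side x k <;> simp [hs]
  -- `counit_lam`
  · refine eq_of_basis b (counit.rTensor A ∘ₗ lam C b) (TensorProduct.mk K K A 1 ∘ₗ
      (LinearMap.id - (counit (R := K) (A := A)).smulRight 1)) (fun x => ?_) a
    simp only [LinearMap.comp_apply, map_lam_basis, LinearMap.rTensor_tmul, hcu, LinearMap.sub_apply,
      LinearMap.id_apply, LinearMap.smulRight_apply, TensorProduct.mk_apply]
    rw [h.sum_cuts_roo x fun u v s => if s then (if u = C.one then (1 : K) else 0) ⊗ₜ[K] b v else 0]
    · by_cases hx : x = C.one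
      · simp [hx, h.basis_one]
      · simp [hx]
    · intro u v s hu
      simp [hu]
  -- `lam_counit`
  · refine eq_of_basis b (counit.lTensor A ∘ₗ lam C b) 0 (fun x => ?_) a
    simp only [LinearMap.comp_apply, map_lam_basis, LinearMap.lTensor_tmul, hcu,
      LinearMap.zero_apply]
    refine Finset.sum_eq_zero fun k hk => ?_
    split_ifs with h1 h2
    · exact absurd h2 (h.lea_ne_one x k hk h1)
    · simp
    · rfl
  -- `rho_counit`
  · refine eq_of_basis b (counit.lTensor A ∘ₗ rho C b) ((TensorProduct.mk K A K).flip 1 ∘ₗ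
      (LinearMap.id - (counit (R := K) (A := A)).smulRight 1)) (fun x => ?_) a
    simp only [LinearMap.comp_apply, LinearMap.sub_apply, hcu,
      LinearMap.id_apply, LinearMap.smulRight_apply, LinearMap.flip_apply, TensorProduct.mk_apply]
    by_cases hx : x = C.one
    · rw [hx, rho_basis_one, if_pos rfl, h.basis_one]
      simp
    · simp only [map_rho_basis b _ hx, LinearMap.lTensor_tmul, hcu]
      rw [h.sum_cuts_lea x fun u v s => if s then 0 else b u ⊗ₜ[K] (if v = C.one then (1 : K) else 0)]
      · simp [hx]
      · intro u v s hu
        simp [hu]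
  -- `lam_mul`
  · refine eq_of_basis₂ b ((LinearMap.mul K A).compr₂ (lam C b))
      ((LinearMap.mul K (A ⊗[K] A)).compl₁₂ comul (lam C b) +
        (LinearMap.lsmul K (A ⊗[K] A)).flip.compl₁₂ (lam C b) counit) (fun x y => ?_) a a'
    simp only [LinearMap.compr₂_apply, LinearMap.compl₁₂_apply, LinearMap.mul_apply',
      LinearMap.add_apply, LinearMap.flip_apply, LinearMap.lsmul_apply, hcu]
    by_cases hy : y = C.one
    · rw [hy, h.lam_basis_one, mul_zero, if_pos rfl, h.basis_one, mul_one, one_smul, zero_add]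
    · rw [if_neg hy, zero_smul, add_zero, h.mul_basis, map_sum]
      simp only [lam_basis, hcm, Finset.sum_mul_sum, mul_ite, mul_zero,
        Algebra.TensorProduct.tmul_mul_tmul, h.mul_basis, TensorProduct.sum_tmul]
      refine (h.cuts_prod x y hy fun u v s => if s then b u ⊗ₜ[K] b v else 0).trans ?_
      refine Finset.sum_congr rfl fun k _ => Finset.sum_congr rfl fun l _ => ?_
      split_ifs <;> simp [TensorProduct.tmul_sum]
  -- `graft_mul`
  · revert m
    refine fun m => LinearMap.congr_fun (eq_of_basis₂ b ((LinearMap.mul K A).compr₂ (graft C b))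
      ((LinearMap.mul K (Module.End K A)).compl₁₂ (graft C b) (graft C b))
      (fun y y' => b.ext fun x => ?_) a a') m
    simp only [LinearMap.compr₂_apply, LinearMap.compl₁₂_apply, LinearMap.mul_apply']
    rw [Module.End.mul_apply]
    by_cases hx : x = C.one
    · rw [hx, graft_basis_one, map_zero, ← hx, h.mul_basis, map_sum, LinearMap.sum_apply]
      exact Finset.sum_eq_zero fun z _ => by rw [hx, graft_basis_one]
    · rw [graft_basis b y' hx, h.mul_basis, map_sum, map_sum, LinearMap.sum_apply]
      rw [Finset.sum_congr rfl fun z _ => graft_basis b z hx,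
        Finset.sum_congr rfl fun z hz => graft_basis b y (h.gr_ne_one hx hz)]
      exact h.gr_prod y y' x hx _
  -- `graft_one`
  · refine eq_of_basis b (graft C b 1) (LinearMap.id - (counit (R := K) (A := A)).smulRight 1) (fun x => ?_) m
    simp only [LinearMap.sub_apply, LinearMap.id_apply, LinearMap.smulRight_apply, hcu]
    rw [← h.basis_one]
    by_cases hx : x = C.one
    · simp [hx, graft_basis_one]
    · rw [graft_basis b _ hx, h.gr_one x hx]
      simp [hx]
  -- `lam_graft`
  · refine eq_of_basis₂ b ((graft C b).compr₂ (lam C b))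
      (LinearMap.lcomp K _ (lam C b) ∘ₗ LinearMap.lTensorHom A ∘ₗ graft C b)
      (fun y x => ?_) a m
    simp only [LinearMap.compr₂_apply, LinearMap.comp_apply, LinearMap.lcomp_apply]
    change _ = (graft C b (b y)).lTensor A (lam C b (b x))
    by_cases hx : x = C.one
    · rw [hx, graft_basis_one, h.lam_basis_one, map_zero, map_zero]
    · rw [graft_basis b y hx, map_sum, map_lam_basis]
      simp only [lam_basis]
      refine (h.cuts_gr y x hx fun u v s => if s then b u ⊗ₜ[K] b v else 0).trans ?_
      refine Finset.sum_congr rfl fun k hk => ?_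
      by_cases hs : C.side x k
      · simp [hs, graft_basis b y (h.lea_ne_one x k hk hs), TensorProduct.tmul_sum]
      · simp [hs]
  -- `rho_graft`
  · refine eq_of_basis₂ b ((graft C b).compr₂ (rho C b))
      ((TensorProduct.map₂ (graft C b) (LinearMap.mul K A)).compl₁₂ comul (rho C b))
      (fun y x => ?_) a m
    simp only [LinearMap.compr₂_apply, LinearMap.compl₁₂_apply]
    by_cases hx : x = C.one
    · rw [hx, graft_basis_one, rho_basis_one, map_zero, map_zero]
    · rw [graft_basis b y hx, map_sum, map_rho_basis b _ hx]
      rw [Finset.sum_congr rfl fun z hz => rho_basis b (h.gr_ne_one hx hz)]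
      refine (h.cuts_gr y x hx fun u v s => if s then 0 else b u ⊗ₜ[K] b v).trans ?_
      refine Finset.sum_congr rfl fun k hk => ?_
      by_cases hs : C.side x k
      · simp [hs]
      · simp only [hs, if_false, hcm, map_sum, LinearMap.sum_apply, TensorProduct.map₂_apply_tmul,
          TensorProduct.map_tmul,
          graft_basis b _ (h.roo_ne_one x hx k hk hs), LinearMap.mul_apply', h.mul_basis,
          TensorProduct.sum_tmul]
        refine Finset.sum_congr rfl fun l _ => Finset.sum_congr rfl fun u _ => ?_
        rw [TensorProduct.tmul_sum]
  · rw [lam_basis]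
    exact sum_mem fun k hk => by
      split_ifs
      exacts [hcut x k hk, zero_mem _]
  · by_cases hx : x = C.one
    · rw [hx, rho_basis_one]
      exact zero_mem _
    · rw [rho_basis b hx]
      exact sum_mem fun k hk => by
        split_ifs
        exacts [zero_mem _, hcut x k hk]
  · by_cases hx : x = C.one
    · rw [hx, graft_basis_one]
      exact zero_mem _
    · rw [graft_basis b y hx]
      exact sum_mem fun z hz => h.size_gr y x hx z hz ▸ basis_mem_homog b C.size z

theorem isHopfAlgebra : IsHopfAlgebra K A :=
  letI := h.bialgebra
  h.isGrafting.graded.isHopfAlgebra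

theorem exists_graded_bialgEquiv {X' κ' : Type*} {C' : CutData X' κ'} {A' : Type v} [Ring A']
    [Algebra K A'] [CoalgebraStruct K A'] {b' : Module.Basis X' K A'} (h' : C'.IsBasis b')
    (hfin : ∀ n, {x | C.size x = n}.Finite) (hfin' : ∀ n, {x | C'.size x = n}.Finite)
    (hcard : ∀ n, Nat.card {x | C.size x = n} = Nat.card {x | C'.size x = n}) :
    ∃ e : A ≃ₐc[K] A', ∀ n x, x ∈ homog b C.size n ↔ e x ∈ homog b' C'.size n :=
  letI := h.bialgebra
  letI := h'.bialgebra
  h.isGrafting.exists_graded_bialgEquiv h'.isGrafting hfin hfin' hcard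

end Grafting
end CutData.IsBasis

/-! ## Cuts of ordered forests -/

namespace OrderedForest

theorem NatEdge.left_lt {F : OrderedForest} {a b : ℕ} (h : F.NatEdge a b) : a < F.size := h.1

theorem NatEdge.right_lt {F : OrderedForest} {a b : ℕ} (h : F.NatEdge a b) : b < F.size := h.2.1

theorem NatEdge.unique {F : OrderedForest} {a b c : ℕ} (h : F.NatEdge a b) (h' : F.NatEdge a c) :
    b = c := by
  obtain ⟨_, _, h⟩ := h
  obtain ⟨_, _, h'⟩ := h'
  have := h.symm.trans h'
  simpa using this

theorem natEdge_acyclic (F : OrderedForest) (a : ℕ) : ¬ Relation.TransGen F.NatEdge a a := by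
  have key : ∀ b, Relation.TransGen F.NatEdge a b → ∃ (ha : a < F.size) (hb : b < F.size),
      F.Path ⟨a, ha⟩ ⟨b, hb⟩ := by
    intro b h
    induction h with
    | single h => exact ⟨h.1, h.2.1, .single h.2.2⟩
    | tail _ h ih =>
      obtain ⟨ha, hb, hp⟩ := ih
      exact ⟨ha, h.2.1, hp.tail h.2.2⟩
  intro h
  obtain ⟨ha, _, hp⟩ := key a h
  exact F.acyclic _ hp

open Classical in
/-- The ordered forest with `n` vertices and the edges given by the relation `E`. -/
noncomputable def ofEdge (n : ℕ) (E : ℕ → ℕ → Prop) (hE : ∀ a, ¬ Relation.TransGen E a a) :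
    OrderedForest where
  size := n
  parent i := if h : ∃ w : Fin n, E i w then some h.choose else none
  acyclic v h := by
    refine hE v (h.lift Fin.val fun i j hij => ?_)
    split_ifs at hij with hw
    rw [← Option.some.inj hij]
    exact hw.choose_spec

theorem natEdge_ofEdge {n : ℕ} {E : ℕ → ℕ → Prop} {hE : ∀ a, ¬ Relation.TransGen E a a}
    (hf : ∀ a b c, E a b → E a c → b = c) {a b : ℕ} :
    (ofEdge n E hE).NatEdge a b ↔ a < n ∧ b < n ∧ E a b := by
  constructor
  · rintro ⟨ha, hb, h⟩
    refine ⟨ha, hb, ?_⟩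
    simp only [ofEdge] at h
    split_ifs at h with hw
    have := hw.choose_spec
    rwa [Option.some.inj h] at this
  · rintro ⟨ha, hb, h⟩
    refine ⟨ha, hb, ?_⟩
    have hw : ∃ w : Fin n, E a w := ⟨⟨b, hb⟩, h⟩
    refine (dif_pos hw).trans ?_
    exact congrArg some (Fin.ext (hf _ _ _ hw.choose_spec h))

/-- The edges of the disjoint union of `G` and `F`, together with edges from the roots of `G` to the
greatest vertex of `F` if `t` holds. -/
def attachEdge (G F : OrderedForest) (t : Prop) (a b : ℕ) : Prop :=
  G.NatEdge a b ∨ (∃ a' b', a = G.size + a' ∧ b = G.size + b' ∧ F.NatEdge a' b') ∨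
    (t ∧ a < G.size ∧ (∀ c, ¬ G.NatEdge a c) ∧ b + 1 = G.size + F.size ∧ 0 < F.size)

/-- The three kinds of edges start at different vertices: at non-roots of `G`, at vertices of `F`,
and at roots of `G`. -/
theorem attachEdge_unique {G F : OrderedForest} {t : Prop} (a b c : ℕ)
    (h : attachEdge G F t a b) (h' : attachEdge G F t a c) : b = c := by
  rcases h with h | ⟨a', b', ha, hb, h⟩ | ⟨ht, ha, h, hb, h0⟩ <;>
  rcases h' with k | ⟨a'', c', ka, kb, k⟩ | ⟨-, ka, k, kb, -⟩
  · exact h.unique k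
  · have := h.left_lt; omega
  · exact absurd h (k _)
  · have := k.left_lt; omega
  · obtain rfl : a' = a'' := by omega
    have := h.unique k; omega
  · omega
  · exact absurd k (h _)
  · omega
  · omega

/-- Edges between the two parts lead only from `G` to `F`, so a cycle would stay inside one part. -/
theorem attachEdge_acyclic (G F : OrderedForest) (t : Prop) (a : ℕ) :
    ¬ Relation.TransGen (attachEdge G F t) a a := by
  have hl : ∀ b, Relation.TransGen (attachEdge G F t) a b → b < G.size →
      Relation.TransGen G.NatEdge a b := by
    intro b h
    induction h with
    | single h =>
      intro hb
      rcases h with h | ⟨a', b', ha, hb', h⟩ | ⟨ht, ha, h, hb', h0⟩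
      · exact .single h
      · omega
      · omega
    | tail _ h ih =>
      intro hb
      rcases h with h | ⟨a', b', ha, hb', h⟩ | ⟨ht, ha, h, hb', h0⟩
      · exact (ih h.left_lt).tail h
      · omega
      · omega
  have hr : ∀ b, Relation.TransGen (attachEdge G F t) a b → G.size ≤ a →
      ∃ a' b', a = G.size + a' ∧ b = G.size + b' ∧ Relation.TransGen F.NatEdge a' b' := by
    intro b h ha
    induction h with
    | single h =>
      rcases h with h | ⟨a', b', ha, hb', h⟩ | ⟨ht, ha, h, hb', h0⟩
      · have := h.left_lt; omega
      · exact ⟨a', b', ha, hb', .single h⟩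
      · omega
    | tail _ h ih =>
      obtain ⟨a', b', rfl, rfl, hp⟩ := ih
      rcases h with h | ⟨a'', b'', ha, hb', h⟩ | ⟨ht, ha, h, hb', h0⟩
      · have := h.left_lt; omega
      · obtain rfl : b' = a'' := by omega
        exact ⟨a', b'', rfl, hb', hp.tail h⟩
      · omega
  intro h
  rcases lt_or_ge a G.size with ha | ha
  · exact G.natEdge_acyclic a (hl a h ha)
  · obtain ⟨a', b', h1, h2, hp⟩ := hr a h ha
    obtain rfl : a' = b' := by omega
    exact F.natEdge_acyclic a' hp

/-- The disjoint union of `G` and `F`, all vertices of `G` preceding those of `F`, where the roots of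
`G` are attached to the greatest vertex of `F` if `t` holds. -/
noncomputable def attach (G F : OrderedForest) (t : Prop) : OrderedForest :=
  ofEdge (G.size + F.size) (attachEdge G F t) (attachEdge_acyclic G F t)

theorem size_attach (G F : OrderedForest) (t : Prop) : (attach G F t).size = G.size + F.size := rfl

theorem size_mul (G F : OrderedForest) : (G * F).size = G.size + F.size := rfl

theorem natEdge_attach {G F : OrderedForest} {t : Prop} {a b : ℕ} :
    (attach G F t).NatEdge a b ↔ attachEdge G F t a b := by
  refine (natEdge_ofEdge attachEdge_unique).trans ⟨fun h => h.2.2, fun h => ?_⟩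
  have h0 := h
  rcases h with h | ⟨a', b', ha, hb, h⟩ | ⟨ht, ha, h, hb, hF⟩
  · have := h.left_lt; have := h.right_lt
    exact ⟨by omega, by omega, h0⟩
  · have := h.left_lt; have := h.right_lt
    exact ⟨by omega, by omega, h0⟩
  · exact ⟨by omega, by omega, h0⟩

/-- Product and grafting are thus the two instances of `attach`, and their cuts can be treated
together. -/
theorem mul_eq_attach (G F : OrderedForest) : G * F = attach G F False :=
  ext_natEdge rfl fun a b => (natEdge_union G F a b).trans <| by
    rw [natEdge_attach, attachEdge]
    simp

theorem natEdge_mul {G F : OrderedForest} {a b : ℕ} : (G * F).NatEdge a b ↔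
    G.NatEdge a b ∨ ∃ a' b', a = G.size + a' ∧ b = G.size + b' ∧ F.NatEdge a' b' :=
  natEdge_union G F a b

theorem size_eq_zero {F : OrderedForest} : F.size = 0 ↔ F = 1 := by
  refine ⟨fun h => ext_natEdge h fun a b => ⟨fun k => ?_, fun k => ?_⟩, fun h => h ▸ rfl⟩
  · have := k.left_lt; omega
  · exact absurd k.left_lt (Nat.not_lt_zero _)

theorem one_attach (F : OrderedForest) (t : Prop) : attach 1 F t = F := by
  have h0 : (1 : OrderedForest).size = 0 := rfl
  refine ext_natEdge (by rw [size_attach, h0, zero_add]) fun a b => ?_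
  rw [natEdge_attach, attachEdge, h0]
  constructor
  · rintro (h | ⟨a', b', ha, hb, h⟩ | h)
    · exact absurd h.left_lt (Nat.not_lt_zero _)
    · rwa [ha, hb, zero_add, zero_add]
    · omega
  · exact fun h => .inr (.inl ⟨a, b, (zero_add _).symm, (zero_add _).symm, h⟩)

/-- Since `F` is nonempty and comes last, its greatest vertex is also that of `attach G' F True`, so
the roots of `G` and of `G'` are attached to the same vertex on both sides. -/
theorem mul_attach (G G' F : OrderedForest) (hF : F ≠ 1) :
    attach (G * G') F True = attach G (attach G' F True) True := by
  have h0 : 0 < F.size := Nat.pos_of_ne_zero fun h => hF (size_eq_zero.1 h)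
  refine ext_natEdge (by simp only [size_attach, size_mul, add_assoc]) fun a b => ?_
  simp only [natEdge_attach, attachEdge, size_attach, size_mul, natEdge_mul, true_and]
  constructor
  · rintro ((h | ⟨a', b', ha, hb, h⟩) | ⟨a', b', ha, hb, h⟩ | ⟨ha, hr, hb, -⟩)
    · exact .inl h
    · exact .inr (.inl ⟨a', b', ha, hb, .inl h⟩)
    · exact .inr (.inl ⟨G'.size + a', G'.size + b', by omega, by omega,
        .inr (.inl ⟨a', b', rfl, rfl, h⟩)⟩)
    · rcases lt_or_ge a G.size with h1 | h1
      · exact .inr (.inr ⟨h1, fun c hc => hr c (.inl hc), by omega, by omega⟩)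
      · exact .inr (.inl ⟨a - G.size, b - G.size, by omega, by omega, .inr (.inr ⟨by omega,
          fun c hc => hr (G.size + c) (.inr ⟨a - G.size, c, by omega, rfl, hc⟩), by omega, h0⟩)⟩)
  · rintro (h | ⟨a', b', ha, hb, h | ⟨a'', b'', ha', hb', h⟩ | ⟨ha', hr, hb', -⟩⟩ | ⟨ha, hr, hb, -⟩)
    · exact .inl (.inl h)
    · exact .inl (.inr ⟨a', b', ha, hb, h⟩)
    · exact .inr (.inl ⟨a'', b'', by omega, by omega, h⟩)
    · refine .inr (.inr ⟨by omega, ?_, by omega, h0⟩)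
      rintro c (hc | ⟨a'', c', ha'', hc, h⟩)
      · have := hc.left_lt; omega
      · obtain rfl : a' = a'' := by omega
        exact hr _ h
    · refine .inr (.inr ⟨by omega, ?_, by omega, h0⟩)
      rintro c (hc | ⟨a'', c', ha'', hc, h⟩)
      · exact hr _ hc
      · omega

/-! ### Induced subforests -/

open Classical in
/-- The forest induced on the vertices in `P`. -/
noncomputable def sub (F : OrderedForest) (P : Set ℕ) : OrderedForest :=
  F.restrict {v | (v : ℕ) ∈ P}

/-- The map `φ` identifies `G` with the forest induced by `F` on the vertices in `P`. -/
structure IsInduced (G F : OrderedForest) (P : Set ℕ) (φ : ℕ → ℕ) : Prop where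
  lt : ∀ i < G.size, φ i < F.size
  mem : ∀ i < G.size, φ i ∈ P
  mono : ∀ i j, i < j → j < G.size → φ i < φ j
  surj : ∀ a < F.size, a ∈ P → ∃ i < G.size, φ i = a
  edge : ∀ i j, i < G.size → j < G.size → (G.NatEdge i j ↔ F.NatEdge (φ i) (φ j))

theorem exists_isInduced_sub (F : OrderedForest) (P : Set ℕ) : ∃ φ, IsInduced (F.sub P) F P φ := by
  classical
  let s : Finset (Fin F.size) := {v | (v : ℕ) ∈ P}
  let e := s.orderIsoOfFin rfl
  have hs (v : Fin F.size) : v ∈ s ↔ (v : ℕ) ∈ P := by simp [s]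
  let φ (i : ℕ) : ℕ := if h : i < s.card then (e ⟨i, h⟩ : Fin F.size) else 0
  have hφ (i : Fin s.card) : φ i = (e i : Fin F.size) := dif_pos i.2
  refine ⟨φ, ?_, ?_, ?_, ?_, ?_⟩
  · intro i hi
    exact (hφ ⟨i, hi⟩).trans_lt (Fin.is_lt _)
  · intro i hi
    rw [hφ ⟨i, hi⟩, ← hs]
    exact (e ⟨i, hi⟩).2
  · intro i j hij hj
    rw [hφ ⟨i, hij.trans hj⟩, hφ ⟨j, hj⟩]
    exact e.strictMono (show (⟨i, hij.trans hj⟩ : Fin s.card) < ⟨j, hj⟩ from hij)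
  · intro a ha haP
    refine ⟨e.symm ⟨⟨a, ha⟩, (hs _).2 haP⟩, Fin.is_lt _, ?_⟩
    rw [hφ, OrderIso.apply_symm_apply]
  · intro i j hi hj
    rw [hφ ⟨i, hi⟩, hφ ⟨j, hj⟩]
    have hsub (i : Fin s.card) : (F.sub P).parent i = (F.parent (e i)).bind fun w =>
      if h : w ∈ s then some (e.symm ⟨w, h⟩) else none := rfl
    constructor
    · rintro ⟨_, _, h⟩
      refine ⟨Fin.is_lt _, Fin.is_lt _, ?_⟩
      replace h := (hsub ⟨i, hi⟩).symm.trans h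
      obtain ⟨w, hw, h⟩ := Option.bind_eq_some_iff.1 h
      split_ifs at h with hws
      have h2 : e ⟨j, hj⟩ = ⟨w, hws⟩ := by
        rw [← OrderIso.apply_symm_apply e ⟨w, hws⟩]
        exact congrArg e (Option.some.inj h).symm
      exact hw.trans (congrArg (some ·.1) h2).symm
    · rintro ⟨_, _, h⟩
      refine ⟨hi, hj, ?_⟩
      refine (hsub ⟨i, hi⟩).trans (Option.bind_eq_some_iff.2 ?_)
      refine ⟨_, h, ?_⟩
      rw [dif_pos (e ⟨j, hj⟩).2]
      exact congrArg some (e.symm_apply_apply _)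

/-- The increasing enumeration of the vertices of `F` in `P`. -/
noncomputable def emb (F : OrderedForest) (P : Set ℕ) : ℕ → ℕ := (exists_isInduced_sub F P).choose

theorem isInduced_sub (F : OrderedForest) (P : Set ℕ) : IsInduced (F.sub P) F P (F.emb P) :=
  (exists_isInduced_sub F P).choose_spec

theorem IsInduced.mono_iff {G F : OrderedForest} {P : Set ℕ} {φ : ℕ → ℕ} (h : IsInduced G F P φ)
    {i j : ℕ} (hi : i < G.size) (hj : j < G.size) : φ i < φ j ↔ i < j := by
  refine ⟨fun hij => ?_, fun hij => h.mono i j hij hj⟩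
  by_contra hn
  rcases (not_lt.1 hn).lt_or_eq with hlt | rfl
  · exact absurd (h.mono j i hlt hi) (by omega)
  · omega

theorem IsInduced.inj {G F : OrderedForest} {P : Set ℕ} {φ : ℕ → ℕ} (h : IsInduced G F P φ)
    {i j : ℕ} (hi : i < G.size) (hj : j < G.size) (hij : φ i = φ j) : i = j := by
  have h1 := h.mono_iff hi hj
  have h2 := h.mono_iff hj hi
  omega

/-- Both maps are the increasing enumeration of the vertices of `F` in `P`. An induced subforest can
therefore be identified by exhibiting any suitable enumeration. -/
theorem IsInduced.unique {G G' F : OrderedForest} {P : Set ℕ} {φ ψ : ℕ → ℕ}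
    (h : IsInduced G F P φ) (h' : IsInduced G' F P ψ) : G = G' := by
  classical
  let s : Finset ℕ := (Finset.range F.size).filter (· ∈ P)
  have hs {G : OrderedForest} {φ : ℕ → ℕ} (h : IsInduced G F P φ) :
      s = (Finset.range G.size).image φ := by
    ext a
    simp only [s, Finset.mem_filter, Finset.mem_range, Finset.mem_image]
    exact ⟨fun ⟨h1, h2⟩ => h.surj a h1 h2, fun ⟨i, hi, hia⟩ => hia ▸ ⟨h.lt i hi, h.mem i hi⟩⟩
  have hc {G : OrderedForest} {φ : ℕ → ℕ} (h : IsInduced G F P φ) : s.card = G.size := by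
    rw [hs h, Finset.card_image_of_injOn, Finset.card_range]
    intro i hi j hj hij
    exact h.inj (by simpa using hi) (by simpa using hj) hij
  have hu {G : OrderedForest} {φ : ℕ → ℕ} (h : IsInduced G F P φ) (i : ℕ) (hi : i < s.card) :
      φ i = s.orderEmbOfFin rfl ⟨i, hi⟩ := by
    have := Finset.orderEmbOfFin_unique (s := s) rfl (f := fun i : Fin s.card => φ i)
      (fun x => by
        have : (x : ℕ) < G.size := x.2.trans_eq (hc h)
        simp only [s, Finset.mem_filter, Finset.mem_range]
        exact ⟨h.lt _ this, h.mem _ this⟩)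
      (fun x y hxy => h.mono _ _ hxy (y.2.trans_eq (hc h)))
    exact congrFun this ⟨i, hi⟩
  have hGG : G.size = G'.size := (hc h).symm.trans (hc h')
  refine ext_natEdge hGG fun a b => ?_
  by_cases hab : a < G.size ∧ b < G.size
  · rw [h.edge a b hab.1 hab.2, h'.edge a b (hGG ▸ hab.1) (hGG ▸ hab.2),
      hu h a (hc h ▸ hab.1), hu h b (hc h ▸ hab.2), hu h' a (hc h ▸ hab.1), hu h' b (hc h ▸ hab.2)]
  · exact ⟨fun k => absurd ⟨k.left_lt, k.right_lt⟩ hab,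
      fun k => absurd ⟨hGG ▸ k.left_lt, hGG ▸ k.right_lt⟩ hab⟩

theorem IsInduced.eq_sub {G F : OrderedForest} {P : Set ℕ} {φ : ℕ → ℕ} (h : IsInduced G F P φ) :
    G = F.sub P := h.unique (isInduced_sub F P)

theorem IsInduced.comp {H G F : OrderedForest} {P Q : Set ℕ} {φ ψ : ℕ → ℕ}
    (h : IsInduced G F P φ) (h' : IsInduced H G Q ψ) :
    IsInduced H F (φ '' (Q ∩ Set.Iio G.size)) (φ ∘ ψ) where
  lt i hi := h.lt _ (h'.lt i hi)
  mem i hi := ⟨ψ i, ⟨h'.mem i hi, h'.lt i hi⟩, rfl⟩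
  mono i j hij hj := h.mono _ _ (h'.mono i j hij hj) (h'.lt j hj)
  surj := by
    rintro _ - ⟨c, ⟨hc, hcG⟩, rfl⟩
    obtain ⟨i, hi, rfl⟩ := h'.surj c hcG hc
    exact ⟨i, hi, rfl⟩
  edge i j hi hj := (h'.edge i j hi hj).trans (h.edge _ _ (h'.lt i hi) (h'.lt j hj))

theorem isInduced_self (F : OrderedForest) {P : Set ℕ} (hP : ∀ a < F.size, a ∈ P) :
    IsInduced F F P id where
  lt _ hi := hi
  mem i hi := hP i hi
  mono _ _ hij _ := hij
  surj a ha _ := ⟨a, ha, rfl⟩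
  edge _ _ _ _ := Iff.rfl

theorem sub_congr (F : OrderedForest) {P Q : Set ℕ} (h : ∀ a < F.size, a ∈ P ↔ a ∈ Q) :
    F.sub P = F.sub Q := by
  classical
  have : Finset.univ.filter (fun v : Fin F.size => (v : ℕ) ∈ P) =
      Finset.univ.filter (fun v : Fin F.size => (v : ℕ) ∈ Q) :=
    Finset.filter_congr fun v _ => h v v.2
  rw [sub, this, sub]

theorem sub_eq_self (F : OrderedForest) {P : Set ℕ} (hP : ∀ a < F.size, a ∈ P) : F.sub P = F :=
  (isInduced_self F hP).eq_sub.symm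

theorem size_sub (F : OrderedForest) (P : Set ℕ) [DecidablePred (· ∈ P)] :
    (F.sub P).size = ((Finset.range F.size).filter (· ∈ P)).card := by
  have h := isInduced_sub F P
  have : (Finset.range F.size).filter (· ∈ P) = (Finset.range (F.sub P).size).image (F.emb P) := by
    ext a
    simp only [Finset.mem_filter, Finset.mem_range, Finset.mem_image]
    exact ⟨fun ⟨h1, h2⟩ => h.surj a h1 h2, fun ⟨i, hi, hia⟩ => hia ▸ ⟨h.lt i hi, h.mem i hi⟩⟩
  rw [this, Finset.card_image_of_injOn, Finset.card_range]
  intro i hi j hj hij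
  exact h.inj (by simpa using hi) (by simpa using hj) hij

theorem size_sub_add_compl (F : OrderedForest) (P : Set ℕ) :
    (F.sub Pᶜ).size + (F.sub P).size = F.size := by
  classical
  rw [size_sub, size_sub, add_comm]
  simp only [Set.mem_compl_iff]
  rw [Finset.card_filter_add_card_filter_not, Finset.card_range]

theorem sub_eq_one_iff (F : OrderedForest) (P : Set ℕ) :
    F.sub P = 1 ↔ ∀ a < F.size, a ∉ P := by
  classical
  rw [← size_eq_zero, size_sub, Finset.card_eq_zero, Finset.filter_eq_empty_iff]
  simp

/-- The vertices in `P` of a disjoint union with attached roots, for a set `P` such that the roots of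
the part of `G` in `P` are roots of `G` if they have to be attached. -/
theorem attach_sub (G F : OrderedForest) (t : Prop) (P : Set ℕ)
    (hP : t ∧ 0 < F.size ∧ G.size + F.size - 1 ∈ P → ∀ a b, G.NatEdge a b → a ∈ P → b ∈ P) :
    (attach G F t).sub P = attach (G.sub P) (F.sub ((G.size + ·) ⁻¹' P))
      (t ∧ 0 < F.size ∧ G.size + F.size - 1 ∈ P) := by
  have hG := isInduced_sub G P
  have hF := isInduced_sub F ((G.size + ·) ⁻¹' P)
  set G' := G.sub P
  set F' := F.sub ((G.size + ·) ⁻¹' P)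
  set φ := G.emb P
  set ψ := F.emb ((G.size + ·) ⁻¹' P)
  have hl (i : ℕ) (hi : i < G'.size) : (if i < G'.size then φ i else G.size + ψ (i - G'.size)) = φ i :=
    if_pos hi
  have hr (i : ℕ) (hi : ¬ i < G'.size) : (if i < G'.size then φ i else G.size + ψ (i - G'.size)) =
    G.size + ψ (i - G'.size) := if_neg hi
  refine (IsInduced.eq_sub (φ := fun i => if i < G'.size then φ i else G.size + ψ (i - G'.size))
    ⟨?_, ?_, ?_, ?_, ?_⟩).symm
  · intro i hi
    rw [size_attach] at hi ⊢
    split_ifs with h1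
    · have := hG.lt i h1; omega
    · have := hF.lt (i - G'.size) (by omega); omega
  · intro i hi
    rw [size_attach] at hi
    split_ifs with h1
    · exact hG.mem i h1
    · exact hF.mem (i - G'.size) (by omega)
  · intro i j hij hj
    rw [size_attach] at hj
    split_ifs with h1 h2 h2
    · exact hG.mono i j hij h2
    · have := hG.lt i h1; omega
    · omega
    · have := hF.mono (i - G'.size) (j - G'.size) (by omega) (by omega); omega
  · intro a ha haP
    rw [size_attach] at ha ⊢
    rcases lt_or_ge a G.size with h1 | h1
    · obtain ⟨i, hi, rfl⟩ := hG.surj a h1 haP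
      exact ⟨i, by omega, if_pos hi⟩
    · obtain ⟨i, hi, hia⟩ := hF.surj (a - G.size) (by omega)
        (by
          rwa [Set.mem_preimage, Nat.add_sub_cancel' h1])
      refine ⟨G'.size + i, by omega, ?_⟩
      rw [if_neg (by omega), Nat.add_sub_cancel_left, hia]; omega
  · intro i j hi hj
    rw [size_attach] at hi hj
    rw [natEdge_attach, natEdge_attach]
    constructor
    · rintro (h | ⟨a', b', rfl, rfl, h⟩ | ⟨ht, ha, h, hb, h0⟩)
      · rw [hl i h.left_lt, hl j h.right_lt]
        exact .inl ((hG.edge _ _ h.left_lt h.right_lt).1 h)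
      · rw [hr _ (by omega), hr _ (by omega), Nat.add_sub_cancel_left, Nat.add_sub_cancel_left]
        exact .inr (.inl ⟨_, _, rfl, rfl, (hF.edge _ _ h.left_lt h.right_lt).1 h⟩)
      · rw [hl i ha, hr j (by omega)]
        refine .inr (.inr ⟨ht.1, hG.lt i ha, fun c hc => ?_, ?_, ht.2.1⟩)
        -- A parent of `φ i` in `G` would lie in `P` by `hP`, and `i` would not be a root of `G'`.
        · obtain ⟨k, hk, rfl⟩ := hG.surj c hc.right_lt (hP ht _ _ hc (hG.mem i ha))
          exact h k ((hG.edge i k ha hk).2 hc)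
        -- The greatest vertex of `F` was kept, so it is the image of the greatest vertex of `F'`,
        -- where the new edge ends.
        · obtain ⟨k, hk, hkl⟩ := hF.surj (F.size - 1) (by have := ht.2.1; omega) (by
            have := ht.2.2
            rwa [Nat.add_sub_assoc ht.2.1] at this)
          have hj' : j - G'.size < F'.size := by omega
          have h2 := hF.lt (j - G'.size) (by omega)
          have h3 : k = j - G'.size := by
            by_contra hne
            have := hF.mono k (j - G'.size) (by omega) hj'
            omega
          subst h3
          omega
    · rintro (h | ⟨a', b', ha, hb, h⟩ | ⟨ht, ha, h, hb, h0⟩)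
      · have hi' : i < G'.size := by
          by_contra hn
          have := h.left_lt
          rw [hr i hn] at this; omega
        have hj' : j < G'.size := by
          by_contra hn
          have := h.right_lt
          rw [hr j hn] at this; omega
        rw [hl i hi', hl j hj'] at h
        exact .inl ((hG.edge _ _ hi' hj').2 h)
      · have hi' : ¬ i < G'.size := by
          intro hn
          have := hG.lt i hn
          rw [hl i hn] at ha; omega
        have hj' : ¬ j < G'.size := by
          intro hn
          have := hG.lt j hn
          rw [hl j hn] at hb; omega
        rw [hr i hi'] at ha
        rw [hr j hj'] at hb
        obtain rfl := Nat.add_left_cancel ha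
        obtain rfl := Nat.add_left_cancel hb
        exact .inr (.inl ⟨i - G'.size, j - G'.size, by omega, by omega,
          (hF.edge _ _ (by omega) (by omega)).2 h⟩)
      · have hi' : i < G'.size := by
          by_contra hn
          rw [hr i hn] at ha; omega
        have hj' : ¬ j < G'.size := by
          intro hn
          have := hG.lt j hn
          rw [hl j hn] at hb; omega
        rw [hl i hi'] at h
        rw [hr j hj'] at hb
        have hjF : j - G'.size < F'.size := by omega
        have hm := hF.mem _ hjF
        refine .inr (.inr ⟨⟨ht, h0, ?_⟩, hi', fun c hc => ?_, ?_, by omega⟩)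
        · have e : G.size + F.size - 1 = G.size + ψ (j - G'.size) := by omega
          rw [e]; exact hm
        · exact h _ ((hG.edge i c hi' hc.right_lt).1 hc)
        -- A later vertex of `F'` would be mapped beyond the greatest vertex of `F`.
        · by_contra hne
          have := hF.mono (j - G'.size) (j - G'.size + 1) (by omega) (by omega)
          have := hF.lt (j - G'.size + 1) (by omega)
          omega

end OrderedForest

/-! ### Upsets of ordered forests and iterated cuts. -/

namespace OrderedForest

/-- A set of vertices that contains with a vertex all vertices from which a path leads to it. -/
def IsUpset (F : OrderedForest) (I : Set ℕ) : Prop :=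
  I ⊆ Set.Iio F.size ∧ ∀ a b, F.NatEdge a b → b ∈ I → a ∈ I

theorem finite_upsets (F : OrderedForest) : {I | F.IsUpset I}.Finite :=
  (Set.finite_Iio F.size).finite_subsets.subset fun _ h => h.1

/-- The upsets of an ordered forest, which correspond to its admissible cuts. -/
noncomputable def upsets (F : OrderedForest) : Finset (Set ℕ) := F.finite_upsets.toFinset

theorem mem_upsets {F : OrderedForest} {I : Set ℕ} : I ∈ F.upsets ↔ F.IsUpset I := by
  simp [upsets]

/-- The greatest vertex lies in `I`. -/
def Side (F : OrderedForest) (I : Set ℕ) : Prop := 0 < F.size ∧ F.size - 1 ∈ I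

open Classical in
/-- The upsets of the forest induced on `P`, as sets of vertices of `F`. -/
noncomputable def relUpsets (F : OrderedForest) (P : Set ℕ) : Finset (Set ℕ) :=
  (F.sub P).upsets.image (F.emb P '' ·)

/-- Makes iterated cuts into pairs of subsets of one and the same vertex set, without renumbering.
-/
theorem mem_relUpsets {F : OrderedForest} {P T : Set ℕ} : T ∈ F.relUpsets P ↔
    T ⊆ P ∧ T ⊆ Set.Iio F.size ∧ ∀ a b, F.NatEdge a b → a ∈ P → b ∈ T → a ∈ T := by
  have h := F.isInduced_sub P
  simp only [relUpsets, Finset.mem_image, mem_upsets]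
  constructor
  · rintro ⟨J, ⟨hJ, hJ'⟩, rfl⟩
    refine ⟨?_, ?_, ?_⟩
    · rintro _ ⟨j, hj, rfl⟩
      exact h.mem j (hJ hj)
    · rintro _ ⟨j, hj, rfl⟩
      exact h.lt j (hJ hj)
    · rintro a _ hab haP ⟨j, hj, rfl⟩
      obtain ⟨i, hi, rfl⟩ := h.surj a hab.left_lt haP
      exact ⟨i, hJ' i j ((h.edge i j hi (hJ hj)).2 hab) hj, rfl⟩
  · rintro ⟨h1, h2, h3⟩
    refine ⟨F.emb P ⁻¹' T ∩ Set.Iio (F.sub P).size, ⟨Set.inter_subset_right, ?_⟩, ?_⟩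
    · rintro a b hab ⟨hb, -⟩
      exact ⟨h3 _ _ ((h.edge a b hab.left_lt hab.right_lt).1 hab) (h.mem a hab.left_lt) hb,
        hab.left_lt⟩
    · ext a
      constructor
      · rintro ⟨i, ⟨hi, -⟩, rfl⟩
        exact hi
      · intro ha
        obtain ⟨i, hi, rfl⟩ := h.surj a (h2 ha) (h1 ha)
        exact ⟨i, ⟨ha, hi⟩, rfl⟩

theorem sub_sub (F : OrderedForest) (P J : Set ℕ) :
    (F.sub P).sub J = F.sub (F.emb P '' (J ∩ Set.Iio (F.sub P).size)) :=
  ((F.isInduced_sub P).comp ((F.sub P).isInduced_sub J)).eq_sub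

theorem sub_sub_of_subset (F : OrderedForest) {P J : Set ℕ} (hJ : J ⊆ Set.Iio (F.sub P).size) :
    (F.sub P).sub J = F.sub (F.emb P '' J) := by
  rw [sub_sub, Set.inter_eq_left.2 hJ]

theorem sub_sub_compl (F : OrderedForest) {P J : Set ℕ} (hJ : J ⊆ Set.Iio (F.sub P).size) :
    (F.sub P).sub Jᶜ = F.sub (P \ F.emb P '' J) := by
  have h := F.isInduced_sub P
  rw [sub_sub]
  refine F.sub_congr fun a ha => ⟨?_, ?_⟩
  · rintro ⟨i, ⟨hi, hi'⟩, rfl⟩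
    refine ⟨h.mem i hi', ?_⟩
    rintro ⟨j, hj, hji⟩
    exact hi (h.inj (hJ hj) hi' hji ▸ hj)
  · rintro ⟨haP, haJ⟩
    obtain ⟨i, hi, rfl⟩ := h.surj a ha haP
    exact ⟨i, ⟨fun hiJ => haJ ⟨i, hiJ, rfl⟩, hi⟩, rfl⟩

theorem IsInduced.last {G F : OrderedForest} {P : Set ℕ} {φ : ℕ → ℕ} (h : IsInduced G F P φ)
    (h0 : 0 < F.size) (hP : F.size - 1 ∈ P) : 0 < G.size ∧ φ (G.size - 1) = F.size - 1 := by
  obtain ⟨k, hk, hkl⟩ := h.surj _ (Nat.sub_lt h0 one_pos) hP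
  have : k = G.size - 1 := by
    by_contra hne
    have := h.mono k (G.size - 1) (by omega) (by omega)
    have := h.lt (G.size - 1) (by omega)
    omega
  exact ⟨by omega, this ▸ hkl⟩

/-- If the greatest vertex of `F` is kept, it stays the greatest one. Without `hP` the greatest
vertex of the subforest is a different vertex of `F`. -/
theorem side_sub {F : OrderedForest} {P J : Set ℕ} (hP : F.Side P)
    (hJ : J ⊆ Set.Iio (F.sub P).size) : (F.sub P).Side J ↔ F.Side (F.emb P '' J) := by
  have h := F.isInduced_sub P
  obtain ⟨h1, h2⟩ := h.last hP.1 hP.2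
  refine ⟨fun hs => ⟨hP.1, _, hs.2, h2⟩, fun ⟨_, j, hj, hjl⟩ => ⟨h1, ?_⟩⟩
  rwa [h.inj (j := j) (by omega) (hJ hj) (h2.trans hjl.symm)]

theorem sum_relUpsets {M : Type*} [AddCommMonoid M] (F : OrderedForest) (P : Set ℕ)
    (f : Set ℕ → M) :
    ∑ T ∈ F.relUpsets P, f T = ∑ J ∈ (F.sub P).upsets, f (F.emb P '' J) := by
  classical
  rw [relUpsets, Finset.sum_image]
  intro J hJ J' hJ' hJJ
  have h := F.isInduced_sub P
  have key : ∀ {J J' : Set ℕ}, J ⊆ Set.Iio (F.sub P).size → J' ⊆ Set.Iio (F.sub P).size →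
      F.emb P '' J ⊆ F.emb P '' J' → J ⊆ J' := by
    intro J J' hJ hJ' hs j hj
    obtain ⟨i, hi, hij⟩ := hs ⟨j, hj, rfl⟩
    rwa [← h.inj (hJ' hi) (hJ hj) hij]
  have h1 := (mem_upsets.1 hJ).1
  have h2 := (mem_upsets.1 hJ').1
  exact (key h1 h2 hJJ.subset).antisymm (key h2 h1 hJJ.superset)

/-- Both sides run over chains of two upsets `I ⊆ I ∪ T`, with the pieces `(I ∪ T)ᶜ`, `T` and `I`.
On the left the smaller upset is chosen first and `T` is an upset of its complement; on the right
the larger one is chosen first. -/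
theorem sum_upsets_upsets {M : Type*} [AddCommMonoid M] (F : OrderedForest)
    (Φ : OrderedForest → OrderedForest → OrderedForest → Prop → Prop → M) :
    ∑ k ∈ F.upsets, ∑ l ∈ (F.sub kᶜ).upsets, Φ ((F.sub kᶜ).sub lᶜ) ((F.sub kᶜ).sub l)
      (F.sub k) (F.Side k) (F.Side k ∨ (F.sub kᶜ).Side l) =
    ∑ k ∈ F.upsets, ∑ l ∈ (F.sub k).upsets, Φ (F.sub kᶜ) ((F.sub k).sub lᶜ)
      ((F.sub k).sub l) (F.Side k ∧ (F.sub k).Side l) (F.Side k) := by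
  have h1 : ∀ k ∈ F.upsets, ∑ l ∈ (F.sub kᶜ).upsets, Φ ((F.sub kᶜ).sub lᶜ) ((F.sub kᶜ).sub l)
      (F.sub k) (F.Side k) (F.Side k ∨ (F.sub kᶜ).Side l) =
      ∑ T ∈ F.relUpsets kᶜ, Φ (F.sub (kᶜ \ T)) (F.sub T) (F.sub k) (F.Side k)
        (F.Side k ∨ F.Side T) := by
    intro k _
    rw [sum_relUpsets]
    refine Finset.sum_congr rfl fun l hl => ?_
    have hl := (mem_upsets.1 hl).1
    rw [sub_sub_of_subset F hl, sub_sub_compl F hl]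
    by_cases hs : F.Side k
    · simp only [hs, true_or]
    · by_cases h0 : 0 < F.size
      · rw [side_sub (P := kᶜ) ⟨h0, fun h => hs ⟨h0, h⟩⟩ hl]
      · have : ¬ (F.sub kᶜ).Side l := fun h => by
          have := size_sub_add_compl F k
          have := h.1
          omega
        rw [eq_false this, eq_false (show ¬ F.Side (F.emb kᶜ '' l) from fun h => h0 h.1)]
  have h2 : ∀ k ∈ F.upsets, ∑ l ∈ (F.sub k).upsets, Φ (F.sub kᶜ) ((F.sub k).sub lᶜ)
      ((F.sub k).sub l) (F.Side k ∧ (F.sub k).Side l) (F.Side k) =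
      ∑ T ∈ F.relUpsets k, Φ (F.sub kᶜ) (F.sub (k \ T)) (F.sub T) (F.Side k ∧ F.Side T)
        (F.Side k) := by
    intro k _
    rw [sum_relUpsets]
    refine Finset.sum_congr rfl fun l hl => ?_
    have hl := (mem_upsets.1 hl).1
    rw [sub_sub_of_subset F hl, sub_sub_compl F hl]
    by_cases hs : F.Side k
    · rw [side_sub hs hl]
    · simp only [hs, false_and]
  rw [Finset.sum_congr rfl h1, Finset.sum_congr rfl h2, Finset.sum_sigma', Finset.sum_sigma']
  refine Finset.sum_bij' (fun p _ => ⟨p.1 ∪ p.2, p.1⟩) (fun p _ => ⟨p.2, p.1 \ p.2⟩) ?_ ?_ ?_ ?_ ?_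
  · rintro ⟨I, T⟩ h
    simp only [Finset.mem_sigma, mem_upsets, mem_relUpsets] at h ⊢
    obtain ⟨⟨hI, hI'⟩, hT, hT', hT''⟩ := h
    refine ⟨⟨Set.union_subset hI hT', ?_⟩, Set.subset_union_left, hI, fun a b hab _ => hI' a b hab⟩
    rintro a b hab (hb | hb)
    · exact .inl (hI' a b hab hb)
    · by_cases ha : a ∈ I
      · exact .inl ha
      · exact .inr (hT'' a b hab ha hb)
  · rintro ⟨I, T⟩ h
    simp only [Finset.mem_sigma, mem_upsets, mem_relUpsets] at h ⊢
    obtain ⟨⟨hI, hI'⟩, hT, hT', hT''⟩ := h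
    refine ⟨⟨hT', fun a b hab hb => hT'' a b hab (hI' a b hab (hT hb)) hb⟩, fun a ha => ha.2,
      fun a ha => hI ha.1, fun a b hab ha hb => ⟨hI' a b hab hb.1, ha⟩⟩
  · rintro ⟨I, T⟩ h
    simp only [Finset.mem_sigma, mem_upsets, mem_relUpsets] at h
    have : (I ∪ T) \ I = T := Set.union_sdiff_cancel_left fun a ha => h.2.1 ha.2 ha.1
    simp only [this]
  · rintro ⟨I, T⟩ h
    simp only [Finset.mem_sigma, mem_upsets, mem_relUpsets] at h
    simp only [Set.union_sdiff_cancel h.2.1]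
  · rintro ⟨I, T⟩ h
    simp only [Finset.mem_sigma, mem_upsets, mem_relUpsets] at h
    have e1 : (I ∪ T) \ I = T := Set.union_sdiff_cancel_left fun a ha => h.2.1 ha.2 ha.1
    have e2 : Iᶜ \ T = (I ∪ T)ᶜ := by rw [Set.compl_union]; rfl
    have e3 : (F.Side I ∨ F.Side T) = F.Side (I ∪ T) := by
      simp only [Side, Set.mem_union, eq_iff_iff]; tauto
    have e4 : (F.Side (I ∪ T) ∧ F.Side I) = F.Side I := by
      simp only [Side, Set.mem_union, eq_iff_iff]; tauto
    simp only [e1, e2, e3, e4]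

open Classical in
-- An upset that contains the vertex to which the roots of `G` are attached contains all of `G`.
-- Otherwise its traces on `G` and `F` are arbitrary upsets.
theorem sum_upsets_attach {M : Type*} [AddCommMonoid M] (G F : OrderedForest) (t : Prop)
    (f : Set ℕ → M) : ∑ I ∈ (attach G F t).upsets, f I =
      ∑ L ∈ F.upsets, ∑ J ∈ if t ∧ F.Side L then {Set.Iio G.size} else G.upsets,
        f (J ∪ (G.size + ·) '' L) := by
  have hm (L J : Set ℕ) (hL : L ⊆ Set.Iio F.size) :
      (J ∈ if t ∧ F.Side L then {Set.Iio G.size} else G.upsets) ↔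
        G.IsUpset J ∧ (t ∧ F.Side L → J = Set.Iio G.size) := by
    split_ifs with hs
    · rw [Finset.mem_singleton]
      refine ⟨?_, fun h => h.2 hs⟩
      rintro rfl
      exact ⟨⟨le_rfl, fun a b hab _ => hab.left_lt⟩, fun _ => rfl⟩
    · rw [mem_upsets]
      exact ⟨fun h => ⟨h, fun h' => absurd h' hs⟩, fun h => h.1⟩
  rw [Finset.sum_sigma']
  have hbij {L J : Set ℕ} (hJ : J ⊆ Set.Iio G.size) :
      (G.size + ·) ⁻¹' (J ∪ (G.size + ·) '' L) = L ∧
        (J ∪ (G.size + ·) '' L) ∩ Set.Iio G.size = J := by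
    constructor
    · ext a
      simp only [Set.mem_preimage, Set.mem_union, Set.mem_image, add_right_inj, exists_eq_right]
      refine ⟨?_, .inr⟩
      rintro (h | h)
      · have := hJ h
        simp only [Set.mem_Iio] at this; omega
      · exact h
    · ext a
      simp only [Set.mem_inter_iff, Set.mem_union, Set.mem_image, Set.mem_Iio]
      refine ⟨?_, fun h => ⟨.inl h, hJ h⟩⟩
      rintro ⟨h | ⟨b, hb, rfl⟩, h'⟩
      · exact h
      · omega
  have hbij' (I : Set ℕ) : I ∩ Set.Iio G.size ∪ (G.size + ·) '' ((G.size + ·) ⁻¹' I) = I := by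
    ext a
    simp only [Set.mem_inter_iff, Set.mem_union, Set.mem_image, Set.mem_Iio, Set.mem_preimage]
    constructor
    · rintro (h | ⟨b, hb, rfl⟩)
      exacts [h.1, hb]
    · intro h
      rcases lt_or_ge a G.size with h1 | h1
      · exact .inl ⟨h, h1⟩
      · exact .inr ⟨a - G.size, by rwa [Nat.add_sub_cancel' h1], Nat.add_sub_cancel' h1⟩
  refine Finset.sum_bij' (fun I _ => ⟨(G.size + ·) ⁻¹' I, I ∩ Set.Iio G.size⟩)
    (fun p _ => p.2 ∪ (G.size + ·) '' p.1) ?_ ?_ ?_ ?_ ?_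
  · intro I hI
    rw [mem_upsets, IsUpset, size_attach] at hI
    simp only [natEdge_attach] at hI
    obtain ⟨h1, h2⟩ := hI
    have hL : (G.size + ·) ⁻¹' I ⊆ Set.Iio F.size := fun a ha => by
      have := h1 ha
      simp only [Set.mem_Iio] at this ⊢; omega
    rw [Finset.mem_sigma, hm _ _ hL, mem_upsets]
    refine ⟨⟨hL, fun a b hab hb => h2 _ _ (.inr (.inl ⟨a, b, rfl, rfl, hab⟩)) hb⟩,
      ⟨Set.inter_subset_right, fun a b hab hb => ⟨h2 a b (.inl hab) hb.1, hab.left_lt⟩⟩, ?_⟩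
    rintro ⟨ht, h0, hs⟩
    refine Set.inter_eq_right.2 fun a ha => ?_
    -- From the roots upwards: a root of `G` is attached to the greatest vertex of `F`, which lies
    -- in `I`, and any other vertex has its parent in `I` by induction.
    have hwf : ∀ a < G.size, a ∈ I := by
      have hw : WellFounded fun x y : Fin G.size => G.Path y x := by
        have : IsTrans (Fin G.size) fun x y => G.Path y x := ⟨fun a b c h h' => h'.trans h⟩
        have : Std.Irrefl fun x y : Fin G.size => G.Path y x := ⟨fun a h => G.acyclic a h⟩
        exact Finite.wellFounded_of_trans_of_irrefl _
      intro a ha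
      refine hw.induction (C := fun a : Fin G.size => (a : ℕ) ∈ I) ⟨a, ha⟩ fun x ih => ?_
      by_cases hx : ∃ c, G.NatEdge x c
      · obtain ⟨c, hc⟩ := hx
        exact h2 x c (.inl hc) (ih ⟨c, hc.right_lt⟩ (.single hc.2.2))
      · push Not at hx
        refine h2 x (G.size + (F.size - 1)) (.inr (.inr ⟨ht, x.2, hx, by omega, h0⟩)) hs
    exact hwf a ha
  · rintro ⟨L, J⟩ h
    rw [Finset.mem_sigma, mem_upsets] at h
    obtain ⟨⟨hL, hL'⟩, h⟩ := h
    rw [hm _ _ hL] at h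
    obtain ⟨⟨hJ, hJ'⟩, hs⟩ := h
    rw [mem_upsets]
    refine ⟨?_, ?_⟩
    · rintro a (h | ⟨b, hb, rfl⟩)
      · have := hJ h
        simp only [Set.mem_Iio, size_attach] at this ⊢; omega
      · have := hL hb
        simp only [Set.mem_Iio, size_attach] at this ⊢; omega
    · intro a b hab hb
      rw [natEdge_attach] at hab
      rcases hab with h | ⟨a', b', rfl, rfl, h⟩ | ⟨ht, ha, h, hb', h0⟩
      · rcases hb with hb | ⟨c, hc, rfl⟩
        · exact .inl (hJ' a b h hb)
        · have : G.size + c < G.size := h.right_lt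
          omega
      · rcases hb with hb | ⟨c, hc, hcb⟩
        · have := hJ hb
          simp only [Set.mem_Iio] at this; omega
        · obtain rfl : c = b' := by simpa using hcb
          exact .inr ⟨a', hL' a' c h hc, rfl⟩
      · rcases hb with hb | ⟨c, hc, rfl⟩
        · have := hJ hb
          simp only [Set.mem_Iio] at this; omega
        · left
          dsimp only at hb' hs ⊢
          obtain rfl : c = F.size - 1 := by omega
          rw [hs ⟨ht, h0, hc⟩]
          exact ha
  · intro I _
    exact hbij' I
  · rintro ⟨L, J⟩ h
    rw [Finset.mem_sigma, mem_upsets] at h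
    have := (hm _ _ h.1.1).1 h.2
    simp only [(hbij this.1.1).1, (hbij this.1.1).2]
  · intro I _
    simp only [hbij']

end OrderedForest

/-! ### Cuts of products and graftings of forests. -/

namespace OrderedForest

section Attach
variable {G F : OrderedForest} {t : Prop} {L J : Set ℕ}

/-- `attach_sub` applies to both pieces. For the upset its hypothesis holds since `J` is all of `G`
whenever roots have to be attached; for the complement it holds because complements of upsets are
closed under passing to parents. -/
theorem attach_sub_cut (hJ : G.IsUpset J) (hs : t ∧ F.Side L → J = Set.Iio G.size) :
    (attach G F t).sub (J ∪ (G.size + ·) '' L) = attach (G.sub J) (F.sub L) (t ∧ F.Side L) ∧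
    (attach G F t).sub (J ∪ (G.size + ·) '' L)ᶜ = attach (G.sub Jᶜ) (F.sub Lᶜ) (t ∧ F.Side Lᶜ) := by
  have hG (a : ℕ) (ha : a < G.size) : a ∈ J ∪ (G.size + ·) '' L ↔ a ∈ J := by
    refine ⟨?_, .inl⟩
    rintro (h | ⟨b, hb, rfl⟩)
    · exact h
    · exact absurd ha (by simp)
  have hF (a : ℕ) : G.size + a ∈ J ∪ (G.size + ·) '' L ↔ a ∈ L := by
    simp only [Set.mem_union, Set.mem_image, add_right_inj, exists_eq_right]
    refine ⟨?_, .inr⟩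
    rintro (h | h)
    · have := hJ.1 h
      simp only [Set.mem_Iio] at this; omega
    · exact h
  have hl (h0 : 0 < F.size) : G.size + F.size - 1 = G.size + (F.size - 1) := Nat.add_sub_assoc h0 _
  have hF' : (G.size + ·) ⁻¹' (J ∪ (G.size + ·) '' L) = L := Set.ext hF
  constructor
  · rw [attach_sub, hF', G.sub_congr hG]
    · congr 1
      refine propext (and_congr_right fun _ => and_congr_right fun h0 => ?_)
      rw [hl h0, hF]
    · rintro ⟨ht, h0, h⟩ a b hab -
      rw [hl h0, hF] at h
      rw [hG b hab.right_lt, hs ⟨ht, h0, h⟩]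
      exact hab.right_lt
  · rw [attach_sub, Set.preimage_compl, hF', 
      G.sub_congr (P := (J ∪ (G.size + ·) '' L)ᶜ) (Q := Jᶜ) fun a ha => not_congr (hG a ha)]
    · congr 1
      refine propext (and_congr_right fun _ => and_congr_right fun h0 => ?_)
      rw [hl h0, Set.mem_compl_iff, hF]; rfl
    · rintro - a b hab ha
      rw [Set.mem_compl_iff, hG a hab.left_lt] at ha
      rw [Set.mem_compl_iff, hG b hab.right_lt]
      exact fun hb => ha (hJ.2 a b hab hb)

theorem side_attach (hF : F ≠ 1) (hJ : J ⊆ Set.Iio G.size) :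
    (attach G F t).Side (J ∪ (G.size + ·) '' L) = F.Side L := by
  have h0 : 0 < F.size := Nat.pos_of_ne_zero fun h => hF (size_eq_zero.1 h)
  refine propext ⟨?_, fun h => ⟨by rw [size_attach]; omega, .inr ⟨_, h.2, ?_⟩⟩⟩
  · rintro ⟨-, h | ⟨b, hb, hbl⟩⟩
    · have := hJ h
      simp only [Set.mem_Iio, size_attach] at this; omega
    · simp only [size_attach] at hbl
      obtain rfl : b = F.size - 1 := by omega
      exact ⟨h0, hb⟩
  · simp only [size_attach]; omega

theorem sum_upsets_mul {M : Type*} [AddCommMonoid M] (G : OrderedForest) (hF : F ≠ 1)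
    (Φ : OrderedForest → OrderedForest → Prop → M) :
    ∑ k ∈ (G * F).upsets, Φ ((G * F).sub kᶜ) ((G * F).sub k) ((G * F).Side k) =
      ∑ k ∈ G.upsets, ∑ l ∈ F.upsets, Φ (G.sub kᶜ * F.sub lᶜ) (G.sub k * F.sub l) (F.Side l) := by
  rw [mul_eq_attach, sum_upsets_attach _ _ _ fun I => Φ ((attach G F False).sub Iᶜ)
    ((attach G F False).sub I) ((attach G F False).Side I)]
  simp only [false_and, if_false]
  rw [Finset.sum_comm (s := G.upsets)]
  refine Finset.sum_congr rfl fun L _ => Finset.sum_congr rfl fun J hJ => ?_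
  rw [mem_upsets] at hJ
  have h := attach_sub_cut (t := False) (F := F) (L := L) hJ fun h => h.1.elim
  rw [h.1, h.2, side_attach hF hJ.1, mul_eq_attach, mul_eq_attach]
  simp only [false_and]

open Classical in
-- If the greatest vertex of `F` is cut off, `G` goes with it and leaves nothing below the cut. If
-- it is kept, `G` is cut freely: its lower piece stays attached, and its upper piece is
-- disconnected from `F`, whence a product.
theorem sum_upsets_graft {M : Type*} [AddCommMonoid M] (G : OrderedForest) (hF : F ≠ 1)
    (Φ : OrderedForest → OrderedForest → Prop → M) :
    ∑ k ∈ (attach G F True).upsets,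
      Φ ((attach G F True).sub kᶜ) ((attach G F True).sub k) ((attach G F True).Side k) =
    ∑ k ∈ F.upsets, if F.Side k then Φ (F.sub kᶜ) (attach G (F.sub k) True) True else
      ∑ l ∈ G.upsets, Φ (attach (G.sub lᶜ) (F.sub kᶜ) True) (G.sub l * F.sub k) False := by
  rw [sum_upsets_attach _ _ _ fun I => Φ ((attach G F True).sub Iᶜ)
    ((attach G F True).sub I) ((attach G F True).Side I)]
  have h0 : 0 < F.size := Nat.pos_of_ne_zero fun h => hF (size_eq_zero.1 h)
  refine Finset.sum_congr rfl fun L _ => ?_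
  by_cases hL : F.Side L
  · simp only [hL, and_self, if_true, Finset.sum_singleton]
    have hu : G.IsUpset (Set.Iio G.size) := ⟨le_rfl, fun a b hab _ => hab.left_lt⟩
    have h := attach_sub_cut (t := True) (F := F) (L := L) hu fun _ => rfl
    have h1 : G.sub (Set.Iio G.size)ᶜ = 1 := (sub_eq_one_iff _ _).2 fun a ha h => h ha
    rw [h.1, h.2, side_attach hF le_rfl, G.sub_eq_self (P := Set.Iio G.size) fun a ha => ha, h1, one_attach]
    simp only [hL, and_self]
  · simp only [hL, and_false, if_false]
    refine Finset.sum_congr rfl fun J hJ => ?_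
    rw [mem_upsets] at hJ
    have h := attach_sub_cut (t := True) (F := F) (L := L) hJ fun h => absurd h.2 hL
    rw [h.1, h.2, side_attach hF hJ.1, mul_eq_attach]
    have hLc : F.Side Lᶜ := ⟨h0, fun h => hL ⟨h0, h⟩⟩
    simp only [hL, hLc, and_false, and_true]

end Attach

/-! ### Admissible cuts and upsets -/

/-- Parents are followed from `v` as long as they stay in `I`; acyclicity makes this stop. -/
theorem exists_first_mem (F : OrderedForest) {I : Set ℕ} {v : Fin F.size} (hv : (v : ℕ) ∈ I) :
    ∃ u : Fin F.size, (u : ℕ) ∈ I ∧ (∀ w, F.parent u = some w → (w : ℕ) ∉ I) ∧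
      (v = u ∨ F.Path v u) := by
  have hw : WellFounded fun x y : Fin F.size => F.Path y x := by
    have : IsTrans (Fin F.size) fun x y => F.Path y x := ⟨fun a b c h h' => h'.trans h⟩
    have : Std.Irrefl fun x y : Fin F.size => F.Path y x := ⟨fun a h => F.acyclic a h⟩
    exact Finite.wellFounded_of_trans_of_irrefl _
  induction v using hw.induction with
  | _ v ih =>
    by_cases h : ∃ w, F.parent v = some w ∧ (w : ℕ) ∈ I
    · obtain ⟨w, hw, hwI⟩ := h
      obtain ⟨u, hu, hu', h⟩ := ih w (.single hw) hwI
      refine ⟨u, hu, hu', .inr ?_⟩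
      rcases h with rfl | h
      · exact .single hw
      · exact .head hw h
    · push Not at h
      exact ⟨v, hv, h, .inl rfl⟩

theorem mem_leaVertices {F : OrderedForest} {c : Finset (Fin F.size)} {w : Fin F.size} :
    w ∈ F.leaVertices c ↔ w ∈ c ∨ ∃ v ∈ c, F.Path w v := by
  simp [leaVertices]

theorem sub_image (F : OrderedForest) (s : Finset (Fin F.size)) :
    F.sub (Fin.val '' (s : Set (Fin F.size))) = F.restrict s := by
  classical
  rw [sub]
  congr 1
  ext v
  simp [Fin.val_inj]

theorem sub_image_compl (F : OrderedForest) (s : Finset (Fin F.size)) :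
    F.sub (Fin.val '' (s : Set (Fin F.size)))ᶜ = F.restrict sᶜ := by
  classical
  rw [sub]
  congr 1
  ext v
  simp [Fin.val_inj]

open Classical in
-- An admissible cut is recovered from the upset it generates as the set of the lowest vertices,
-- those whose parent is not in the upset; conversely the lowest vertices of any upset form an
-- admissible cut that generates it.
theorem sum_admissibleCuts {M : Type*} [AddCommMonoid M] (F : OrderedForest)
    (f : OrderedForest → OrderedForest → M) :
    ∑ c ∈ F.admissibleCuts, f (F.roo c) (F.lea c) = ∑ I ∈ F.upsets, f (F.sub Iᶜ) (F.sub I) := by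
  refine Finset.sum_bij' (fun c _ => Fin.val '' (F.leaVertices c : Set (Fin F.size)))
    (fun I _ => Finset.univ.filter fun v : Fin F.size =>
      (v : ℕ) ∈ I ∧ ∀ w, F.parent v = some w → (w : ℕ) ∉ I) ?_ ?_ ?_ ?_ ?_
  · intro c _
    rw [mem_upsets]
    refine ⟨?_, ?_⟩
    · rintro _ ⟨v, -, rfl⟩
      exact v.2
    · rintro a _ hab ⟨v, hv, rfl⟩
      refine ⟨⟨a, hab.left_lt⟩, ?_, rfl⟩
      have hav : F.Edge ⟨a, hab.left_lt⟩ v := hab.2.2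
      rw [Finset.mem_coe, mem_leaVertices] at hv ⊢
      rcases hv with hv | ⟨u, hu, hp⟩
      · exact .inr ⟨v, hv, .single hav⟩
      · exact .inr ⟨u, hu, .head hav hp⟩
  · intro I hI
    rw [mem_upsets] at hI
    simp only [admissibleCuts, Finset.mem_filter, Finset.mem_univ, true_and]
    intro v hv w hw _ hp
    simp only [Finset.mem_filter, Finset.mem_univ, true_and] at hv hw
    -- On a path from `v` to `w ∈ I`, already the parent `u` of `v` leads to `w`, hence lies in the
    -- upset `I`, so `v` would not be lowest.
    obtain ⟨u, hvu, huw⟩ := Relation.TransGen.head'_iff.1 hp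
    refine hv.2 u hvu ?_
    have : ∀ u : Fin F.size, Relation.ReflTransGen F.Edge u w → (u : ℕ) ∈ I := by
      intro u h
      induction h using Relation.ReflTransGen.head_induction_on with
      | refl => exact hw.1
      | head hab _ ih => exact hI.2 _ _ ⟨Fin.is_lt _, Fin.is_lt _, hab⟩ ih
    exact this u huw
  · intro c hc
    simp only [admissibleCuts, Finset.mem_filter, Finset.mem_univ, true_and] at hc
    ext v
    simp only [Finset.mem_filter, Finset.mem_univ, true_and, Set.mem_image, Finset.mem_coe,
      Fin.val_inj, exists_eq_right, mem_leaVertices]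
    constructor
    · rintro ⟨hv | ⟨u, hu, hp⟩, h⟩
      · exact hv
      · obtain ⟨w, hvw, hwu⟩ := Relation.TransGen.head'_iff.1 hp
        refine absurd ?_ (h w hvw)
        rcases Relation.reflTransGen_iff_eq_or_transGen.1 hwu with rfl | hwu
        · exact .inl hu
        · exact .inr ⟨u, hu, hwu⟩
    · intro hv
      refine ⟨.inl hv, ?_⟩
      rintro w hvw (hw | ⟨u, hu, hp⟩)
      · refine hc v hv w hw ?_ (.single hvw)
        rintro rfl
        exact F.acyclic v (.single hvw)
      · have hvu : F.Path v u := .head hvw hp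
        refine hc v hv u hu ?_ hvu
        rintro rfl
        exact F.acyclic v hvu
  · intro I hI
    rw [mem_upsets] at hI
    ext a
    simp only [Set.mem_image, Finset.mem_coe, mem_leaVertices, Finset.mem_filter, Finset.mem_univ,
      true_and]
    constructor
    · rintro ⟨v, hv | ⟨w, hw, hp⟩, rfl⟩
      · exact hv.1
      · have : ∀ u : Fin F.size, Relation.TransGen F.Edge u w → (u : ℕ) ∈ I := by
          intro u h
          induction h using Relation.TransGen.head_induction_on with
          | single hab => exact hI.2 _ _ ⟨Fin.is_lt _, Fin.is_lt _, hab⟩ hw.1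
          | head hab _ ih => exact hI.2 _ _ ⟨Fin.is_lt _, Fin.is_lt _, hab⟩ ih
        exact this v hp
    · intro ha
      obtain ⟨u, hu, hu', h⟩ := F.exists_first_mem (v := ⟨a, hI.1 ha⟩) ha
      refine ⟨⟨a, hI.1 ha⟩, ?_, rfl⟩
      rcases h with rfl | h
      · exact .inl ⟨hu, hu'⟩
      · exact .inr ⟨u, ⟨hu, hu'⟩, h⟩
  · intro c _
    rw [sub_image, sub_image_compl]; rfl

end OrderedForest

/-! ### The bialgebra of ordered forests -/

namespace Ho
open OrderedForest

/-- The cuts, the product and the grafting of ordered forests. -/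
noncomputable def cutData : CutData OrderedForest (Set ℕ) where
  one := 1
  size := size
  cuts := upsets
  roo F I := F.sub Iᶜ
  lea F I := F.sub I
  side := Side
  prod G F := {G * F}
  gr G F := {attach G F True}

/-- The basis of the ordered forests. -/
noncomputable def basis (K : Type*) [Field K] : Module.Basis OrderedForest K (Ho K) :=
  .ofRepr (MonoidAlgebra.coeffLinearEquiv K :
    MonoidAlgebra K OrderedForest ≃ₗ[K] OrderedForest →₀ K)

theorem basis_apply (K : Type*) [Field K] (F : OrderedForest) : basis K F = S K F := rfl

theorem isBasis (K : Type*) [Field K] : cutData.IsBasis (basis K) where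
  basis_one := rfl
  counit_basis F := extend_S K _ F
  comul_basis F := by
    simp only [basis_apply]
    exact (extend_S K _ F).trans (F.sum_admissibleCuts fun G H => S K G ⊗ₜ[K] S K H)
  mul_basis F G := by
    simp only [basis_apply, S_mul]
    exact (Finset.sum_singleton _ _).symm
  size_eq_zero F := OrderedForest.size_eq_zero
  size_cut F I _ := F.size_sub_add_compl I
  exists_top F := by
    refine ⟨Set.Iio F.size, mem_upsets.2 ⟨le_rfl, fun a b hab _ => hab.left_lt⟩,
      (sub_eq_one_iff _ _).2 fun a ha h => h ha, F.sub_eq_self fun a ha => ha, fun I hI h => ?_⟩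
    refine (mem_upsets.1 hI).1.antisymm fun a ha => ?_
    exact not_not.1 ((sub_eq_one_iff _ _).1 h a ha)
  exists_bot F := by
    refine ⟨∅, mem_upsets.2 ⟨Set.empty_subset _, fun a b _ h => h⟩,
      (sub_eq_one_iff _ _).2 fun a ha h => h, F.sub_eq_self fun a ha h => h, fun I hI h => ?_⟩
    refine Set.eq_empty_of_forall_notMem fun a ha => ?_
    exact (sub_eq_one_iff _ _).1 h a ((mem_upsets.1 hI).1 ha) ha
  lea_ne_one F I _ hs h := (sub_eq_one_iff _ _).1 h _ (Nat.sub_lt hs.1 one_pos) hs.2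
  roo_ne_one F hF I _ hs h := by
    have h0 : 0 < F.size := Nat.pos_of_ne_zero fun h => hF (OrderedForest.size_eq_zero.1 h)
    exact (sub_eq_one_iff _ _).1 h _ (Nat.sub_lt h0 one_pos) fun h => hs ⟨h0, h⟩
  cuts_cuts F _ _ Φ := F.sum_upsets_upsets Φ
  size_prod F G H hH := by
    obtain rfl := Finset.mem_singleton.1 hH
    rfl
  cuts_prod G F hF _ _ Φ := by
    simp only [cutData, Finset.sum_singleton]
    exact sum_upsets_mul G hF Φ
  size_gr G F _ H hH := by
    obtain rfl := Finset.mem_singleton.1 hH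
    rfl
  gr_one F _ := congrArg (fun H => ({H} : Finset OrderedForest)) (one_attach F True)
  gr_prod G G' F hF _ _ Φ := by
    simp only [cutData, Finset.sum_singleton]
    rw [mul_attach _ _ _ hF]
  cuts_gr G F hF _ _ Φ := by
    simp only [cutData, Finset.sum_singleton]
    exact sum_upsets_graft G hF Φ

end Ho

/-! ## Splitting words by the size of their letters -/

/-- The subword of the letters `≤ k`. -/
def lowWord (w : List ℕ) (k : ℕ) : List ℕ := w.filter (· ≤ k)

/-- The subword of the letters `> k`, decreased by `k`. -/
def highWord (w : List ℕ) (k : ℕ) : List ℕ := (w.filter (k < ·)).map (· - k)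

theorem length_lowWord (w : List ℕ) (k : ℕ) : (lowWord w k).length = w.countP (· ≤ k) :=
  List.countP_eq_length_filter.symm

theorem countP_lowWord (w : List ℕ) {k s : ℕ} (h : s ≤ k) :
    (lowWord w k).countP (· ≤ s) = w.countP (· ≤ s) := by
  rw [lowWord, List.countP_filter]
  exact List.countP_congr fun x _ => by grind

theorem length_highWord (w : List ℕ) (k : ℕ) :
    w.countP (· ≤ k) + (highWord w k).length = w.length := by
  induction w with
  | nil => rfl
  | cons x w ih => simp only [highWord, List.length_map] at ih ⊢; grind

theorem countP_highWord (w : List ℕ) (k s : ℕ) :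
    w.countP (· ≤ k) + (highWord w k).countP (· ≤ s) = w.countP (· ≤ k + s) := by
  induction w with
  | nil => rfl
  | cons x w ih => simp only [highWord, List.countP_map] at ih ⊢; grind

theorem lowWord_lowWord (w : List ℕ) {k l : ℕ} (h : l ≤ k) : lowWord (lowWord w k) l = lowWord w l := by
  rw [lowWord, lowWord, List.filter_filter]
  exact List.filter_congr fun x _ => by grind

theorem highWord_lowWord (w : List ℕ) (l m : ℕ) :
    highWord (lowWord w (l + m)) l = lowWord (highWord w l) m := by
  simp only [lowWord, highWord, List.filter_map, List.filter_filter]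
  congr 1
  exact List.filter_congr fun x _ => by grind

theorem highWord_highWord (w : List ℕ) (l m : ℕ) :
    highWord (highWord w l) m = highWord w (l + m) := by
  simp only [highWord, List.filter_map, List.filter_filter, List.map_map]
  refine Eq.trans (List.map_congr_left fun x _ => ?_) (congrArg _ (List.filter_congr fun x _ => ?_))
  · simp only [Function.comp]; omega
  · grind

theorem lowWord_append (u v : List ℕ) (k : ℕ) : lowWord (u ++ v) k = lowWord u k ++ lowWord v k :=
  List.filter_append ..

theorem highWord_append (u v : List ℕ) (k : ℕ) :
    highWord (u ++ v) k = highWord u k ++ highWord v k := by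
  rw [highWord, List.filter_append, List.map_append]; rfl

theorem mem_lowWord {w : List ℕ} {k x : ℕ} : x ∈ lowWord w k ↔ x ∈ w ∧ x ≤ k := by
  simp [lowWord]

theorem mem_highWord {w : List ℕ} {k x : ℕ} : x ∈ highWord w k ↔ 0 < x ∧ x + k ∈ w := by
  simp only [highWord, List.mem_map, List.mem_filter, decide_eq_true_eq]
  constructor
  · rintro ⟨y, ⟨hy, hk⟩, rfl⟩
    exact ⟨by omega, by rwa [Nat.sub_add_cancel hk.le]⟩
  · rintro ⟨h0, h⟩
    exact ⟨x + k, ⟨h, by omega⟩, by omega⟩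

theorem getLastD_lowWord {w : List ℕ} {k : ℕ} (h : w.getLastD 0 ≤ k) :
    (lowWord w k).getLastD 0 = w.getLastD 0 := by
  rcases List.eq_nil_or_concat w with rfl | ⟨w, x, rfl⟩
  · rfl
  · rw [List.concat_eq_append, lowWord_append] at *
    simp only [List.getLastD_concat] at h ⊢
    simp [lowWord, h]

theorem getLastD_highWord (w : List ℕ) {k : ℕ} (h : k < w.getLastD 0) :
    (highWord w k).getLastD 0 = w.getLastD 0 - k := by
  rcases List.eq_nil_or_concat w with rfl | ⟨w, x, rfl⟩
  · exact absurd h (Nat.not_lt_zero _)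
  · rw [List.concat_eq_append, highWord_append] at *
    simp only [List.getLastD_concat] at h ⊢
    simp [highWord, h]

theorem getLastD_append {u v : List ℕ} (hv : v ≠ []) : (u ++ v).getLastD 0 = v.getLastD 0 := by
  rcases List.eq_nil_or_concat v with rfl | ⟨v, x, rfl⟩
  · exact absurd rfl hv
  · rw [List.concat_eq_append, ← List.append_assoc, List.getLastD_concat, List.getLastD_concat]

theorem getLastD_mem {w : List ℕ} (hw : w ≠ []) : w.getLastD 0 ∈ w := by
  rcases List.eq_nil_or_concat w with rfl | ⟨v, x, rfl⟩
  · exact absurd rfl hw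
  · simp

theorem getLastD_map {w : List ℕ} {f : ℕ → ℕ} (h : f 0 = 0) :
    (w.map f).getLastD 0 = f (w.getLastD 0) := by
  rcases List.eq_nil_or_concat w with rfl | ⟨v, x, rfl⟩
  · exact h.symm
  · simp

/-- A word is determined by the positions and the subword of its letters `≤ k` and the subword of the
others. -/
theorem eq_of_lowWord_of_highWord {u v : List ℕ} {k : ℕ}
    (hp : u.map (fun x => decide (x ≤ k)) = v.map fun x => decide (x ≤ k))
    (hl : lowWord u k = lowWord v k) (hh : highWord u k = highWord v k) : u = v := by
  induction u generalizing v with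
  | nil => simpa using hp.symm
  | cons x u ih =>
    cases v with
    | nil => simp at hp
    | cons y v =>
      simp only [List.map_cons, List.cons.injEq, decide_eq_decide] at hp
      by_cases hx : x ≤ k
      · have hy := hp.1.1 hx
        have hx' : ¬ k < x := by omega
        have hy' : ¬ k < y := by omega
        simp only [lowWord, highWord, List.filter_cons, hx, hy, hx', hy', decide_true, decide_false,
          if_true, List.cons.injEq] at hl hh
        exact List.cons_eq_cons.2 ⟨hl.1, ih hp.2 hl.2 hh⟩
      · have hy : ¬ y ≤ k := fun h => hx (hp.1.2 h)
        have hx' : k < x := by omega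
        have hy' : k < y := by omega
        simp only [lowWord, highWord, List.filter_cons, hx, hy, hx', hy', decide_true, decide_false,
          if_true, List.map_cons, List.cons.injEq, Bool.false_eq_true, if_false] at hl hh
        exact List.cons_eq_cons.2 ⟨by omega, ih hp.2 hl hh.2⟩

/-- The words `u` and `w` can be merged, with the positions given by the letters of `a`. -/
theorem exists_merge {a u w : List ℕ} {i k : ℕ} (hu : u.length = a.countP (· ≤ i))
    (hw : a.countP (· ≤ i) + w.length = a.length) (huk : ∀ x ∈ u, x ≤ k) (hw0 : ∀ x ∈ w, 1 ≤ x) :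
    ∃ c : List ℕ, c.map (fun x => decide (x ≤ k)) = a.map (fun x => decide (x ≤ i)) ∧
      lowWord c k = u ∧ highWord c k = w := by
  induction a generalizing u w with
  | nil =>
    have h1 : u = [] := List.length_eq_zero_iff.1 hu
    have h2 : w = [] := List.length_eq_zero_iff.1 (by simpa using hw)
    exact ⟨[], rfl, h1.symm, h2.symm⟩
  | cons x a ih =>
    by_cases hx : x ≤ i
    · simp only [List.countP_cons, hx, decide_true, if_true, List.length_cons] at hu hw
      cases u with
      | nil => simp at hu
      | cons y u =>
        simp only [List.length_cons] at hu
        obtain ⟨c, h1, h2, h3⟩ := ih (u := u) (w := w) (by omega) (by omega)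
          (fun z hz => huk z (List.mem_cons_of_mem _ hz)) hw0
        have hy := huk y List.mem_cons_self
        refine ⟨y :: c, by simp [h1, hx, hy], ?_, ?_⟩
        · rw [← h2]; simp [lowWord, hy]
        · rw [← h3]; simp [highWord, Nat.not_lt.2 hy]
    · simp only [List.countP_cons, hx, decide_false, List.length_cons] at hu hw
      cases w with
      | nil =>
        have := List.countP_le_length (p := fun x => decide (x ≤ i)) (l := a)
        simp at hw; omega
      | cons y w =>
        simp only [List.length_cons] at hw
        obtain ⟨c, h1, h2, h3⟩ := ih (u := u) (w := w) (by simpa using hu) (by simp at hw; omega) huk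
          (fun z hz => hw0 z (List.mem_cons_of_mem _ hz))
        have hy := hw0 y List.mem_cons_self
        have h4 : ¬ (y + k ≤ k) := by omega
        have h5 : k < y + k := by omega
        refine ⟨(y + k) :: c, ?_, ?_, ?_⟩
        · simp only [List.map_cons, h1, hx, h4]
        · rw [← h2]; simp only [lowWord, List.filter_cons, h4, decide_false]; rfl
        · rw [← h3]
          simp only [highWord, List.filter_cons, h5, decide_true, if_true, List.map_cons,
            Nat.add_sub_cancel]

/-! ### Splitting and parkization -/

/-- At most `k - s` letters of `w` lie in `(s, k]`, for all `s ≤ k`. -/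
def IsSparse (w : List ℕ) (k : ℕ) : Prop :=
  ∀ s ≤ k, w.countP (· ≤ k) ≤ w.countP (· ≤ s) + (k - s)

/-- The equality `hk` is not inherited by the factors of a word, but sparseness is, and it suffices
to make parkization compatible with splitting at `k`. -/
theorem IsParking.isSparse {w : List ℕ} (h : IsParking w) {k : ℕ} (hk : w.countP (· ≤ k) = k) :
    IsSparse w k := fun s hs => by
  have : k ≤ w.length := hk ▸ List.countP_le_length
  have := h.2 s (by omega)
  omega

theorem IsSparse.of_append_left {u v : List ℕ} {k : ℕ} (h : IsSparse (u ++ v) k) : IsSparse u k :=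
  fun s hs => by
    have h1 := h s hs
    have h2 := countP_le_mono v hs
    simp only [List.countP_append] at h1
    omega

theorem IsSparse.of_append_right {u v : List ℕ} {k : ℕ} (h : IsSparse (u ++ v) k) : IsSparse v k :=
  fun s hs => by
    have h1 := h s hs
    have h2 := countP_le_mono u hs
    simp only [List.countP_append] at h1
    omega

/-- An occurring letter leaves no gap to be closed right after it. Hence parkization preserves
strict comparisons with letters of the word, in particular with the last one. -/
theorem parkLetter_lt {w : List ℕ} {u v : ℕ} (hu : u ∈ w) (huv : u < v) :
    parkLetter w u < parkLetter w v := by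
  refine lt_of_lt_of_le ?_ (parkLetter_mono w (show u + 1 ≤ v from huv))
  have h : parkLetter w u ≤ w.countP (· ≤ u) := by
    cases u with
    | zero => simp [parkLetter]
    | succ u =>
      have := countP_le_succ w u
      have := List.one_le_count_iff.2 hu
      simp only [parkLetter]; omega
  simp only [parkLetter]; omega

theorem parkLetter_lt_iff {w : List ℕ} {u v : ℕ} (hu : u ∈ w) :
    parkLetter w u < parkLetter w v ↔ u < v := by
  refine ⟨fun h => ?_, parkLetter_lt hu⟩
  by_contra hn
  have := parkLetter_mono w (not_lt.1 hn)
  omega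

theorem parkLetter_lowWord (w : List ℕ) {k v : ℕ} (hv : v ≤ k) :
    parkLetter (lowWord w k) v = parkLetter w v := by
  induction v with
  | zero => rfl
  | succ v ih => rw [parkLetter, parkLetter, ih (by omega), countP_lowWord w (by omega)]

/-- Each step of the recursion for `parkLetter` either adds one to the value or lowers it to a count
plus one, and sparseness bounds that count from below. -/
theorem IsSparse.countP_le_parkLetter {w : List ℕ} {k : ℕ} (h : IsSparse w k) :
    w.countP (· ≤ k) ≤ parkLetter w k + w.countP (· ≤ 0) := by
  have key : ∀ s ≤ k, w.countP (· ≤ k) ≤ parkLetter w s + (k - s) + w.countP (· ≤ 0) := by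
    intro s hs
    induction s with
    | zero => have := h 0 hs; simp only [parkLetter]; omega
    | succ s ih =>
      have := ih (by omega)
      have := h s (by omega)
      simp only [parkLetter]; omega
  simpa using key k le_rfl

theorem countP_zero {w : List ℕ} (h : ∀ x ∈ w, 1 ≤ x) : w.countP (· ≤ 0) = 0 :=
  List.countP_eq_zero.2 fun x hx => by
    have := h x hx
    simp only [decide_eq_true_eq]; omega

/-- By the preceding bound the minimum taken at `k` is the number of letters `≤ k`. From there the
recursion restarts as it does for `highWord w k`. -/
theorem IsSparse.parkLetter_add {w : List ℕ} {k : ℕ} (h : IsSparse w k) (h0 : ∀ x ∈ w, 1 ≤ x)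
    (v : ℕ) : parkLetter w (k + (v + 1)) = w.countP (· ≤ k) + parkLetter (highWord w k) (v + 1) := by
  have h1 := h.countP_le_parkLetter
  rw [countP_zero h0] at h1
  induction v with
  | zero => simp only [← add_assoc, parkLetter]; omega
  | succ v ih =>
    have := countP_highWord w k (v + 1)
    rw [← add_assoc, parkLetter, ih, ← this]
    simp only [parkLetter]; omega

/-- Ensures that splitting the parkization at the number of letters `≤ k` separates the same
positions as splitting `w` at `k`. -/
theorem IsSparse.parkLetter_le_iff {w : List ℕ} {k : ℕ} (h : IsSparse w k) (h0 : ∀ x ∈ w, 1 ≤ x)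
    {v : ℕ} (hv : v ∈ w) : parkLetter w v ≤ w.countP (· ≤ k) ↔ v ≤ k := by
  constructor
  · intro hle
    by_contra hn
    obtain ⟨d, rfl⟩ := Nat.exists_eq_add_of_lt (not_le.1 hn)
    rw [add_assoc, h.parkLetter_add h0] at hle
    simp only [parkLetter] at hle; omega
  · intro hle
    obtain ⟨u, rfl⟩ := Nat.exists_eq_add_of_le' (h0 v hv)
    have := countP_le_succ w u
    have := List.one_le_count_iff.2 hv
    have := countP_le_mono w hle
    simp only [parkLetter]; omega

theorem IsSparse.lowWord_park {w : List ℕ} {k : ℕ} (h : IsSparse w k) (h0 : ∀ x ∈ w, 1 ≤ x) :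
    lowWord (park w) (w.countP (· ≤ k)) = park (lowWord w k) := by
  rw [park_eq_map, park_eq_map, lowWord, List.filter_map]
  have : w.filter ((fun x => decide (x ≤ w.countP (· ≤ k))) ∘ parkLetter w) = lowWord w k :=
    List.filter_congr fun x hx => by
      simp only [Function.comp, decide_eq_decide]
      exact h.parkLetter_le_iff h0 hx
  rw [this]
  exact List.map_congr_left fun x hx => (parkLetter_lowWord w (mem_lowWord.1 hx).2).symm

theorem IsSparse.highWord_park {w : List ℕ} {k : ℕ} (h : IsSparse w k) (h0 : ∀ x ∈ w, 1 ≤ x) :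
    highWord (park w) (w.countP (· ≤ k)) = park (highWord w k) := by
  rw [park_eq_map, park_eq_map, highWord, List.filter_map]
  have : w.filter ((fun x => decide (w.countP (· ≤ k) < x)) ∘ parkLetter w) = w.filter (k < ·) :=
    List.filter_congr fun x hx => by
      simp only [Function.comp, decide_eq_decide, ← not_le]
      exact not_congr (h.parkLetter_le_iff h0 hx)
  rw [this, List.map_map, highWord, List.map_map]
  refine List.map_congr_left fun x hx => ?_
  have hx := of_decide_eq_true (List.mem_filter.1 hx).2
  obtain ⟨d, rfl⟩ := Nat.exists_eq_add_of_lt hx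
  have := h.parkLetter_add h0 d
  simp only [Function.comp]
  rw [add_assoc, this, Nat.add_sub_cancel_left, Nat.add_sub_cancel_left]
  rfl

theorem IsSparse.map_le_park {w : List ℕ} {k : ℕ} (h : IsSparse w k) (h0 : ∀ x ∈ w, 1 ≤ x) :
    (park w).map (fun x => decide (x ≤ w.countP (· ≤ k))) = w.map fun x => decide (x ≤ k) := by
  rw [park_eq_map, List.map_map]
  refine List.map_congr_left fun x hx => ?_
  simp only [Function.comp, decide_eq_decide]
  exact h.parkLetter_le_iff h0 hx

/-! ## Cuts of parking functions -/

theorem IsParking.lowWord {w : List ℕ} (h : IsParking w) {k : ℕ} (hk : w.countP (· ≤ k) = k) :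
    IsParking (lowWord w k) := by
  refine ⟨fun x hx => h.1 x (mem_lowWord.1 hx).1, fun i hi => ?_⟩
  rw [length_lowWord, hk] at hi
  rw [countP_lowWord w hi]
  exact h.2 i (hi.trans (hk ▸ List.countP_le_length))

theorem IsParking.highWord {w : List ℕ} (h : IsParking w) {k : ℕ} (hk : w.countP (· ≤ k) = k) :
    IsParking (highWord w k) := by
  refine ⟨fun x hx => (mem_highWord.1 hx).1, fun i hi => ?_⟩
  have h1 := length_highWord w k
  have h2 := countP_highWord w k i
  have h3 := h.2 (k + i) (by omega)
  omega

namespace ParkingFunction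

/-- The `k` such that exactly `k` letters are `≤ k`. -/
def cuts (a : ParkingFunction) : Finset ℕ :=
  (Finset.range (a.size + 1)).filter fun k => a.1.countP (· ≤ k) = k

theorem mem_cuts {a : ParkingFunction} {k : ℕ} : k ∈ a.cuts ↔ a.1.countP (· ≤ k) = k := by
  rw [cuts, Finset.mem_filter, Finset.mem_range, and_iff_right_iff_imp]
  intro h
  have : a.1.countP (· ≤ k) ≤ a.size := List.countP_le_length
  omega

/-- The parkization of the subword of the letters `≤ k`. -/
def low (a : ParkingFunction) (k : ℕ) : ParkingFunction :=
  ofWord (lowWord a.1 k) fun x hx => a.2.1 x (mem_lowWord.1 hx).1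

/-- The parkization of the subword of the letters `> k`. -/
def high (a : ParkingFunction) (k : ℕ) : ParkingFunction :=
  ofWord (highWord a.1 k) fun _ hx => (mem_highWord.1 hx).1

theorem val_low {a : ParkingFunction} {k : ℕ} (hk : k ∈ a.cuts) : (a.low k).1 = lowWord a.1 k :=
  park_of_isParking (a.2.lowWord (mem_cuts.1 hk))

theorem val_high {a : ParkingFunction} {k : ℕ} (hk : k ∈ a.cuts) : (a.high k).1 = highWord a.1 k :=
  park_of_isParking (a.2.highWord (mem_cuts.1 hk))

theorem size_low {a : ParkingFunction} {k : ℕ} (hk : k ∈ a.cuts) : (a.low k).size = k := by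
  rw [size, val_low hk, length_lowWord, mem_cuts.1 hk]

theorem size_high {a : ParkingFunction} {k : ℕ} (hk : k ∈ a.cuts) : k + (a.high k).size = a.size := by
  have := length_highWord a.1 k
  rwa [mem_cuts.1 hk, ← val_high hk] at this

theorem le_size_of_mem_cuts {a : ParkingFunction} {k : ℕ} (hk : k ∈ a.cuts) : k ≤ a.size := by
  have := size_high hk
  omega

theorem zero_mem_cuts (a : ParkingFunction) : 0 ∈ a.cuts := mem_cuts.2 (countP_zero a.2.1)

theorem low_zero (a : ParkingFunction) : a.low 0 = empty :=
  size_eq_zero.1 (size_low a.zero_mem_cuts)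

theorem high_zero (a : ParkingFunction) : a.high 0 = a := by
  refine Subtype.ext ((val_high a.zero_mem_cuts).trans ?_)
  have : a.1.filter (0 < ·) = a.1 :=
    List.filter_eq_self.2 fun x hx => decide_eq_true (a.2.1 x hx)
  rw [highWord, this]
  simp

theorem size_mem_cuts (a : ParkingFunction) : a.size ∈ a.cuts :=
  mem_cuts.2 (List.countP_eq_length.2 fun x hx => decide_eq_true (a.le_size x hx))

theorem high_size (a : ParkingFunction) : a.high a.size = empty :=
  size_eq_zero.1 (by have := size_high a.size_mem_cuts; omega)

theorem low_size (a : ParkingFunction) : a.low a.size = a :=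
  Subtype.ext ((val_low a.size_mem_cuts).trans
    (List.filter_eq_self.2 fun x hx => decide_eq_true (a.le_size x hx)))

theorem mem_cuts_low {a : ParkingFunction} {k l : ℕ} (hk : k ∈ a.cuts) :
    l ∈ (a.low k).cuts ↔ l ≤ k ∧ l ∈ a.cuts := by
  constructor
  · intro hl
    have h1 := le_size_of_mem_cuts hl
    rw [size_low hk] at h1
    rw [mem_cuts, val_low hk, countP_lowWord _ h1] at hl
    exact ⟨h1, mem_cuts.2 hl⟩
  · rintro ⟨h1, hl⟩
    rw [mem_cuts, val_low hk, countP_lowWord _ h1]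
    exact mem_cuts.1 hl

theorem mem_cuts_high {a : ParkingFunction} {k l : ℕ} (hk : k ∈ a.cuts) :
    l ∈ (a.high k).cuts ↔ k + l ∈ a.cuts := by
  have := countP_highWord a.1 k l
  rw [mem_cuts, mem_cuts, val_high hk, ← this, mem_cuts.1 hk]
  omega

theorem low_low {a : ParkingFunction} {k l : ℕ} (hk : k ∈ a.cuts) (hl : l ∈ a.cuts) (h : l ≤ k) :
    (a.low k).low l = a.low l :=
  Subtype.ext (by
    rw [val_low ((mem_cuts_low hk).2 ⟨h, hl⟩), val_low hk, val_low hl, lowWord_lowWord _ h])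

theorem high_low {a : ParkingFunction} {l m : ℕ} (hl : l ∈ a.cuts) (hk : l + m ∈ a.cuts) :
    (a.low (l + m)).high l = (a.high l).low m :=
  Subtype.ext (by
    rw [val_high ((mem_cuts_low hk).2 ⟨Nat.le_add_right l m, hl⟩), val_low hk,
      val_low ((mem_cuts_high hl).2 hk), val_high hl, highWord_lowWord])

theorem high_high {a : ParkingFunction} {l m : ℕ} (hl : l ∈ a.cuts) (hk : l + m ∈ a.cuts) :
    (a.high l).high m = a.high (l + m) :=
  Subtype.ext (by
    rw [val_high ((mem_cuts_high hl).2 hk), val_high hl, val_high hk, highWord_highWord])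

/-- The last letter, and `0` for the empty word. -/
def last (a : ParkingFunction) : ℕ := a.1.getLastD 0

theorem last_empty : empty.last = 0 := rfl

theorem last_mem {a : ParkingFunction} (ha : a ≠ empty) : a.last ∈ a.1 :=
  getLastD_mem fun h => ha (Subtype.ext h)

theorem last_low {a : ParkingFunction} {k : ℕ} (hk : k ∈ a.cuts) (h : a.last ≤ k) :
    (a.low k).last = a.last := by
  rw [last, val_low hk, getLastD_lowWord h, last]

theorem last_high {a : ParkingFunction} {k : ℕ} (hk : k ∈ a.cuts) (h : k < a.last) :
    (a.high k).last = a.last - k := by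
  rw [last, val_high hk, getLastD_highWord _ h, last]

theorem low_ne_empty {a : ParkingFunction} (ha : a ≠ empty) {k : ℕ} (hk : k ∈ a.cuts)
    (h : a.last ≤ k) : a.low k ≠ empty := fun h0 => by
  have h1 := last_low hk h
  have h2 := a.2.1 _ (last_mem ha)
  rw [h0, last_empty] at h1
  omega

theorem high_ne_empty {a : ParkingFunction} {k : ℕ} (hk : k ∈ a.cuts)
    (h : k < a.last) : a.high k ≠ empty := fun h0 => by
  have h1 := last_high hk h
  rw [h0, last_empty] at h1
  omega

/-- Both sides run over pairs of cuts `l ≤ k` of `a`, the cuts of the upper part at `l` being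
shifted by `l`. -/
theorem sum_cuts_cuts {M : Type*} [AddCommMonoid M] (a : ParkingFunction)
    (Φ : ParkingFunction → ParkingFunction → ParkingFunction → Prop → Prop → M) :
    ∑ k ∈ a.cuts, ∑ l ∈ (a.low k).cuts, Φ ((a.low k).low l) ((a.low k).high l)
      (a.high k) (k < a.last) (k < a.last ∨ l < (a.low k).last) =
    ∑ k ∈ a.cuts, ∑ l ∈ (a.high k).cuts, Φ (a.low k) ((a.high k).low l)
      ((a.high k).high l) (k < a.last ∧ l < (a.high k).last) (k < a.last) := by
  rw [Finset.sum_sigma', Finset.sum_sigma']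
  refine Finset.sum_bij' (fun p _ => ⟨p.2, p.1 - p.2⟩) (fun p _ => ⟨p.1 + p.2, p.1⟩) ?_ ?_ ?_ ?_ ?_
  · rintro ⟨k, l⟩ h
    rw [Finset.mem_sigma] at h ⊢
    obtain ⟨hk, hl⟩ := h
    obtain ⟨hlk, hl⟩ := (mem_cuts_low hk).1 hl
    exact ⟨hl, (mem_cuts_high hl).2 (by rwa [Nat.add_sub_cancel' hlk])⟩
  · rintro ⟨k, l⟩ h
    rw [Finset.mem_sigma] at h ⊢
    obtain ⟨hk, hl⟩ := h
    have hkl := (mem_cuts_high hk).1 hl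
    exact ⟨hkl, (mem_cuts_low hkl).2 ⟨Nat.le_add_right k l, hk⟩⟩
  · rintro ⟨k, l⟩ h
    rw [Finset.mem_sigma] at h
    have := ((mem_cuts_low h.1).1 h.2).1
    simp only [Nat.add_sub_cancel' this]
  · rintro ⟨k, l⟩ h
    simp only [Nat.add_sub_cancel_left]
  · rintro ⟨k, l⟩ h
    rw [Finset.mem_sigma] at h
    obtain ⟨hk, hl'⟩ := h
    obtain ⟨hlk, hl⟩ := (mem_cuts_low hk).1 hl'
    clear hl'
    dsimp only at hk hlk hl ⊢
    obtain ⟨m, rfl⟩ := Nat.exists_eq_add_of_le hlk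
    simp only [Nat.add_sub_cancel_left]
    rw [low_low hk hl hlk, high_low hl hk, high_high hl hk]
    have e1 : (l + m < a.last) = (l < a.last ∧ m < (a.high l).last) := by
      refine propext ⟨fun h => ⟨by omega, ?_⟩, fun ⟨h1, h2⟩ => ?_⟩
      · rw [last_high hl (by omega)]; omega
      · rw [last_high hl h1] at h2; omega
    have e2 : (l + m < a.last ∨ l < (a.low (l + m)).last) = (l < a.last) := by
      by_cases h : l + m < a.last
      · exact propext ⟨fun _ => by omega, fun _ => .inl h⟩
      · rw [last_low hk (not_lt.1 h)]
        exact propext ⟨fun h' => h'.resolve_left h, .inr⟩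
    rw [e2, e1]

/-- The words whose parts before and after the length of `a` have the parkizations `a` and `b`. -/
noncomputable def conc (a b : ParkingFunction) : Finset ParkingFunction :=
  (ofSize (a.size + b.size)).filter fun c => c.take a.size = a ∧ c.drop a.size = b

theorem mem_conc {a b c : ParkingFunction} :
    c ∈ conc a b ↔ c.size = a.size + b.size ∧ c.take a.size = a ∧ c.drop a.size = b := by
  rw [conc, Finset.mem_filter, mem_ofSize]

theorem mem_conc' {a b c : ParkingFunction} : c ∈ conc a b ↔
    ∃ u v, c.1 = u ++ v ∧ park u = a.1 ∧ park v = b.1 := by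
  rw [mem_conc]
  constructor
  · rintro ⟨-, h1, h2⟩
    exact ⟨_, _, (List.take_append_drop a.size c.1).symm, congrArg Subtype.val h1,
      congrArg Subtype.val h2⟩
  · rintro ⟨u, v, h, hu, hv⟩
    have h1 : a.size = u.length := by rw [size, ← hu, length_park]
    have h2 : b.size = v.length := by rw [size, ← hv, length_park]
    refine ⟨by rw [size, h, List.length_append, h1, h2], Subtype.ext ?_, Subtype.ext ?_⟩
    · change park (c.1.take a.size) = a.1
      rw [h, h1, List.take_left, hu]
    · change park (c.1.drop a.size) = b.1
      rw [h, h1, List.drop_left, hv]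

theorem empty_conc (a : ParkingFunction) : conc empty a = {a} := by
  have h0 : empty.size = 0 := rfl
  ext c
  rw [mem_conc, Finset.mem_singleton, h0, zero_add, drop_zero]
  refine ⟨fun h => h.2.2, ?_⟩
  rintro rfl
  exact ⟨rfl, size_eq_zero.1 (by rw [size_take, Nat.zero_min]), rfl⟩

/-- The data attached to a cut of a word `c = uv` with parkizations `a` and `b` of `u` and `v`. -/
theorem cut_conc {a b c : ParkingFunction} {u v : List ℕ} (hc : c.1 = u ++ v) (hu : park u = a.1)
    (hv : park v = b.1) {k : ℕ} (hk : k ∈ c.cuts) :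
    u.countP (· ≤ k) + v.countP (· ≤ k) = k ∧
    u.countP (· ≤ k) ∈ a.cuts ∧ v.countP (· ≤ k) ∈ b.cuts ∧
    (park (lowWord u k) = (a.low (u.countP (· ≤ k))).1 ∧
      park (lowWord v k) = (b.low (v.countP (· ≤ k))).1) ∧
    (park (highWord u k) = (a.high (u.countP (· ≤ k))).1 ∧
      park (highWord v k) = (b.high (v.countP (· ≤ k))).1) ∧
    a.1.map (fun x => decide (x ≤ u.countP (· ≤ k))) = u.map (fun x => decide (x ≤ k)) ∧
    b.1.map (fun x => decide (x ≤ v.countP (· ≤ k))) = v.map (fun x => decide (x ≤ k)) := by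
  have h0 := c.2.1
  have hs := c.2.isSparse (mem_cuts.1 hk)
  have hk' := mem_cuts.1 hk
  rw [hc] at h0 hs hk'
  rw [List.countP_append] at hk'
  -- Each factor is sparse at `k`, so for each of them parkization commutes with splitting.
  have key {a : ParkingFunction} {u : List ℕ} (hu : park u = a.1) (h0 : ∀ x ∈ u, 1 ≤ x)
      (hs : IsSparse u k) : u.countP (· ≤ k) ∈ a.cuts ∧
        park (lowWord u k) = (a.low (u.countP (· ≤ k))).1 ∧
        park (highWord u k) = (a.high (u.countP (· ≤ k))).1 ∧
        a.1.map (fun x => decide (x ≤ u.countP (· ≤ k))) = u.map (fun x => decide (x ≤ k)) := by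
    have h1 : u.countP (· ≤ k) ∈ a.cuts := by
      rw [mem_cuts, ← length_lowWord, ← hu, hs.lowWord_park h0, length_park, length_lowWord]
    rw [val_low h1, val_high h1, ← hu, hs.lowWord_park h0, hs.highWord_park h0, hs.map_le_park h0]
    exact ⟨h1, rfl, rfl, rfl⟩
  obtain ⟨a1, a2, a3, a4⟩ := key hu (fun x hx => h0 x (List.mem_append_left _ hx)) hs.of_append_left
  obtain ⟨b1, b2, b3, b4⟩ := key hv (fun x hx => h0 x (List.mem_append_right _ hx)) hs.of_append_right
  exact ⟨hk', a1, b1, ⟨a2, b2⟩, ⟨a3, b3⟩, a4, b4⟩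

/-- The cuts of the words in the product of `a` and `b` are the words in the products of the parts of
cuts of `a` and `b`. -/
theorem sum_cuts_conc {M : Type*} [AddCommMonoid M] (a b : ParkingFunction)
    (Φ : ℕ → ℕ → ParkingFunction → ParkingFunction → M) :
    ∑ c ∈ conc a b, ∑ k ∈ c.cuts, Φ ((c.1.take a.size).countP (· ≤ k))
      ((c.1.drop a.size).countP (· ≤ k)) (c.low k) (c.high k) =
    ∑ i ∈ a.cuts, ∑ j ∈ b.cuts, ∑ u ∈ conc (a.low i) (b.low j),
      ∑ w ∈ conc (a.high i) (b.high j), Φ i j u w := by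
  have hspec {c : ParkingFunction} (hc : c ∈ conc a b) {k : ℕ} (hk : k ∈ c.cuts) :=
    cut_conc (List.take_append_drop a.size c.1).symm
      (congrArg Subtype.val (mem_conc.1 hc).2.1) (congrArg Subtype.val (mem_conc.1 hc).2.2) hk
  have hR : ∑ i ∈ a.cuts, ∑ j ∈ b.cuts, ∑ u ∈ conc (a.low i) (b.low j),
      ∑ w ∈ conc (a.high i) (b.high j), Φ i j u w =
      ∑ p ∈ (a.cuts ×ˢ b.cuts).sigma fun p => conc (a.low p.1) (b.low p.2) ×ˢ
        conc (a.high p.1) (b.high p.2), Φ p.1.1 p.1.2 p.2.1 p.2.2 := by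
    rw [Finset.sum_sigma, Finset.sum_product]
    simp only [Finset.sum_product]
  rw [hR, Finset.sum_sigma']
  -- The cut `k` distributes over the two factors: `i` and `j` are the numbers of letters `≤ k` in
  -- each, and `k = i + j`.
  refine Finset.sum_bij (fun p _ => ⟨((p.1.1.take a.size).countP (· ≤ p.2),
    (p.1.1.drop a.size).countP (· ≤ p.2)), (p.1.low p.2, p.1.high p.2)⟩) ?_ ?_ ?_ ?_
  · rintro ⟨c, k⟩ h
    rw [Finset.mem_sigma] at h
    obtain ⟨hc, hk⟩ := h
    dsimp only at hc hk
    obtain ⟨h1, h2, h3, h4, h5, -⟩ := hspec hc hk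
    rw [Finset.mem_sigma, Finset.mem_product, Finset.mem_product]
    refine ⟨⟨h2, h3⟩, mem_conc'.2 ⟨_, _, ?_, h4⟩, mem_conc'.2 ⟨_, _, ?_, h5⟩⟩
    · rw [val_low hk, ← lowWord_append, List.take_append_drop]
    · rw [val_high hk, ← highWord_append, List.take_append_drop]
  · rintro ⟨c, k⟩ h ⟨c', k'⟩ h' heq
    rw [Finset.mem_sigma] at h h'
    obtain ⟨hc, hk⟩ := h
    obtain ⟨hc', hk'⟩ := h'
    dsimp only at hc hk hc' hk'
    obtain ⟨h1, -, -, -, -, h6, h7⟩ := hspec hc hk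
    obtain ⟨h1', -, -, -, -, h6', h7'⟩ := hspec hc' hk'
    simp only [Sigma.mk.injEq, Prod.mk.injEq, heq_eq_eq] at heq
    obtain ⟨⟨e1, e2⟩, e3, e4⟩ := heq
    obtain rfl : k = k' := by rw [← h1, ← h1', e1, e2]
    -- The positions of the letters `≤ k` are prescribed by `a`, `b`, `i` and `j`, and the letters
    -- themselves by the two pieces.
    have : c = c' := by
      refine Subtype.ext (eq_of_lowWord_of_highWord (k := k) ?_ ?_ ?_)
      · rw [← List.take_append_drop a.size c.1, ← List.take_append_drop a.size c'.1, List.map_append,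
          List.map_append, ← h6, ← h7, ← h6', ← h7', e1, e2]
      · rw [← val_low hk, ← val_low hk', e3]
      · rw [← val_high hk, ← val_high hk', e4]
    rw [this]
  · rintro ⟨⟨i, j⟩, u, w⟩ h
    rw [Finset.mem_sigma, Finset.mem_product, Finset.mem_product] at h
    obtain ⟨⟨hi, hj⟩, hu, hw⟩ := h
    dsimp only at hi hj hu hw
    obtain ⟨u1, u2, hu, hu1, hu2⟩ := mem_conc'.1 hu
    obtain ⟨w1, w2, hw, hw1, hw2⟩ := mem_conc'.1 hw
    have lu1 : u1.length = i := by
      rw [← length_park, hu1]; exact size_low hi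
    have lu2 : u2.length = j := by
      rw [← length_park, hu2]; exact size_low hj
    have lw1 : i + w1.length = a.size := by
      rw [← length_park w1, hw1]; exact size_high hi
    have lw2 : j + w2.length = b.size := by
      rw [← length_park w2, hw2]; exact size_high hj
    have hsu : u.size = i + j := by rw [size, hu, List.length_append, lu1, lu2]
    have hule : ∀ x ∈ u1 ++ u2, x ≤ i + j := fun x hx => hsu ▸ u.le_size x (hu ▸ hx)
    have hwpos : ∀ x ∈ w1 ++ w2, 1 ≤ x := fun x hx => w.2.1 x (hw ▸ hx)
    -- For the inverse, `a` prescribes the positions of the small letters and `u1`, `w1` the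
    -- letters. The threshold of the merged word is `i + j`, as the letters of `u` go up to its
    -- length.
    obtain ⟨c1, p1, l1, g1⟩ := exists_merge (a := a.1) (u := u1) (w := w1) (i := i) (k := i + j)
      (by rw [lu1, mem_cuts.1 hi]) (by rw [mem_cuts.1 hi]; exact lw1)
      (fun x hx => hule x (List.mem_append_left _ hx))
      (fun x hx => hwpos x (List.mem_append_left _ hx))
    obtain ⟨c2, p2, l2, g2⟩ := exists_merge (a := b.1) (u := u2) (w := w2) (i := j) (k := i + j)
      (by rw [lu2, mem_cuts.1 hj]) (by rw [mem_cuts.1 hj]; exact lw2)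
      (fun x hx => hule x (List.mem_append_right _ hx))
      (fun x hx => hwpos x (List.mem_append_right _ hx))
    have hl : lowWord (c1 ++ c2) (i + j) = u.1 := by rw [lowWord_append, l1, l2, hu]
    have hg : highWord (c1 ++ c2) (i + j) = w.1 := by rw [highWord_append, g1, g2, hw]
    -- The merged word is a shifted shuffle of the parking functions `u` and `w`.
    have hpark : IsParking (c1 ++ c2) := by
      refine isParking_of_filter (a := u) (b := w) (hsu ▸ hl) ?_
      rw [hsu, ← hg, highWord, List.map_map]
      refine ((List.map_congr_left (g := id) fun x hx => ?_).trans (List.map_id _)).symm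
      have := of_decide_eq_true (List.mem_filter.1 hx).2
      simp only [Function.comp, id]; omega
    have hcut : (c1 ++ c2).countP (· ≤ i + j) = i + j := by
      rw [← length_lowWord, hl]; exact hsu
    have hs := hpark.isSparse hcut
    have k1 : c1.countP (· ≤ i + j) = i := by rw [← length_lowWord, l1, lu1]
    have k2 : c2.countP (· ≤ i + j) = j := by rw [← length_lowWord, l2, lu2]
    have key {a : ParkingFunction} {c u w : List ℕ} {i k : ℕ} (hi : i ∈ a.cuts)
        (h0 : ∀ x ∈ c, 1 ≤ x) (hs : IsSparse c k) (hk : c.countP (· ≤ k) = i)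
        (p : c.map (fun x => decide (x ≤ k)) = a.1.map fun x => decide (x ≤ i))
        (l : lowWord c k = u) (g : highWord c k = w) (hu : park u = (a.low i).1)
        (hw : park w = (a.high i).1) : park c = a.1 := by
      subst hk
      refine eq_of_lowWord_of_highWord ((hs.map_le_park h0).trans p) ?_ ?_
      · rw [hs.lowWord_park h0, l, hu, val_low hi]
      · rw [hs.highWord_park h0, g, hw, val_high hi]
    have hc1 := key hi (fun x hx => hpark.1 x (List.mem_append_left _ hx)) hs.of_append_left k1 p1 l1 g1 hu1 hw1
    have hc2 := key hj (fun x hx => hpark.1 x (List.mem_append_right _ hx)) hs.of_append_right k2 p2 l2 g2 hu2 hw2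
    have hla : a.size = c1.length := by rw [size, ← hc1, length_park]
    have hk : i + j ∈ cuts ⟨c1 ++ c2, hpark⟩ := mem_cuts.2 hcut
    refine ⟨⟨⟨c1 ++ c2, hpark⟩, i + j⟩, Finset.mem_sigma.2 ⟨mem_conc'.2 ⟨c1, c2, rfl, hc1, hc2⟩, hk⟩, ?_⟩
    have e1 : low ⟨c1 ++ c2, hpark⟩ (i + j) = u :=
      Subtype.ext ((val_low hk).trans hl)
    have e2 : high ⟨c1 ++ c2, hpark⟩ (i + j) = w :=
      Subtype.ext ((val_high hk).trans hg)
    simp only [e1, e2, hla, List.take_left, List.drop_left, k1, k2]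
  · rintro ⟨c, k⟩ _
    rfl

end ParkingFunction

/-! ### The last letter and the grafting of parking functions. -/

namespace ParkingFunction

theorem last_of_append {a : ParkingFunction} {u v : List ℕ} (h : a.1 = u ++ v) (hv : v ≠ []) :
    a.last = v.getLastD 0 := by
  rw [last, h, getLastD_append hv]

theorem drop_ne_nil {a b c : ParkingFunction} (hc : c ∈ conc a b) (hb : b ≠ empty) :
    c.1.drop a.size ≠ [] := fun h => hb <| by
  have h1 : park (c.1.drop a.size) = b.1 := congrArg Subtype.val (mem_conc.1 hc).2.2
  rw [h] at h1
  exact Subtype.ext h1.symm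

theorem last_eq_of_drop {c : ParkingFunction} {m : ℕ} (h : c.1.drop m ≠ []) :
    c.last = (c.1.drop m).getLastD 0 :=
  last_of_append (List.take_append_drop m c.1).symm h

theorem last_drop {c : ParkingFunction} {m : ℕ} (h : c.1.drop m ≠ []) :
    (c.drop m).last = parkLetter (c.1.drop m) c.last := by
  rw [last_eq_of_drop h]
  change (park (c.1.drop m)).getLastD 0 = _
  rw [park_eq_map]
  exact getLastD_map rfl

/-- The last letter of `b` is the parkized last letter of `c`, and the second factor of `c` is
sparse at `k`, so `parkLetter_le_iff` translates the comparison. -/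
theorem lt_last_iff {a b c : ParkingFunction} (hc : c ∈ conc a b) (hb : b ≠ empty) {k : ℕ}
    (hk : k ∈ c.cuts) : k < c.last ↔ (c.1.drop a.size).countP (· ≤ k) < b.last := by
  have hne := drop_ne_nil hc hb
  have hs := c.2.isSparse (mem_cuts.1 hk)
  rw [← List.take_append_drop a.size c.1] at hs
  have h0 : ∀ x ∈ c.1.drop a.size, 1 ≤ x := fun x hx => c.2.1 x (List.mem_of_mem_drop hx)
  have h1 : b.last = parkLetter (c.1.drop a.size) c.last := by
    rw [← last_drop hne, (mem_conc.1 hc).2.2]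
  have hm : c.last ∈ c.1.drop a.size := by
    rw [last_eq_of_drop hne]
    exact getLastD_mem hne
  rw [h1, ← not_le, ← not_le]
  exact not_congr (hs.of_append_right.parkLetter_le_iff h0 hm).symm

/-- The words of the product of `a` and `b` in which all letters of the first part are greater than
the last letter. -/
noncomputable def gr (a b : ParkingFunction) : Finset ParkingFunction :=
  (conc a b).filter fun c => ∀ v ∈ c.1.take a.size, c.last < v

theorem mem_gr {a b c : ParkingFunction} :
    c ∈ gr a b ↔ c ∈ conc a b ∧ ∀ v ∈ c.1.take a.size, c.last < v := Finset.mem_filter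

theorem empty_gr (a : ParkingFunction) : gr empty a = {a} := by
  have h0 : empty.size = 0 := rfl
  rw [gr, empty_conc, h0]
  exact Finset.filter_true_of_mem fun c _ v hv => by simp at hv

/-- Both sides describe factorizations `c = u u' v` in which all letters of `u` and `u'` exceed the
last letter of `v`. On the right the letters of `u'` are compared in the parkization of `u' v`,
which preserves comparisons with the occurring last letter. -/
theorem take_add_conc {a a' b c : ParkingFunction} (hb : b ≠ empty) :
    (c.take (a.size + a'.size) ∈ conc a a' ∧ c ∈ gr (c.take (a.size + a'.size)) b ∧
      c.size = a.size + a'.size + b.size) ↔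
    c.drop a.size ∈ gr a' b ∧ c ∈ gr a (c.drop a.size) ∧ c.size = a.size + a'.size + b.size := by
  simp only [← and_assoc]
  refine and_congr_left fun hc => ?_
  have h1 : (c.take (a.size + a'.size)).size = a.size + a'.size := by rw [size_take]; omega
  have h2 : (c.drop a.size).size = a'.size + b.size := by rw [size_drop]; omega
  have hne : c.1.drop a.size ≠ [] := fun h => by
    have h3 := congrArg List.length h
    rw [List.length_drop] at h3
    have h4 : c.1.length = a.size + a'.size + b.size := hc
    exact hb (size_eq_zero.1 (by simp at h3; omega))
  have hm : c.last ∈ c.1.drop a.size := by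
    rw [last_eq_of_drop hne]
    exact getLastD_mem hne
  have hdrop : (c.drop a.size).1.take a'.size =
      ((c.1.drop a.size).take a'.size).map (parkLetter (c.1.drop a.size)) := by
    change (park (c.1.drop a.size)).take a'.size = _
    rw [park_eq_map, List.map_take]
  have hlt : (∀ v ∈ (c.drop a.size).1.take a'.size, (c.drop a.size).last < v) ↔
      ∀ v ∈ (c.1.drop a.size).take a'.size, c.last < v := by
    rw [hdrop, last_drop hne]
    simp only [List.mem_map, forall_exists_index, and_imp, forall_apply_eq_imp_iff₂,
      parkLetter_lt_iff hm]
  simp only [mem_gr, mem_conc, h1, h2, hlt, take_take, drop_take, drop_drop, hc, add_assoc, true_and,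
    and_true, Nat.min_eq_left (Nat.le_add_right a.size a'.size)]
  rw [List.take_add]
  simp only [List.mem_append, or_imp, forall_and]
  tauto

theorem sum_conc_gr {M : Type*} [AddCommMonoid M] (a a' : ParkingFunction) {b : ParkingFunction}
    (hb : b ≠ empty) (Φ : ParkingFunction → M) :
    ∑ w ∈ conc a a', ∑ c ∈ gr w b, Φ c = ∑ w ∈ gr a' b, ∑ c ∈ gr a w, Φ c := by
  rw [Finset.sum_sigma', Finset.sum_sigma']
  have hl {w c : ParkingFunction} (hw : w ∈ conc a a') (hc : c ∈ gr w b) :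
      w = c.take (a.size + a'.size) ∧ c.size = a.size + a'.size + b.size := by
    have h1 := (mem_conc.1 hw).1
    have h2 := mem_conc.1 (mem_gr.1 hc).1
    rw [h1] at h2
    exact ⟨h2.2.1.symm, h2.1⟩
  have hr {w c : ParkingFunction} (hw : w ∈ gr a' b) (hc : c ∈ gr a w) :
      w = c.drop a.size ∧ c.size = a.size + a'.size + b.size := by
    have h1 := (mem_conc.1 (mem_gr.1 hw).1).1
    have h2 := mem_conc.1 (mem_gr.1 hc).1
    rw [h1, ← add_assoc] at h2
    exact ⟨h2.2.2.symm, h2.1⟩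
  refine Finset.sum_bij' (fun p _ => ⟨p.2.drop a.size, p.2⟩)
    (fun p _ => ⟨p.2.take (a.size + a'.size), p.2⟩) ?_ ?_ ?_ ?_ ?_
  · rintro ⟨w, c⟩ h
    rw [Finset.mem_sigma] at h ⊢
    obtain ⟨h1, h2⟩ := hl h.1 h.2
    dsimp only at h1 h2 h ⊢
    rw [h1] at h
    have := (take_add_conc hb).1 ⟨h.1, h.2, h2⟩
    exact ⟨this.1, this.2.1⟩
  · rintro ⟨w, c⟩ h
    rw [Finset.mem_sigma] at h ⊢
    obtain ⟨h1, h2⟩ := hr h.1 h.2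
    dsimp only at h1 h2 h ⊢
    rw [h1] at h
    have := (take_add_conc hb).2 ⟨h.1, h.2, h2⟩
    exact ⟨this.1, this.2.1⟩
  · rintro ⟨w, c⟩ h
    rw [Finset.mem_sigma] at h
    obtain ⟨h1, h2⟩ := hl h.1 h.2
    dsimp only at h1 ⊢
    rw [h1]
  · rintro ⟨w, c⟩ h
    rw [Finset.mem_sigma] at h
    obtain ⟨h1, h2⟩ := hr h.1 h.2
    dsimp only at h1 ⊢
    rw [h1]
  · rintro ⟨w, c⟩ _
    rfl

/-- If the last letter exceeds `k`, so do all letters of a grafted first part. This part then lies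
entirely in the upper piece, where comparisons are merely shifted. -/
theorem forall_last_lt_of_lt {a b c : ParkingFunction} (hc : c ∈ conc a b) {k : ℕ}
    (hk : k ∈ c.cuts) (h : k < c.last) : (∀ v ∈ c.1.take a.size, c.last < v) ↔
      (c.1.take a.size).countP (· ≤ k) = 0 ∧ ∀ v ∈ (c.high k).1.take a.size, (c.high k).last < v := by
  have key (h0 : (c.1.take a.size).countP (· ≤ k) = 0) :
      (c.high k).1.take a.size = highWord (c.1.take a.size) k := by
    have h1 := length_highWord (c.1.take a.size) k
    have h2 : (c.1.take a.size).length = a.size := by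
      have h3 : c.1.length = a.size + b.size := (mem_conc.1 hc).1
      rw [List.length_take]; omega
    have h4 : (highWord (c.1.take a.size) k).length = a.size := by omega
    have h5 : (c.high k).1 = highWord (c.1.take a.size) k ++ highWord (c.1.drop a.size) k := by
      rw [val_high hk, ← highWord_append, List.take_append_drop]
    rw [h5, List.take_left' h4]
  rw [last_high hk h]
  constructor
  · intro hv
    have h0 : (c.1.take a.size).countP (· ≤ k) = 0 := List.countP_eq_zero.2 fun x hx => by
      have := hv x hx
      simp only [decide_eq_true_eq]; omega
    refine ⟨h0, fun v hv' => ?_⟩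
    rw [key h0, mem_highWord] at hv'
    have := hv _ hv'.2
    omega
  · rintro ⟨h0, hv⟩ v hv'
    rw [key h0] at hv
    have h1 := List.countP_eq_zero.1 h0 v hv'
    simp only [decide_eq_true_eq, not_le] at h1
    have := hv (v - k) (mem_highWord.2 ⟨by omega, by rwa [Nat.sub_add_cancel h1.le]⟩)
    omega

/-- Letters above `k` exceed the last letter anyway, so only the lower piece imposes a condition. -/
theorem forall_last_lt_of_le {a c : ParkingFunction} {k : ℕ}
    (hk : k ∈ c.cuts) (h : c.last ≤ k) : (∀ v ∈ c.1.take a.size, c.last < v) ↔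
      ∀ v ∈ (c.low k).1.take ((c.1.take a.size).countP (· ≤ k)), (c.low k).last < v := by
  have key : (c.low k).1.take ((c.1.take a.size).countP (· ≤ k)) = lowWord (c.1.take a.size) k := by
    have h5 : (c.low k).1 = lowWord (c.1.take a.size) k ++ lowWord (c.1.drop a.size) k := by
      rw [val_low hk, ← lowWord_append, List.take_append_drop]
    rw [h5, List.take_left' (length_lowWord _ _)]
  rw [last_low hk h, key]
  simp only [mem_lowWord, and_imp]
  refine ⟨fun hv v hv' _ => hv v hv', fun hv v hv' => ?_⟩
  by_cases hvk : v ≤ k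
  · exact hv v hv' hvk
  · omega

open Classical in
theorem sum_cuts_gr {M : Type*} [AddCommMonoid M] (a : ParkingFunction) {b : ParkingFunction}
    (hb : b ≠ empty) (Φ : ParkingFunction → ParkingFunction → Prop → M) :
    ∑ c ∈ gr a b, ∑ k ∈ c.cuts, Φ (c.low k) (c.high k) (k < c.last) =
    ∑ k ∈ b.cuts, if k < b.last then ∑ w ∈ gr a (b.high k), Φ (b.low k) w True else
      ∑ l ∈ a.cuts, ∑ u ∈ gr (a.low l) (b.low k), ∑ w ∈ conc (a.high l) (b.high k), Φ u w False := by
  -- The grafting condition is rewritten in terms of the pieces of the cut, so that `sum_cuts_conc`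
  -- applies. When the last letter goes up, the condition forces `i = 0`, that is, all of `a` goes
  -- up with it.
  let Ψ (i j : ℕ) (u w : ParkingFunction) : M :=
    if j < b.last then (if i = 0 ∧ ∀ v ∈ w.1.take a.size, w.last < v then Φ u w True else 0) else
      if ∀ v ∈ u.1.take i, u.last < v then Φ u w False else 0
  have h1 : ∑ c ∈ gr a b, ∑ k ∈ c.cuts, Φ (c.low k) (c.high k) (k < c.last) =
      ∑ c ∈ conc a b, ∑ k ∈ c.cuts, Ψ ((c.1.take a.size).countP (· ≤ k))
        ((c.1.drop a.size).countP (· ≤ k)) (c.low k) (c.high k) := by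
    rw [gr, Finset.sum_filter]
    refine Finset.sum_congr rfl fun c hc => ?_
    rw [← Finset.sum_const_zero (s := c.cuts), ← Finset.sum_ite_irrel]
    refine Finset.sum_congr rfl fun k hk => ?_
    simp only [Ψ, ← lt_last_iff hc hb hk]
    by_cases h : k < c.last
    · simp only [h, if_true, forall_last_lt_of_lt hc hk h]
    · simp only [h, if_false, forall_last_lt_of_le hk (not_lt.1 h)]
  rw [h1, sum_cuts_conc, Finset.sum_comm]
  refine Finset.sum_congr rfl fun j hj => ?_
  simp only [Ψ]
  split_ifs with h
  · rw [Finset.sum_eq_single_of_mem 0 a.zero_mem_cuts]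
    · rw [low_zero, high_zero, empty_conc, Finset.sum_singleton, gr, Finset.sum_filter]
      simp only [true_and]
    · intro i _ hi
      simp only [hi, false_and, if_false, Finset.sum_const_zero]
  · refine Finset.sum_congr rfl fun i hi => ?_
    rw [gr, Finset.sum_filter, size_low hi]
    refine Finset.sum_congr rfl fun u _ => ?_
    split_ifs
    · rfl
    · exact Finset.sum_const_zero

end ParkingFunction

/-! ### The bialgebra structure of `PQSymDual` -/

namespace PQSymDual
open ParkingFunction

variable (K : Type*) [Field K]

/-- The coefficient of `G_a ⊗ G_b` is one exactly if `c` is in the shifted shuffle of `a` and `b`.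
Given the length `k` of `a`, this determines `a` and `b` as the subwords of small and large letters
and requires exactly `k` letters `≤ k`. -/
theorem comul_G (c : ParkingFunction) : CoalgebraStruct.comul (R := K) (G K c) =
    ∑ k ∈ c.cuts, G K (c.low k) ⊗ₜ[K] G K (c.high k) := by
  classical
  refine (extend_G _ c).trans ?_
  rw [cuts, Finset.sum_filter]
  refine Finset.sum_congr rfl fun k hk => ?_
  have hp (a b : ParkingFunction) : pair (G K c) (PQSym.F K a * PQSym.F K b) =
      if c ∈ shiftedShuffle a b then 1 else 0 := by
    simp only [PQSym.F_mul, map_sum, pair_G_F, Finset.sum_ite_eq]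
  have hmem {a b : ParkingFunction} (ha : a.size = k) : c ∈ shiftedShuffle a b ↔
      lowWord c.1 k = a.1 ∧ highWord c.1 k = b.1 := by
    rw [mem_shiftedShuffle, ha]
    refine and_congr_right fun _ => ⟨fun h => ?_, fun h => ?_⟩
    · rw [highWord, h, List.map_map]
      refine (List.map_congr_left (g := id) fun x _ => ?_).trans (List.map_id _)
      simp
    · rw [← h, highWord, List.map_map]
      refine ((List.map_congr_left (g := id) fun x hx => ?_).trans (List.map_id _)).symm
      have := of_decide_eq_true (List.mem_filter.1 hx).2
      simp only [Function.comp, id]; omega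
  simp only [hp, ite_smul, one_smul, zero_smul]
  split_ifs with h
  · have hc : k ∈ c.cuts := mem_cuts.2 h
    have hs := size_high hc
    rw [Finset.sum_eq_single_of_mem (c.low k) (mem_ofSize.2 (size_low hc)),
      Finset.sum_eq_single_of_mem (c.high k) (mem_ofSize.2 (by omega)), if_pos]
    · exact (hmem (size_low hc)).2 ⟨(val_low hc).symm, (val_high hc).symm⟩
    · intro b _ hb
      refine if_neg fun hm => hb (Subtype.ext ?_)
      rw [← ((hmem (size_low hc)).1 hm).2, val_high hc]
    · intro a ha hne
      refine Finset.sum_eq_zero fun b _ => if_neg fun hm => hne (Subtype.ext ?_)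
      rw [← ((hmem (mem_ofSize.1 ha)).1 hm).1, val_low hc]
  · refine Finset.sum_eq_zero fun a ha => Finset.sum_eq_zero fun b _ => if_neg fun hm => h ?_
    rw [← length_lowWord, ((hmem (mem_ofSize.1 ha)).1 hm).1]
    exact mem_ofSize.1 ha

/-- Parkization preserves lengths, so of all factorizations of `c` only the one at the length of `a`
can contribute. -/
theorem G_mul (a b : ParkingFunction) : G K a * G K b = ∑ c ∈ conc a b, G K c := by
  classical
  have h1 : G K a * G K b = ∑ c ∈ ofSize (a.size + b.size),
      tensorPair (G K a ⊗ₜ[K] G K b) (Coalgebra.comul (PQSym.F K c)) • G K c := by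
    change mulHom (G K a) (G K b) = _
    rw [mulHom, extend_G, extend_G]
  rw [h1, conc, Finset.sum_filter]
  refine Finset.sum_congr rfl fun c hc => ?_
  have hc : c.size = a.size + b.size := mem_ofSize.1 hc
  rw [PQSym.comul_F, map_sum, Finset.sum_eq_single_of_mem a.size (Finset.mem_range.2 (by omega))]
  · rw [tensorPair_tmul, pair_G_F, pair_G_F]
    by_cases h1 : c.take a.size = a <;> by_cases h2 : c.drop a.size = b <;>
      simp [h1, h2, eq_comm (a := a), eq_comm (a := b)]
  · intro i hi hne
    have := Finset.mem_range.1 hi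
    rw [tensorPair_tmul, pair_G_F, if_neg, zero_mul]
    intro h
    refine hne ?_
    rw [h, size_take]; omega

/-- The cuts, the product and the grafting of parking functions. -/
noncomputable def cutData : CutData ParkingFunction ℕ where
  one := empty
  size := size
  cuts := cuts
  roo := low
  lea := high
  side a k := k < a.last
  prod := conc
  gr := gr

/-- The basis of the `G_a`. -/
noncomputable def basis : Module.Basis ParkingFunction K (PQSymDual K) :=
  .ofRepr (LinearEquiv.refl K (ParkingFunction →₀ K))

theorem basis_apply (a : ParkingFunction) : basis K a = G K a := rfl

theorem isBasis : cutData.IsBasis (basis K) where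
  basis_one := rfl
  counit_basis a := by
    classical
    exact (pair_G_F a empty).trans (by congr)
  comul_basis a := comul_G K a
  mul_basis a b := G_mul K a b
  size_eq_zero a := ParkingFunction.size_eq_zero
  size_cut a k hk := (congrArg (· + _) (size_low hk)).trans (size_high hk)
  exists_top a := ⟨0, a.zero_mem_cuts, a.low_zero, a.high_zero, fun l hl h => by
    exact (size_low hl).symm.trans (ParkingFunction.size_eq_zero.2 h)⟩
  exists_bot a := ⟨a.size, a.size_mem_cuts, a.high_size, a.low_size, fun l hl h => by
    have h1 := size_high hl
    have h2 : (a.high l).size = 0 := ParkingFunction.size_eq_zero.2 h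
    omega⟩
  lea_ne_one a k hk hs := high_ne_empty hk hs
  roo_ne_one a ha k hk hs := low_ne_empty ha hk (not_lt.1 hs)
  cuts_cuts a _ _ Φ := a.sum_cuts_cuts Φ
  size_prod a b c hc := (mem_conc.1 hc).1
  cuts_prod a b hb _ _ Φ := by
    refine Eq.trans ?_ (sum_cuts_conc a b fun i j u w => Φ u w (j < b.last))
    refine Finset.sum_congr rfl fun c hc => Finset.sum_congr rfl fun k hk => ?_
    exact congrArg _ (propext (lt_last_iff hc hb hk))
  size_gr a b _ c hc := (mem_conc.1 (mem_gr.1 hc).1).1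
  gr_one a _ := empty_gr a
  gr_prod a a' b hb _ _ Φ := sum_conc_gr a a' hb Φ
  cuts_gr a b hb _ _ Φ := by
    refine (sum_cuts_gr a hb Φ).trans (Finset.sum_congr rfl fun k _ => ?_)
    congr 1

end PQSymDual

/-! ### The bialgebra structure of `PQSym` -/

namespace PQSym
open ParkingFunction PQSymDual

section
variable {K : Type*} [Field K]

/-- The basis of the `F_a`. -/
noncomputable def basis (K : Type*) [Field K] : Module.Basis ParkingFunction K (PQSym K) :=
  .ofRepr (LinearEquiv.refl K (ParkingFunction →₀ K))

theorem basis_apply (a : ParkingFunction) : basis K a = F K a := rfl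

/-- The pairing of the tensor squares separates the elements of the tensor square of `PQSym`. -/
theorem eq_of_tensorPair {s t : PQSym K ⊗[K] PQSym K}
    (h : ∀ p q : PQSymDual K, tensorPair (p ⊗ₜ q) s = tensorPair (p ⊗ₜ q) t) : s = t := by
  classical
  let B := (basis K).tensorProduct (basis K)
  have key (i : ParkingFunction × ParkingFunction) :
      tensorPair (G K i.1 ⊗ₜ[K] G K i.2) = B.coord i := by
    refine B.ext fun j => ?_
    rw [Module.Basis.coord_apply, Module.Basis.repr_self, Finsupp.single_apply,
      Module.Basis.tensorProduct_apply, basis_apply, basis_apply, tensorPair_tmul, pair_G_F,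
      pair_G_F]
    obtain ⟨i, i'⟩ := i
    obtain ⟨j, j'⟩ := j
    by_cases h1 : i = j <;> by_cases h2 : i' = j' <;>
      simp [h1, h2, Prod.ext_iff, eq_comm (a := j), eq_comm (a := j')]
  refine B.ext_elem fun i => ?_
  rw [← Module.Basis.coord_apply, ← Module.Basis.coord_apply, ← key]
  exact h _ _

/-- The pairing of `(p₁ ⊗ p₂, q₁ ⊗ q₂)` and `(u₁ ⊗ u₂, v₁ ⊗ v₂)` with the value
`⟨p₁, u₁⟩ ⟨p₂, v₁⟩ ⟨q₁, u₂⟩ ⟨q₂, v₂⟩`. -/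
noncomputable def quadPair (s t : PQSymDual K ⊗[K] PQSymDual K) (U V : PQSym K ⊗[K] PQSym K) : K :=
  TensorProduct.dualDistrib K _ _ (tensorPair s ⊗ₜ tensorPair t)
    (TensorProduct.tensorTensorTensorComm K _ _ _ _ (U ⊗ₜ V))

theorem tensorPair_mul_right (p q : PQSymDual K) (U V : PQSym K ⊗[K] PQSym K) :
    tensorPair (p ⊗ₜ q) (U * V) =
      quadPair (CoalgebraStruct.comul p) (CoalgebraStruct.comul q) U V := by
  induction U with
  | zero => simp [quadPair]
  | add U U' h h' => simp only [quadPair, add_mul, map_add, TensorProduct.add_tmul] at h h' ⊢; rw [h, h']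
  | tmul u u' =>
    induction V with
    | zero => simp [quadPair]
    | add V V' h h' =>
      simp only [quadPair, mul_add, map_add, TensorProduct.tmul_add] at h h' ⊢; rw [h, h']
    | tmul v v' =>
      rw [Algebra.TensorProduct.tmul_mul_tmul, tensorPair_tmul, quadPair,
        TensorProduct.tensorTensorTensorComm_tmul, TensorProduct.dualDistrib_apply,
        tensorPair_comul, tensorPair_comul, LinearMap.mul'_apply, LinearMap.mul'_apply]

theorem quadPair_tmul (p p' q q' : PQSymDual K) (U V : PQSym K ⊗[K] PQSym K) :
    quadPair (p ⊗ₜ p') (q ⊗ₜ q') U V = tensorPair (p ⊗ₜ q) U * tensorPair (p' ⊗ₜ q') V := by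
  induction U with
  | zero => simp [quadPair]
  | add U U' h h' =>
    simp only [quadPair, add_mul, map_add, TensorProduct.add_tmul] at h h' ⊢; rw [h, h']
  | tmul u u' =>
    induction V with
    | zero => simp [quadPair]
    | add V V' h h' =>
      simp only [quadPair, mul_add, map_add, TensorProduct.tmul_add] at h h' ⊢; rw [h, h']
    | tmul v v' =>
      rw [quadPair, TensorProduct.tensorTensorTensorComm_tmul, TensorProduct.dualDistrib_apply]
      simp only [tensorPair_tmul]
      ring

theorem tensorPair_mul_left (s t : PQSymDual K ⊗[K] PQSymDual K) (x y : PQSym K) :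
    tensorPair (s * t) (x ⊗ₜ y) = quadPair s t (Coalgebra.comul x) (Coalgebra.comul y) := by
  induction s with
  | zero => simp [quadPair]
  | add s s' h h' =>
    simp only [quadPair, add_mul, map_add, TensorProduct.add_tmul, LinearMap.add_apply] at h h' ⊢
    rw [h, h']
  | tmul p p' =>
    induction t with
    | zero => simp [quadPair]
    | add t t' h h' =>
      simp only [quadPair, mul_add, map_add, TensorProduct.tmul_add, LinearMap.add_apply] at h h' ⊢
      rw [h, h']
    | tmul q q' =>
      rw [Algebra.TensorProduct.tmul_mul_tmul, tensorPair_tmul, quadPair_tmul, ← pair_mulHom,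
        ← pair_mulHom]
      rfl

/-- Tested against `p ⊗ q`: `⟨p ⊗ q, Δ(xy)⟩ = ⟨pq, xy⟩ = ⟨Δ(pq), x ⊗ y⟩ = ⟨Δp Δq, x ⊗ y⟩`, where the
last equality is the known compatibility in the dual. Transposing back through `quadPair` gives `⟨p
⊗ q, Δx Δy⟩`. -/
theorem comul_mul (x y : PQSym K) :
    Coalgebra.comul (R := K) (x * y) = Coalgebra.comul x * Coalgebra.comul y := by
  refine eq_of_tensorPair fun p q => ?_
  let _ := (PQSymDual.isBasis K).bialgebra
  rw [tensorPair_mul_right, ← tensorPair_mul_left, ← pair_mulHom]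
  have h1 : CoalgebraStruct.comul (R := K) p * CoalgebraStruct.comul q =
      CoalgebraStruct.comul (R := K) (p * q) := (Bialgebra.comul_mul (R := K) p q).symm
  rw [h1, tensorPair_comul]
  rfl

theorem counit_F (a : ParkingFunction) [Decidable (a = empty)] :
    Coalgebra.counit (R := K) (F K a) = if a = empty then 1 else 0 :=
  (counitHom_F a).trans (by congr)

theorem comul_one : Coalgebra.comul (R := K) (1 : PQSym K) = 1 ⊗ₜ 1 := by
  refine (comul_F empty).trans ?_
  have h0 : empty.size = 0 := rfl
  rw [h0, zero_add, Finset.sum_range_one, drop_zero, take_size _ (by rw [h0]), one_def]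

/-- The counit is the pairing with the unit of the dual, which is group-like. -/
theorem counit_mul (x y : PQSym K) :
    Coalgebra.counit (R := K) (x * y) = Coalgebra.counit (R := K) x * Coalgebra.counit (R := K) y := by
  have h1 : CoalgebraStruct.comul (R := K) (1 : PQSymDual K) = 1 ⊗ₜ 1 :=
    (PQSymDual.isBasis K).comul_one
  rw [← pair_one, ← LinearMap.mul'_apply (R := K), ← tensorPair_comul, h1, tensorPair_tmul]

noncomputable instance : Bialgebra K (PQSym K) :=
  Bialgebra.mk' K (PQSym K)
    (by classical exact (counit_F empty).trans (if_pos rfl))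
    (fun {x y} => counit_mul x y) comul_one (fun {x y} => comul_mul x y)

theorem isConnectedGraded : IsConnectedGraded (basis K) size where
  exists_unit := ⟨empty, rfl, rfl, fun a ha => size_eq_zero.1 ha⟩
  mul_mem a b := by
    rw [basis_apply, basis_apply, F_mul]
    exact sum_mem fun c hc => size_of_mem_shiftedShuffle hc ▸ basis_mem_homog (basis K) size c
  comul_mem a := by
    rw [basis_apply]
    have h : CoalgebraStruct.comul (R := K) (F K a) = _ := comul_F a
    rw [h]
    refine sum_mem fun i hi => ?_
    refine tmul_mem_tensorHomog (basis_mem_homog (basis K) size _) (basis_mem_homog (basis K) size _) ?_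
    have := Finset.mem_range.1 hi
    rw [size_take, size_drop]; omega
  counit_one := Bialgebra.counit_one
  counit_eq_zero a ha := by
    classical
    rw [basis_apply]
    refine (counit_F a).trans (if_neg fun h => ha ?_)
    rw [h]; rfl

end

end PQSym

/-! ## Parent maps and parking maps are equinumerous -/

section Counting
variable {β : Type*} [DecidableEq β]

/-- The map `p` sends each vertex in `S` to its parent, in `S` or in the set `Q` of roots, such that
no nonempty subset of `S` is closed; the elements outside of `S` are fixed. -/
structure IsParentMap (Q S : Finset β) (p : β → β) : Prop where
  fixed : ∀ v, v ∉ S → p v = v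
  mem : ∀ v ∈ S, p v ∈ Q ∪ S
  exists_notMem : ∀ X ⊆ S, X.Nonempty → ∃ v ∈ X, p v ∉ X

/-- The function `w` is positive on `S`, vanishes elsewhere, and satisfies the condition of a parking
function, with the `i`-th bound relaxed by `k - 1`. -/
structure IsParkingMap (k : ℕ) (S : Finset β) (w : β → ℕ) : Prop where
  eq_zero : ∀ v, v ∉ S → w v = 0
  pos : ∀ v ∈ S, 1 ≤ w v
  lt : ∀ i < k + S.card, i < k + (S.filter fun v => w v ≤ i).card

/-! ### Parent maps: deleting a root. -/

section Parent
variable {Q S T : Finset β} {q : β} {p : β → β}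

/-- When the root `q` is deleted, its children, the elements of `T`, become roots. -/
theorem IsParentMap.of_insert (h : IsParentMap (insert q Q) S p)
    (hp : S.filter (fun v => p v = q) = T) :
    IsParentMap (Q ∪ T) (S \ T) ((S \ T).piecewise p id) where
  fixed v hv := Finset.piecewise_eq_of_notMem _ _ _ hv
  mem v hv := by
    rw [Finset.piecewise_eq_of_mem _ _ _ hv]
    obtain ⟨hvS, hvT⟩ := Finset.mem_sdiff.1 hv
    have hq : p v ≠ q := fun hq => hvT (hp ▸ Finset.mem_filter.2 ⟨hvS, hq⟩)
    have := h.mem v hvS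
    simp only [Finset.mem_union, Finset.mem_insert, hq, false_or, Finset.mem_sdiff] at this ⊢
    tauto
  exists_notMem X hX hne := by
    obtain ⟨v, hv, hpv⟩ := h.exists_notMem X (hX.trans Finset.sdiff_subset) hne
    exact ⟨v, hv, by rwa [Finset.piecewise_eq_of_mem _ _ _ (hX hv)]⟩

theorem IsParentMap.insert (hS : q ∉ S) (hT : T ⊆ S) (h : IsParentMap (Q ∪ T) (S \ T) p) :
    IsParentMap (insert q Q) S (T.piecewise (fun _ => q) p) where
  fixed v hv := by
    rw [Finset.piecewise_eq_of_notMem _ _ _ fun h => hv (hT h)]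
    exact h.fixed v fun h => hv (Finset.sdiff_subset h)
  mem v hv := by
    by_cases hvT : v ∈ T
    · rw [Finset.piecewise_eq_of_mem _ _ _ hvT]
      simp
    · rw [Finset.piecewise_eq_of_notMem _ _ _ hvT]
      have := h.mem v (Finset.mem_sdiff.2 ⟨hv, hvT⟩)
      simp only [Finset.mem_union, Finset.mem_sdiff, Finset.mem_insert] at this ⊢
      rcases this with (h | h) | h
      · exact .inl (.inr h)
      · exact .inr (hT h)
      · exact .inr h.1
  exists_notMem X hX hne := by
    by_cases hXT : ∃ v ∈ X, v ∈ T
    · obtain ⟨v, hv, hvT⟩ := hXT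
      refine ⟨v, hv, ?_⟩
      rw [Finset.piecewise_eq_of_mem _ _ _ hvT]
      exact fun h => hS (hX h)
    · push Not at hXT
      obtain ⟨v, hv, hpv⟩ :=
        h.exists_notMem X (fun v hv => Finset.mem_sdiff.2 ⟨hX hv, hXT v hv⟩) hne
      exact ⟨v, hv, by rwa [Finset.piecewise_eq_of_notMem _ _ _ (hXT v hv)]⟩

theorem IsParentMap.filter_eq (hQ : q ∉ Q) (hS : q ∉ S) (hT : T ⊆ S)
    (h : IsParentMap (Q ∪ T) (S \ T) p) :
    S.filter (fun v => T.piecewise (fun _ => q) p v = q) = T := by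
  ext v
  rw [Finset.mem_filter]
  by_cases hvT : v ∈ T
  · simp [hvT, hT hvT]
  · rw [Finset.piecewise_eq_of_notMem _ _ _ hvT]
    refine iff_of_false ?_ hvT
    rintro ⟨hv, rfl⟩
    have := h.mem v (Finset.mem_sdiff.2 ⟨hv, hvT⟩)
    simp only [Finset.mem_union, Finset.mem_sdiff] at this
    rcases this with (h | h) | h
    · exact hQ h
    · exact hS (hT h)
    · exact hS h.1

/-- A parent map is determined by the children of one root and the parent map of the rest. -/
def parentMapEquiv (hQ : q ∉ Q) (hS : q ∉ S) :
    {p // IsParentMap (insert q Q) S p} ≃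
      Σ T : {T : Finset β // T ⊆ S}, {p // IsParentMap (Q ∪ T.1) (S \ T.1) p} :=
  (Equiv.sigmaFiberEquiv fun p : {p // IsParentMap (insert q Q) S p} =>
    (⟨S.filter fun v => p.1 v = q, Finset.filter_subset _ _⟩ : {T : Finset β // T ⊆ S})).symm.trans
  (Equiv.sigmaCongrRight fun T =>
    { toFun p := ⟨_, p.1.2.of_insert (congrArg Subtype.val p.2)⟩
      invFun p := ⟨⟨_, p.2.insert hS T.2⟩, Subtype.ext (p.2.filter_eq hQ hS T.2)⟩
      left_inv p := by
        obtain ⟨⟨p, h⟩, hp⟩ := p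
        refine Subtype.ext (Subtype.ext (funext fun v => ?_))
        have hpT : v ∈ T.1 ↔ v ∈ S ∧ p v = q := by
          rw [← congrArg Subtype.val hp, Finset.mem_filter]
        by_cases hv : v ∈ S
        · by_cases hq : p v = q <;> simp [Finset.piecewise, hpT, hv, hq]
        · simp [Finset.piecewise, hpT, hv, h.fixed v hv]
      right_inv p := by
        obtain ⟨p, h⟩ := p
        refine Subtype.ext (funext fun v => ?_)
        dsimp only
        by_cases hv : v ∈ S \ T.1
        · simp [Finset.piecewise, (Finset.mem_sdiff.1 hv).1, (Finset.mem_sdiff.1 hv).2]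
        · rw [Finset.piecewise_eq_of_notMem _ _ _ hv, h.fixed v hv]
          rfl })

end Parent

/-! ### Parking maps: deleting the ones. -/

section Parking
variable {k : ℕ} {S T : Finset β} {w : β → ℕ}

/-- Elements of `T` always count and the others count with a bound lowered by one; this trades `k +
1` for `k + T.card` in the parking condition, in both directions. -/
theorem card_filter_eq_add_card_filter_sdiff (hT : T ⊆ S) (w w' : β → ℕ) (i : ℕ)
    (h : ∀ v ∈ T, w v ≤ i + 1) (h' : ∀ v ∈ S \ T, w v ≤ i + 1 ↔ w' v ≤ i) :
    (S.filter fun v => w v ≤ i + 1).card = T.card + ((S \ T).filter fun v => w' v ≤ i).card := by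
  rw [← Finset.filter_congr h', ← Finset.card_union_of_disjoint]
  · congr 1
    ext v
    simp only [Finset.mem_filter, Finset.mem_union, Finset.mem_sdiff]
    by_cases hv : v ∈ T
    · simp [hv, hT hv, h v hv]
    · simp [hv]
  · exact Finset.disjoint_sdiff.mono_right (Finset.filter_subset _ _)

theorem IsParkingMap.sub_one (h : IsParkingMap (k + 1) S w) (hT : T ⊆ S)
    (hw : S.filter (fun v => w v = 1) = T) :
    IsParkingMap (k + T.card) (S \ T) (fun v => w v - 1) where
  eq_zero v hv := by
    by_cases hvS : v ∈ S
    · have : v ∈ T := by simpa [hvS] using hv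
      rw [← hw] at this
      rw [(Finset.mem_filter.1 this).2]
    · rw [h.eq_zero v hvS]
  pos v hv := by
    obtain ⟨hvS, hvT⟩ := Finset.mem_sdiff.1 hv
    have h1 : w v ≠ 1 := fun h1 => hvT (hw ▸ Finset.mem_filter.2 ⟨hvS, h1⟩)
    have := h.pos v hvS
    omega
  lt i hi := by
    have hc := Finset.card_sdiff_add_card_eq_card hT
    have := h.lt (i + 1) (by omega)
    rw [card_filter_eq_add_card_filter_sdiff hT w (fun v => w v - 1) i] at this
    · omega
    · intro v hv
      rw [← hw] at hv
      rw [(Finset.mem_filter.1 hv).2]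
      omega
    · intro v _
      omega

theorem IsParkingMap.add_one (h : IsParkingMap (k + T.card) (S \ T) w) (hT : T ⊆ S) :
    IsParkingMap (k + 1) S (S.piecewise (fun v => w v + 1) 0) where
  eq_zero v hv := Finset.piecewise_eq_of_notMem _ _ _ hv
  pos v hv := by
    rw [Finset.piecewise_eq_of_mem _ _ _ hv]
    omega
  lt i hi := by
    cases i with
    | zero => omega
    | succ i =>
      have hc := Finset.card_sdiff_add_card_eq_card hT
      have := h.lt i (by omega)
      rw [card_filter_eq_add_card_filter_sdiff hT _ w i]
      · omega
      · intro v hv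
        rw [Finset.piecewise_eq_of_mem _ _ _ (hT hv),
          h.eq_zero v fun h => (Finset.mem_sdiff.1 h).2 hv]
        omega
      · intro v hv
        rw [Finset.piecewise_eq_of_mem _ _ _ (Finset.mem_sdiff.1 hv).1]
        omega

theorem IsParkingMap.filter_eq (h : IsParkingMap (k + T.card) (S \ T) w) (hT : T ⊆ S) :
    S.filter (fun v => S.piecewise (fun v => w v + 1) 0 v = 1) = T := by
  ext v
  rw [Finset.mem_filter]
  by_cases hvS : v ∈ S
  · rw [Finset.piecewise_eq_of_mem _ _ _ hvS]
    by_cases hvT : v ∈ T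
    · simp [hvS, hvT, h.eq_zero v fun h => (Finset.mem_sdiff.1 h).2 hvT]
    · have := h.pos v (Finset.mem_sdiff.2 ⟨hvS, hvT⟩)
      refine iff_of_false ?_ hvT
      rintro ⟨-, h⟩
      omega
  · exact iff_of_false (fun h => hvS h.1) (fun h => hvS (hT h))

/-- A parking map is determined by the set of its ones and by the other values, decreased by one. -/
def parkingMapEquiv (k : ℕ) (S : Finset β) :
    {w // IsParkingMap (k + 1) S w} ≃
      Σ T : {T : Finset β // T ⊆ S}, {w // IsParkingMap (k + T.1.card) (S \ T.1) w} :=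
  (Equiv.sigmaFiberEquiv fun w : {w // IsParkingMap (k + 1) S w} =>
    (⟨S.filter fun v => w.1 v = 1, Finset.filter_subset _ _⟩ : {T : Finset β // T ⊆ S})).symm.trans
  (Equiv.sigmaCongrRight fun T =>
    { toFun w := ⟨_, w.1.2.sub_one T.2 (congrArg Subtype.val w.2)⟩
      invFun w := ⟨⟨_, w.2.add_one T.2⟩, Subtype.ext (w.2.filter_eq T.2)⟩
      left_inv w := by
        obtain ⟨⟨w, h⟩, hw⟩ := w
        refine Subtype.ext (Subtype.ext (funext fun v => ?_))
        by_cases hv : v ∈ S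
        · have := h.pos v hv
          simp only [Finset.piecewise, hv, if_true]
          omega
        · simp [Finset.piecewise, hv, h.eq_zero v hv]
      right_inv w := by
        obtain ⟨w, h⟩ := w
        refine Subtype.ext (funext fun v => ?_)
        by_cases hv : v ∈ S
        · simp [Finset.piecewise, hv]
        · simp [Finset.piecewise, hv, h.eq_zero v fun h => hv (Finset.sdiff_subset h)] })

end Parking

theorem isParentMap_empty {Q : Finset β} {p : β → β} : IsParentMap Q ∅ p ↔ p = id :=
  ⟨fun h => funext fun v => h.fixed v (Finset.notMem_empty v), by
    rintro rfl
    exact ⟨fun _ _ => rfl, by simp, fun X hX hne => absurd (Finset.subset_empty.1 hX) hne.ne_empty⟩⟩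

theorem isParkingMap_empty {γ : Type*} {k : ℕ} {w : γ → ℕ} : IsParkingMap k ∅ w ↔ w = 0 :=
  ⟨fun h => funext fun v => h.eq_zero v (Finset.notMem_empty v), by
    rintro rfl
    exact ⟨fun _ _ => rfl, by simp, by simp⟩⟩

theorem not_isParentMap {S : Finset β} (hS : S.Nonempty) (p : β → β) : ¬ IsParentMap ∅ S p := by
  intro h
  obtain ⟨v, hv, hpv⟩ := h.exists_notMem S subset_rfl hS
  exact hpv (by simpa using h.mem v hv)

theorem not_isParkingMap {γ : Type*} {S : Finset γ} (hS : S.Nonempty) (w : γ → ℕ) : ¬ IsParkingMap 0 S w := by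
  intro h
  have := h.lt 0 (by simpa using hS.card_pos)
  obtain ⟨v, hv⟩ := Finset.card_pos.1 ((Nat.zero_add _).subst (motive := fun n => 0 < n) this)
  obtain ⟨hv, h0⟩ := Finset.mem_filter.1 hv
  have := h.pos v hv
  omega

/-- Both sides obey one recursion: with `q` removed from `Q`, a subset `T` of `S` joins the rest
`R`, and `(Q, S)` becomes `(R ∪ T, S \ T)`, whose total size is smaller by one. With `Q` empty, both
sides are singletons or empty according as `S` is empty or not. -/
theorem nonempty_parentMap_equiv_parkingMap (n : ℕ) (Q S : Finset β) (hn : Q.card + S.card ≤ n)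
    (hd : Disjoint Q S) :
    Nonempty ({p // IsParentMap Q S p} ≃ {w : β → ℕ // IsParkingMap Q.card S w}) := by
  induction n generalizing Q S with
  | zero =>
    obtain rfl : S = ∅ := Finset.card_eq_zero.1 (by omega)
    simp only [isParentMap_empty, isParkingMap_empty]
    exact ⟨Equiv.ofUnique _ _⟩
  | succ n ih =>
    rcases Q.eq_empty_or_nonempty with rfl | ⟨q, hq⟩
    · rcases S.eq_empty_or_nonempty with rfl | hS
      · simp only [isParentMap_empty, isParkingMap_empty]
        exact ⟨Equiv.ofUnique _ _⟩
      · rw [Finset.card_empty]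
        have := Subtype.isEmpty_of_false (not_isParentMap hS)
        have := Subtype.isEmpty_of_false (not_isParkingMap hS)
        exact ⟨Equiv.equivOfIsEmpty _ _⟩
    · obtain ⟨R, hR, rfl⟩ : ∃ R, q ∉ R ∧ insert q R = Q :=
        ⟨Q.erase q, Finset.notMem_erase q Q, Finset.insert_erase hq⟩
      rw [Finset.disjoint_insert_left] at hd
      rw [Finset.card_insert_of_notMem hR] at hn ⊢
      have key (T : {T : Finset β // T ⊆ S}) :
          Nonempty ({p // IsParentMap (R ∪ T.1) (S \ T.1) p} ≃
            {w : β → ℕ // IsParkingMap (R.card + T.1.card) (S \ T.1) w}) := by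
        have hc := Finset.card_sdiff_add_card_eq_card T.2
        have hRT := Finset.card_union_of_disjoint (hd.2.mono_right T.2)
        rw [← hRT]
        refine ih _ _ (by omega) ?_
        rw [Finset.disjoint_union_left]
        exact ⟨hd.2.mono_right Finset.sdiff_subset, Finset.disjoint_sdiff⟩
      exact ⟨(parentMapEquiv hR hd.1).trans ((Equiv.sigmaCongrRight fun T => (key T).some).trans
        (parkingMapEquiv R.card S).symm)⟩

end Counting

/-! ## Ordered forests and parking functions are equinumerous -/

namespace OrderedForest
variable {n : ℕ}

theorem mem_map_some {v : Option (Fin n)} :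
    v ∈ Finset.univ.map (Function.Embedding.some (α := Fin n)) ↔ v ≠ none := by
  cases v <;> simp

/-- The vertices that lead to a vertex on a cycle form a nonempty set closed under `p`. -/
theorem acyclic_of_isParentMap {p : Option (Fin n) → Option (Fin n)}
    (hp : IsParentMap {none} (Finset.univ.map .some) p) (v : Fin n) :
    ¬ Relation.TransGen (fun x y => p (some x) = some y) v v := by
  classical
  intro h
  obtain ⟨x, hx, hpx⟩ := hp.exists_notMem
    ((Finset.univ.filter fun w => Relation.TransGen (fun x y => p (some x) = some y) w v).map .some)
    (Finset.map_subset_map.2 (Finset.subset_univ _)) ⟨some v, by simpa using h⟩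
  obtain ⟨w, hw, rfl⟩ := Finset.mem_map.1 hx
  refine hpx (Finset.mem_map.2 ?_)
  have hw := (Finset.mem_filter.1 hw).2
  obtain ⟨y, hy, hyv⟩ := Relation.TransGen.head'_iff.1 hw
  refine ⟨y, ?_, hy.symm⟩
  rw [Finset.mem_filter]
  refine ⟨Finset.mem_univ _, ?_⟩
  rcases Relation.reflTransGen_iff_eq_or_transGen.1 hyv with rfl | hyv
  · exact h
  · exact hyv

theorem isParentMap_bind (F : OrderedForest) :
    IsParentMap {none} (Finset.univ.map .some) fun v => v.bind F.parent where
  fixed v hv := by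
    rw [mem_map_some, not_not] at hv
    rw [hv]; rfl
  mem v hv := by
    rw [Finset.mem_union, mem_map_some, Finset.mem_singleton]
    exact em _
  exists_notMem X hX hne := by
    obtain ⟨v, hv⟩ := hne
    obtain ⟨w, rfl⟩ := Option.ne_none_iff_exists'.1 (mem_map_some.1 (hX hv))
    obtain ⟨u, ⟨u', hu, hu'⟩, h, -⟩ := F.exists_first_mem (I := Fin.val '' {v | some v ∈ X})
      ⟨w, hv, rfl⟩
    obtain rfl := Fin.ext hu'
    refine ⟨some u', hu, fun hmem => ?_⟩
    obtain ⟨y, hy⟩ := Option.ne_none_iff_exists'.1 (mem_map_some.1 (hX hmem))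
    refine h y hy ⟨y, ?_, rfl⟩
    rwa [hy] at hmem

variable (n) in
/-- The ordered forests with `n` vertices as parent maps, with `none` as the only root. -/
def parentMapEquivForest :
    {p // IsParentMap {none} (Finset.univ.map (Function.Embedding.some (α := Fin n))) p} ≃
      {F : OrderedForest | F.size = n} where
  toFun p := ⟨⟨n, fun v => p.1 (some v), acyclic_of_isParentMap p.2⟩, rfl⟩
  invFun F := ⟨fun v => v.bind (F.2 ▸ F.1.parent), by
    obtain ⟨F, rfl⟩ := F
    exact F.isParentMap_bind⟩
  left_inv p := by
    refine Subtype.ext (funext fun v => ?_)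
    cases v with
    | none => exact (p.2.fixed none (by simp)).symm
    | some v => rfl
  right_inv F := by
    obtain ⟨F, rfl⟩ := F
    rfl

end OrderedForest

namespace ParkingFunction
variable {n : ℕ}

theorem countP_ofFn_eq_card_filter (w : Option (Fin n) → ℕ) (i : ℕ) :
    (List.ofFn fun j => w (some j)).countP (· ≤ i) =
      ((Finset.univ.map (Function.Embedding.some (α := Fin n))).filter fun v => w v ≤ i).card := by
  rw [Finset.filter_map, Finset.card_map, List.ofFn_eq_map, List.countP_map,
    List.countP_eq_length_filter]
  rfl

theorem isParkingMap_iff {w : Option (Fin n) → ℕ} :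
    IsParkingMap 1 (Finset.univ.map .some) w ↔
      w none = 0 ∧ IsParking (List.ofFn fun j => w (some j)) := by
  have hc : (Finset.univ.map (Function.Embedding.some (α := Fin n))).card = n := by simp
  simp only [IsParking, countP_ofFn_eq_card_filter, List.length_ofFn]
  constructor
  · rintro ⟨h1, h2, h3⟩
    refine ⟨h1 none (by simp), ?_, fun i hi => ?_⟩
    · rw [List.forall_mem_ofFn_iff]
      exact fun j => h2 _ (by simp)
    · have := h3 i (by omega)
      omega
  · rintro ⟨h1, h2, h3⟩
    rw [List.forall_mem_ofFn_iff] at h2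
    refine ⟨fun v hv => ?_, fun v hv => ?_, fun i hi => ?_⟩
    · rw [OrderedForest.mem_map_some, not_not] at hv
      rw [hv, h1]
    · obtain ⟨w, rfl⟩ := Option.ne_none_iff_exists'.1 (OrderedForest.mem_map_some.1 hv)
      exact h2 w
    · have := h3 i (by omega)
      omega

variable (n) in
/-- The parking functions of length `n` as parking maps. -/
def parkingMapEquivParkingFunction :
    {w // IsParkingMap 1 (Finset.univ.map (Function.Embedding.some (α := Fin n))) w} ≃
      {a : ParkingFunction | a.size = n} where
  toFun w := ⟨⟨_, (isParkingMap_iff.1 w.2).2⟩, List.length_ofFn⟩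
  invFun a := ⟨fun v => v.elim 0 fun j => a.1.1.get (j.cast a.2.symm), isParkingMap_iff.2 ⟨rfl, by
    obtain ⟨a, rfl⟩ := a
    have : (List.ofFn a.1.get) = a.1 := List.ofFn_get a.1
    exact this.symm ▸ a.2⟩⟩
  left_inv w := by
    refine Subtype.ext (funext fun v => ?_)
    cases v with
    | none => exact (isParkingMap_iff.1 w.2).1.symm
    | some v => simp; rfl
  right_inv a := by
    obtain ⟨a, rfl⟩ := a
    exact Subtype.ext (Subtype.ext (List.ofFn_get a.1))

end ParkingFunction

/-- The virtual vertex `none` is the only root, with the roots of the forest as its children. One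
root corresponds to `k = 1`, the parking condition without relaxation. -/
theorem OrderedForest.nonempty_equiv_parkingFunction (n : ℕ) :
    Nonempty ({F : OrderedForest | F.size = n} ≃ {a : ParkingFunction | a.size = n}) := by
  obtain ⟨e⟩ := nonempty_parentMap_equiv_parkingMap (β := Option (Fin n)) _ {none}
    (Finset.univ.map .some) le_rfl (by simp)
  exact ⟨(parentMapEquivForest n).symm.trans
    (e.trans (ParkingFunction.parkingMapEquivParkingFunction n))⟩

theorem OrderedForest.finite_size (n : ℕ) : {F : OrderedForest | F.size = n}.Finite := by
  obtain ⟨e⟩ := nonempty_equiv_parkingFunction n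
  exact Set.finite_coe_iff.1 <| (Equiv.finite_iff e).2 <|
    Set.finite_coe_iff.2 (ParkingFunction.finite_size n)

theorem Ho.homogeneous_eq_homog (K : Type*) [Field K] (n : ℕ) :
    Ho.homogeneous K n = homog (Ho.basis K) Ho.cutData.size n := by
  have h : Ho.S K = ⇑(Ho.basis K) := funext fun F => (Ho.basis_apply K F).symm
  unfold Ho.homogeneous homog
  rw [h]
  rfl

theorem PQSymDual.homogeneous_eq_homog (K : Type*) [Field K] (n : ℕ) :
    PQSymDual.homogeneous K n = homog (PQSymDual.basis K) PQSymDual.cutData.size n := by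
  have h : PQSymDual.G K = ⇑(PQSymDual.basis K) :=
    funext fun a => (PQSymDual.basis_apply K a).symm
  unfold PQSymDual.homogeneous homog
  rw [h]
  rfl

theorem mainTheorem1 (K : Type*) [Field K] [CharZero K] :
    IsHopfAlgebra K (Ho K) ∧ IsHopfAlgebra K (PQSym K) ∧ IsHopfAlgebra K (PQSymDual K) ∧
      ∃ e : Ho K ≃ₐc[K] PQSymDual K,
        ∀ (n : ℕ) (x : Ho K), x ∈ Ho.homogeneous K n ↔ e x ∈ PQSymDual.homogeneous K n := by
  refine ⟨(Ho.isBasis K).isHopfAlgebra, PQSym.isConnectedGraded.isHopfAlgebra,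
    (PQSymDual.isBasis K).isHopfAlgebra, ?_⟩
  obtain ⟨e, he⟩ := (Ho.isBasis K).exists_graded_bialgEquiv (PQSymDual.isBasis K)
    OrderedForest.finite_size ParkingFunction.finite_size
    fun n => Nat.card_congr (OrderedForest.nonempty_equiv_parkingFunction n).some
  refine ⟨e, fun n x => ?_⟩
  rw [Ho.homogeneous_eq_homog, PQSymDual.homogeneous_eq_homog]
  exact he n x
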